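/- Indices $i$ are taken modulo $3$. Let $z_1,z_2$ be the coordinates of the torus $T=(\mathbb{C}^\times)^2$ and put $z_3=z_0=1/(z_1z_2)$. For $i=1,2,3$ let $C_i=\{(u_i,v_i)\in\mathbb{C}^2 : u_iv_i\neq 1\}$. Let $\check X_{\mathbb{C}}$ be the scheme over $\mathbb{C}$ obtained by gluing each of $C_1,C_2,C_3$ to $T$ by the open immersions $T\hookrightarrow C_i$ given by $$v_i=z_{i+1}^{-1},\qquad u_iv_i=1+z_i^{-1}z_{i+1}^{-2}.$$ (a) Let $P$ be the complete toric surface whose fan has the rays generated by $\rho_1=(2,-1)$, $\rho_2=(-1,2)$, $\rho_3=(-1,-1)$, with open orbit $T$. Let $D_i$ be the toric divisor of $\rho_i$, and let $p_i\in D_i$ be the point $V_i=0$, $Z_i=-1$, where $V_i=z_{i+1}^{-1}$ and $Z_i=z_i^{-1}z_{i+1}^{-2}$ are the coordinates on the affine toric chart $\mathbb{C}\times\mathbb{C}^\times$ of the ray $\rho_i$. Let $\pi:B\to P$ be the blowing up of $P$ at $p_1,p_2,p_3$ (with their reduced structure). Then there is an isomorphism from $\check X_{\mathbb{C}}$ onto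 the complement in $B$ of the strict transforms of $D_1,D_2,D_3$ which, composed with $\pi$, restricts on $T$ to the inclusion $T\subset P$. (b) The function $z_1+z_2+\frac{1}{z_1z_2}$ on $T$ extends to a morphism $W:\check X_{\mathbb{C}}\to\mathbb{A}^1_{\mathbb{C}}$ which is a proper elliptic fibration: $W$ is proper and flat, $\check X_{\mathbb{C}}$ is smooth over $\mathbb{C}$, and all but finitely many scheme-theoretic fibres over points of $\mathbb{C}$ are elliptic curves. More precisely, exactly three fibres are of type $I_1$ (irreducible nodal rational curves, that is, nodal plane cubics) and all other fibres over points of $\mathbb{C}$ are elliptic curves. (c) For each $i$ the axis $\{v_i=0\}\subset C_i$ is a closed subscheme of $\check X_{\mathbb{C}}$ which $W$ maps isomorphically onto $\mathbb{A}^1_{\mathbb{C}}$, so that it is a section of $W$. The three axes are pairwise disjoint, and their union is the complement of $T$ in $\check X_{\mathbb{C}}$. -/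

import Mathlib

open CategoryTheory CategoryTheory.Limits AlgebraicGeometry TopologicalSpace

noncomputable section

namespace CPSMirror

attribute [local instance] MvPolynomial.gradedAlgebra

/-! ### Characters of the two-dimensional torus -/

/-- The exponents of the three characters `z₁, z₂, z₃ = 1 / (z₁ z₂)`, indexed modulo `3`
(so that the index `3` is written `0`). -/
def expo : Fin 3 → ℤ × ℤ := ![(-1, -1), (1, 0), (0, 1)]

/-- The coordinate ring `ℂ[z₁^{±1}, z₂^{±1}]` of the torus `(ℂˣ)²`. -/
abbrev TorusRing : Type := AddMonoidAlgebra ℂ (ℤ × ℤ)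

/-- The character `z₁^a z₂^b` for `m = (a, b)`. -/
def chi (m : ℤ × ℤ) : TorusRing := AddMonoidAlgebra.single m 1

lemma chi_zero : chi 0 = 1 := rfl

lemma chi_add (m n : ℤ × ℤ) : chi (m + n) = chi m * chi n := by
  simp [chi, AddMonoidAlgebra.single_mul_single]

lemma chi_mul_neg (m : ℤ × ℤ) : chi m * chi (-m) = 1 := by
  rw [← chi_add, add_neg_cancel, chi_zero]

lemma isUnit_chi (m : ℤ × ℤ) : IsUnit (chi m) := .of_mul_eq_one _ (chi_mul_neg m)

/-- The torus `(ℂˣ)²`. -/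
def torus : Scheme.{0} := Spec (.of TorusRing)

/-! ### The glued space -/

/-- The coordinate ring of `{(u, v) ∈ ℂ² | u v ≠ 1}`; here `u` is `X 0` and `v` is `X 1`. -/
abbrev ChartRing : Type :=
  Localization.Away (MvPolynomial.X 0 * MvPolynomial.X 1 - 1 : MvPolynomial (Fin 2) ℂ)

/-- The function `u` on the chart. -/
def uu : ChartRing := algebraMap (MvPolynomial (Fin 2) ℂ) ChartRing (MvPolynomial.X 0)

/-- The function `v` on the chart. -/
def vv : ChartRing := algebraMap (MvPolynomial (Fin 2) ℂ) ChartRing (MvPolynomial.X 1)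

/-- The chart `{(u, v) ∈ ℂ² | u v ≠ 1}`. -/
def chart : Scheme.{0} := Spec (.of ChartRing)

/-- The exponent of `Z_i = z_i⁻¹ z_{i+1}⁻²`. -/
def ZZ (i : Fin 3) : ℤ × ℤ := -expo i - 2 • expo (i + 1)

/-- The exponent of `V_i = z_{i+1}⁻¹`. -/
def VV (i : Fin 3) : ℤ × ℤ := -expo (i + 1)

/-- The polynomial part of the transition: `v = z_{i+1}⁻¹` and `u = z_{i+1} (1 + z_i⁻¹ z_{i+1}⁻²)`,
that is `u v = 1 + z_i⁻¹ z_{i+1}⁻²`. -/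
def prePoly (i : Fin 3) : MvPolynomial (Fin 2) ℂ →ₐ[ℂ] TorusRing :=
  MvPolynomial.aeval ![chi (-VV i) * (1 + chi (ZZ i)), chi (VV i)]

lemma prePoly_uv (i : Fin 3) :
    prePoly i (MvPolynomial.X 0 * MvPolynomial.X 1 - 1) = chi (ZZ i) := by
  simp only [prePoly, map_sub, map_mul, map_one, MvPolynomial.aeval_X, Matrix.cons_val_zero,
    Matrix.cons_val_one]
  linear_combination (1 + chi (ZZ i)) * chi_mul_neg (VV i)

lemma isUnit_prePoly_uv (i : Fin 3) :
    IsUnit ((prePoly i).toRingHom (MvPolynomial.X 0 * MvPolynomial.X 1 - 1)) := by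
  change IsUnit (prePoly i _)
  rw [prePoly_uv i]
  exact isUnit_chi _

/-- The transition from the torus to the `i`-th chart, on coordinate rings. -/
def transition (i : Fin 3) : ChartRing →+* TorusRing :=
  Localization.awayLift (prePoly i).toRingHom _ (isUnit_prePoly_uv i)

lemma transition_algebraMap (i : Fin 3) (p : MvPolynomial (Fin 2) ℂ) :
    transition i (algebraMap _ _ p) = prePoly i p :=
  IsLocalization.Away.lift_eq _ (isUnit_prePoly_uv i) p

lemma transition_v (i : Fin 3) : transition i vv = chi (VV i) := by
  rw [vv, transition_algebraMap]; simp [prePoly]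

lemma transition_u (i : Fin 3) : transition i uu = chi (-VV i) * (1 + chi (ZZ i)) := by
  rw [uu, transition_algebraMap]; simp [prePoly]

/-- The inclusion of the torus in the `i`-th chart. -/
def torusToChart (i : Fin 3) : torus ⟶ chart := Spec.map (CommRingCat.ofHom (transition i))

/-- Two units define an algebra homomorphism from the torus ring. -/
def torusLift {L : Type} [CommRing L] [Algebra ℂ L] (a b : Lˣ) : TorusRing →ₐ[ℂ] L :=
  AddMonoidAlgebra.lift ℂ L (ℤ × ℤ)
    { toFun := fun m => ((a ^ m.toAdd.1 * b ^ m.toAdd.2 : Lˣ) : L)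
      map_one' := by simp
      map_mul' := fun m n => by
        rw [← Units.val_mul]
        congr 1
        simp only [toAdd_mul, Prod.fst_add, Prod.snd_add, zpow_add]
        exact mul_mul_mul_comm _ _ _ _ }

lemma torusLift_chi {L : Type} [CommRing L] [Algebra ℂ L] (a b : Lˣ) (m : ℤ × ℤ) :
    torusLift a b (chi m) = ((a ^ m.1 * b ^ m.2 : Lˣ) : L) := by
  simp [torusLift, chi]

lemma exists_torusLift {L : Type} [CommRing L] [Algebra ℂ L] (i : Fin 3) (p q : Lˣ) :
    ∃ ψ : TorusRing →ₐ[ℂ] L, ψ (chi (expo (i + 1))) = p ∧ ψ (chi (-expo (i + 1))) = ↑p⁻¹ ∧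
      ψ (chi (ZZ i)) = ↑(q * p⁻¹) := by
  fin_cases i
  · refine ⟨torusLift p q, ?_, ?_, ?_⟩ <;> rw [torusLift_chi] <;> congr 1 <;>
      simp [expo, ZZ, mul_comm]
  · refine ⟨torusLift (p⁻¹ * q⁻¹) p, ?_, ?_, ?_⟩ <;> rw [torusLift_chi] <;> congr 1 <;>
      simp [expo, ZZ, mul_comm]
    rw [pow_two, mul_inv, mul_comm p q, mul_assoc, mul_inv_cancel_left]
  · refine ⟨torusLift q (p⁻¹ * q⁻¹), ?_, ?_, ?_⟩ <;> rw [torusLift_chi] <;> congr 1 <;>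
      simp [expo, ZZ, mul_comm]
    rw [pow_two, mul_assoc, inv_mul_cancel_left, mul_comm]

/-- The characters on which two homomorphisms agree. -/
def eqSubgroup {L : Type} [CommRing L] [Algebra ℂ L] (f g : TorusRing →ₐ[ℂ] L) :
    AddSubgroup (ℤ × ℤ) where
  carrier := {m | f (chi m) = g (chi m)}
  zero_mem' := by simp [chi_zero]
  add_mem' {m n} hm hn := by
    simp only [Set.mem_ofPred_eq, chi_add, map_mul] at *
    rw [hm, hn]
  neg_mem' {m} hm := by
    simp only [Set.mem_ofPred_eq] at *
    have h₁ : f (chi m) * f (chi (-m)) = 1 := by rw [← map_mul, chi_mul_neg, map_one]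
    have h₂ : g (chi m) * g (chi (-m)) = 1 := by rw [← map_mul, chi_mul_neg, map_one]
    rw [← hm] at h₂
    linear_combination g (chi (-m)) * h₁ - f (chi (-m)) * h₂

lemma torus_algHom_ext {L : Type} [CommRing L] [Algebra ℂ L] {f g : TorusRing →ₐ[ℂ] L} (i : Fin 3)
    (h₁ : f (chi (expo (i + 1))) = g (chi (expo (i + 1))))
    (h₂ : f (chi (ZZ i)) = g (chi (ZZ i))) : f = g := by
  have key : ∀ m : ℤ × ℤ, m ∈ eqSubgroup f g := by
    intro m
    have e₁ : expo (i + 1) ∈ eqSubgroup f g := h₁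
    have e₂ : ZZ i ∈ eqSubgroup f g := h₂
    have : ∃ a b : ℤ, m = a • expo (i + 1) + b • ZZ i := by
      obtain ⟨x, y⟩ := m
      fin_cases i
      · exact ⟨x + y, y, by simp [expo, ZZ]⟩
      · exact ⟨y - 2 * x, -x, by simp [expo, ZZ]; ring⟩
      · exact ⟨x - 2 * y, x - y, Prod.ext (by simp [expo, ZZ]; ring) (by simp [expo, ZZ]; ring)⟩
    obtain ⟨a, b, rfl⟩ := this
    exact add_mem (zsmul_mem e₁ a) (zsmul_mem e₂ b)
  exact AddMonoidAlgebra.algHom_ext key (Subsingleton.elim _ _)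

/-- On coordinate rings, the torus is the locus `v ≠ 0` of each chart. -/
lemma transition_isLocalization (i : Fin 3) :
    @IsLocalization.Away ChartRing _ vv TorusRing _ (transition i).toAlgebra := by
  let _ : Algebra ChartRing TorusRing := (transition i).toAlgebra
  have hmap : ∀ x, algebraMap ChartRing TorusRing x = transition i x := fun _ => rfl
  have hv : IsUnit (transition i vv) := by rw [transition_v]; exact isUnit_chi _
  let L := Localization.Away (vv : ChartRing)
  have uv : IsUnit (algebraMap ChartRing L vv) := IsLocalization.Away.algebraMap_isUnit vv
  have huv : IsUnit (algebraMap ChartRing L (uu * vv - 1)) := by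
    have := IsLocalization.Away.algebraMap_isUnit (S := ChartRing)
      (MvPolynomial.X 0 * MvPolynomial.X 1 - 1 : MvPolynomial (Fin 2) ℂ)
    rw [map_sub, map_mul, map_one] at this
    exact this.map _
  obtain ⟨ψ, hψ₁, hψ₂, hψ₃⟩ :=
    exists_torusLift (L := L) i uv.unit⁻¹ (huv.unit * uv.unit⁻¹)
  rw [inv_inv, IsUnit.unit_spec] at hψ₂
  rw [inv_inv, inv_mul_cancel_right, IsUnit.unit_spec] at hψ₃
  have hψφ : ψ.toRingHom.comp (transition i) = algebraMap ChartRing L := by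
    apply IsLocalization.ringHom_ext (Submonoid.powers
      (MvPolynomial.X 0 * MvPolynomial.X 1 - 1 : MvPolynomial (Fin 2) ℂ))
    apply MvPolynomial.ringHom_ext
    · intro c
      simp only [RingHom.comp_apply, transition_algebraMap]
      simp only [prePoly, MvPolynomial.aeval_C]
      change ψ (algebraMap ℂ TorusRing c) = _
      rw [AlgHom.commutes]
      rfl
    · intro j
      simp only [RingHom.comp_apply]
      fin_cases j
      · change ψ (transition i uu) = algebraMap ChartRing L uu
        rw [transition_u, map_mul, map_add, map_one, hψ₃]
        rw [VV, neg_neg, hψ₁]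
        have := uv.val_inv_mul
        rw [map_sub, map_mul, map_one]
        linear_combination (algebraMap ChartRing L uu) * this
      · change ψ (transition i vv) = algebraMap ChartRing L vv
        rw [transition_v, VV, hψ₂]
  let φ' : L →+* TorusRing := IsLocalization.Away.lift (S := L) vv hv
  have hφ' : ∀ x, φ' (algebraMap ChartRing L x) = transition i x :=
    fun x => IsLocalization.Away.lift_eq vv hv x
  have hφψ : ∀ x, φ' (ψ x) = x := by
    let φ'' : L →ₐ[ℂ] TorusRing := { φ' with
      commutes' := fun c => by
        change φ' (algebraMap ℂ L c) = _
        have : algebraMap ℂ L c = algebraMap ChartRing L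
          (algebraMap (MvPolynomial (Fin 2) ℂ) ChartRing (MvPolynomial.C c)) := rfl
        rw [this, hφ', transition_algebraMap, prePoly, MvPolynomial.aeval_C] }
    have h : φ''.comp ψ = AlgHom.id ℂ _ := by
      apply torus_algHom_ext i
      · change φ' (ψ _) = chi _
        have h₁ : φ' (ψ (chi (-expo (i + 1)))) = chi (-expo (i + 1)) := by
          rw [hψ₂, hφ', transition_v, VV]
        have h₂ : φ' (ψ (chi (expo (i + 1)))) * φ' (ψ (chi (-expo (i + 1)))) = 1 := by
          rw [← map_mul, ← map_mul, chi_mul_neg, map_one, map_one]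
        rw [h₁] at h₂
        have h₃ := chi_mul_neg (expo (i + 1))
        linear_combination (chi (expo (i + 1))) * h₂ - φ' (ψ (chi (expo (i + 1)))) * h₃
      · change φ' (ψ _) = chi _
        rw [hψ₃, hφ', map_sub, map_mul, map_one, transition_u, transition_v]
        linear_combination (1 + chi (ZZ i)) * chi_mul_neg (VV i)
    exact fun x => congrArg (fun f => f x) h
  refine ⟨?_, ?_, ?_⟩
  · rintro ⟨_, n, rfl⟩
    simpa [hmap] using hv.pow n
  · intro z
    obtain ⟨⟨a, s⟩, h⟩ := IsLocalization.surj (Submonoid.powers (vv : ChartRing)) (ψ z)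
    refine ⟨⟨a, s⟩, ?_⟩
    have := congrArg φ' h
    rw [map_mul, hφ', hφ', hφψ] at this
    exact this
  · intro x y h
    have h' := congrArg ψ h
    change ψ.toRingHom.comp (transition i) x = ψ.toRingHom.comp (transition i) y at h'
    rw [hψφ] at h'
    exact IsLocalization.exists_of_eq h'

instance torusToChart_isOpenImmersion (i : Fin 3) : IsOpenImmersion (torusToChart i) := by
  let _ : Algebra ChartRing TorusRing := (transition i).toAlgebra
  have : IsLocalization.Away (vv : ChartRing) TorusRing := transition_isLocalization i
  exact IsOpenImmersion.of_isLocalization (R := ChartRing) (S := TorusRing) vv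

/-- The gluing diagram: the torus, included in each of the three charts. -/
def gluingDiagram : WidePushoutShape (Fin 3) ⥤ Scheme.{0} :=
  WidePushoutShape.wideSpan torus (fun _ => chart) torusToChart

instance gluingDiagram_isOpenImmersion {i j : WidePushoutShape (Fin 3)} (f : i ⟶ j) :
    IsOpenImmersion (gluingDiagram.map f) := by
  rcases f with _ | j
  · change IsOpenImmersion (gluingDiagram.map (𝟙 i))
    rw [CategoryTheory.Functor.map_id]; infer_instance
  · exact torusToChart_isOpenImmersion j

instance gluingDiagram_mono (j : Fin 3) :
    Mono ((gluingDiagram ⋙ Scheme.forget).map (WidePushoutShape.Hom.init j)) := by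
  rw [mono_iff_injective]
  exact (torusToChart j).isOpenEmbedding.injective

/-- The diagram is a gluing datum: `colimit gluingDiagram` is covered by the four charts as open
subschemes, any two of the three added charts meeting exactly in the torus. -/
instance gluingDiagram_isLocallyDirected : (gluingDiagram ⋙ Scheme.forget).IsLocallyDirected :=
  inferInstance

/-- The glued space: the torus and the three charts `{u_i v_i ≠ 1}`, glued by `v_i = z_{i+1}⁻¹` and
`u_i v_i = 1 + z_i⁻¹ z_{i+1}⁻²`. -/
def gluedSpace : Scheme.{0} := colimit gluingDiagram

/-- The torus chart of the glued space. -/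
def torusι : torus ⟶ gluedSpace := colimit.ι gluingDiagram none

/-- The `i`-th added chart of the glued space. -/
def chartι (i : Fin 3) : chart ⟶ gluedSpace := colimit.ι gluingDiagram (some i)

/-! ### The toric surface -/

/-- The pairing between characters and one-parameter subgroups. -/
def pair (m n : ℤ × ℤ) : ℤ := m.1 * n.1 + m.2 * n.2

/-- The primitive generators of the rays. -/
def ray : Fin 3 → ℤ × ℤ := ![(-1, -1), (2, -1), (-1, 2)]

/-- The characters `m` with `⟨m, n⟩ ≥ 0` on the cone spanned by the rays in `S`. -/
def dualCone (S : Finset (Fin 3)) : AddSubmonoid (ℤ × ℤ) where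
  carrier := {m | ∀ i ∈ S, 0 ≤ pair m (ray i)}
  zero_mem' := by intro i _; simp [pair]
  add_mem' {a b} ha hb := by
    intro i hi
    have h₁ := ha i hi
    have h₂ := hb i hi
    simp only [pair, Prod.fst_add, Prod.snd_add] at *
    linarith

lemma dualCone_anti {S T : Finset (Fin 3)} (h : S ⊆ T) : dualCone T ≤ dualCone S :=
  fun _ hm i hi => hm i (h hi)

/-- The coordinate ring of the affine toric variety of the cone spanned by the rays in `S`. -/
abbrev ToricRing (S : Finset (Fin 3)) : Type := AddMonoidAlgebra ℂ (dualCone S)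

/-- The restriction of functions to the affine toric variety of a face. -/
def toricRes {S T : Finset (Fin 3)} (h : S ⊆ T) : ToricRing T →+* ToricRing S :=
  AddMonoidAlgebra.mapDomainRingHom ℂ (AddSubmonoid.inclusion (dualCone_anti h))

/-- The affine toric variety of the cone spanned by the rays in `S`. -/
def affineToric (S : Finset (Fin 3)) : Scheme.{0} := Spec (.of (ToricRing S))

/-- The inclusion of the affine toric variety of a face. -/
def faceMap {S T : Finset (Fin 3)} (h : S ⊆ T) : affineToric S ⟶ affineToric T :=
  Spec.map (CommRingCat.ofHom (toricRes h))

/-- The complete fan with the three given rays: its cones are the cones spanned by the sets of at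
most two rays. -/
abbrev Fan : Type := {S : Finset (Fin 3) // S ≠ Finset.univ}

/-- The affine toric varieties of the cones of the fan, with the inclusions for faces. -/
def toricDiagram : Fan ⥤ Scheme.{0} where
  obj S := affineToric S.1
  map f := faceMap f.le
  map_id S := by
    have : toricRes (Finset.Subset.refl S.1) = RingHom.id _ :=
      AddMonoidAlgebra.mapDomainRingHom_id
    rw [faceMap, this]
    exact Spec.map_id _
  map_comp {S T U} f g := by
    have : toricRes (f ≫ g).le = (toricRes f.le).comp (toricRes g.le) :=
      AddMonoidAlgebra.mapDomainRingHom_comp (AddSubmonoid.inclusion (dualCone_anti f.le))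
        (AddSubmonoid.inclusion (dualCone_anti g.le))
    rw [faceMap, this, CommRingCat.ofHom_comp]
    exact Spec.map_comp _ _

/-- A face is cut out by a character. -/
lemma exists_face {S T : Finset (Fin 3)} (h : S ⊆ T) (hT : T ≠ Finset.univ) :
    ∃ m : dualCone T, (∀ i ∈ S, pair m (ray i) = 0) ∧ ∀ i ∈ T, i ∉ S → 0 < pair m (ray i) := by
  have key : ∀ S T : Finset (Fin 3), S ⊆ T → T ≠ Finset.univ →
      ∃ m ∈ ([(0, 0), (1, 2), (-1, -2), (2, 1), (-2, -1), (1, -1), (-1, 1), (1, 1), (-1, 0),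
        (0, -1)] : List (ℤ × ℤ)),
        (∀ i ∈ S, pair m (ray i) = 0) ∧ ∀ i ∈ T, i ∉ S → 0 < pair m (ray i) := by
    decide
  obtain ⟨m, -, h₀, h₁⟩ := key S T h hT
  refine ⟨⟨m, fun i hi => ?_⟩, h₀, h₁⟩
  by_cases hS : i ∈ S
  · exact (h₀ i hS).ge
  · exact (h₁ i hi hS).le

lemma pair_add_smul (a b : ℤ × ℤ) (k : ℕ) (n : ℤ × ℤ) :
    pair (a + k • b) n = pair a n + k * pair b n := by
  simp [pair]; ring

lemma faceMap_isLocalization {S T : Finset (Fin 3)} (h : S ⊆ T) (m : dualCone T)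
    (h₀ : ∀ i ∈ S, pair m (ray i) = 0) (h₁ : ∀ i ∈ T, i ∉ S → 0 < pair m (ray i)) :
    @IsLocalization.Away (ToricRing T) _ (AddMonoidAlgebra.single m 1) (ToricRing S) _
      (toricRes h).toAlgebra := by
  let _ : Algebra (ToricRing T) (ToricRing S) := (toricRes h).toAlgebra
  have hmap : ∀ x, algebraMap (ToricRing T) (ToricRing S) x = toricRes h x := fun _ => rfl
  have hsingle : ∀ (n : dualCone T) (c : ℂ), toricRes h (AddMonoidAlgebra.single n c) =
      AddMonoidAlgebra.single (AddSubmonoid.inclusion (dualCone_anti h) n) c := by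
    intro n c
    simp [toricRes]
  let m' : dualCone S := AddSubmonoid.inclusion (dualCone_anti h) m
  have hneg : -(m : ℤ × ℤ) ∈ dualCone S := by
    intro i hi
    have := h₀ i hi
    simp only [pair, Prod.fst_neg, Prod.snd_neg] at *
    linarith
  have hinj : Function.Injective (toricRes h) :=
    AddMonoidAlgebra.mapDomain_injective (AddSubmonoid.inclusion_injective _)
  refine ⟨?_, ?_, ?_⟩
  · rintro ⟨_, n, rfl⟩
    have hu : IsUnit (toricRes h (AddMonoidAlgebra.single m 1)) := by
      refine .of_mul_eq_one (AddMonoidAlgebra.single ⟨_, hneg⟩ 1) ?_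
      rw [hsingle, AddMonoidAlgebra.single_mul_single, mul_one, AddMonoidAlgebra.one_def]
      congr 1
      exact Subtype.ext (add_neg_cancel (m : ℤ × ℤ))
    simp only [map_pow]
    exact hu.pow n
  · have key : ∀ z : ToricRing S, ∃ (k : ℕ) (a : ToricRing T),
        z * toricRes h (AddMonoidAlgebra.single m 1) ^ k = toricRes h a := by
      intro z
      induction z using AddMonoidAlgebra.induction_linear with
      | zero => exact ⟨0, 0, by simp⟩
      | add f g hf hg =>
        obtain ⟨k, a, ha⟩ := hf
        obtain ⟨l, b, hb⟩ := hg
        refine ⟨k + l, a * AddMonoidAlgebra.single m 1 ^ l + b * AddMonoidAlgebra.single m 1 ^ k, ?_⟩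
        rw [map_add, map_mul, map_mul, ← ha, ← hb, map_pow, map_pow]
        ring
      | single n c =>
        have : ∃ k : ℕ, (n : ℤ × ℤ) + k • (m : ℤ × ℤ) ∈ dualCone T := by
          refine ⟨∑ i, (pair n (ray i)).natAbs, fun i hi => ?_⟩
          rw [pair_add_smul]
          by_cases hS : i ∈ S
          · rw [h₀ i hS, mul_zero, add_zero]
            exact n.2 i hS
          · have e₁ := h₁ i hi hS
            have e₂ : (pair n (ray i)).natAbs ≤ ∑ i, (pair n (ray i)).natAbs :=
              Finset.single_le_sum (f := fun i => (pair n (ray i)).natAbs)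
                (fun _ _ => Nat.zero_le _) (Finset.mem_univ i)
            generalize (∑ i, (pair n (ray i)).natAbs) = N at *
            have e₃ : -pair n (ray i) ≤ N := by omega
            nlinarith
        obtain ⟨k, hk⟩ := this
        refine ⟨k, AddMonoidAlgebra.single ⟨_, hk⟩ c, ?_⟩
        rw [hsingle, hsingle, AddMonoidAlgebra.single_pow, AddMonoidAlgebra.single_mul_single,
          one_pow, mul_one]
        congr 1
    intro z
    obtain ⟨k, a, hk⟩ := key z
    refine ⟨⟨a, ⟨_, k, rfl⟩⟩, ?_⟩
    simp only [hmap, map_pow]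
    exact hk
  · intro x y hxy
    exact ⟨1, by rw [hinj hxy]⟩

instance faceMap_isOpenImmersion (S T : Fan) (h : S ≤ T) : IsOpenImmersion (faceMap h) := by
  obtain ⟨m, h₀, h₁⟩ := exists_face h T.2
  let _ : Algebra (ToricRing T.1) (ToricRing S.1) := (toricRes h).toAlgebra
  have := faceMap_isLocalization h m h₀ h₁
  exact IsOpenImmersion.of_isLocalization (R := ToricRing T.1) (S := ToricRing S.1)
    (AddMonoidAlgebra.single m 1)

lemma mem_range_faceMap {S T : Finset (Fin 3)} (h : S ⊆ T) (m : dualCone T)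
    (h₀ : ∀ i ∈ S, pair m (ray i) = 0) (h₁ : ∀ i ∈ T, i ∉ S → 0 < pair m (ray i))
    (x : PrimeSpectrum (ToricRing T)) :
    (∃ y, faceMap h y = x) ↔ (AddMonoidAlgebra.single m 1 : ToricRing T) ∉ x.asIdeal := by
  let _ : Algebra (ToricRing T) (ToricRing S) := (toricRes h).toAlgebra
  have := faceMap_isLocalization h m h₀ h₁
  have e := PrimeSpectrum.localization_away_comap_range (ToricRing S)
    (AddMonoidAlgebra.single m 1 : ToricRing T)
  exact Set.ext_iff.mp e x

instance toricDiagram_isOpenImmersion {S T : Fan} (f : S ⟶ T) :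
    IsOpenImmersion (toricDiagram.map f) :=
  faceMap_isOpenImmersion S T f.le

/-- The diagram is a gluing datum: inside the affine toric variety of a cone, the affine toric
varieties of two faces meet in that of the common face. So `colimit toricDiagram` is covered by
the affine toric varieties of the cones as open subschemes, glued along common faces. -/
instance toricDiagram_isLocallyDirected : (toricDiagram ⋙ Scheme.forget).IsLocallyDirected := by
  constructor
  intro S T U f g x y hxy
  change toricDiagram.map f x = toricDiagram.map g y at hxy
  obtain ⟨m, h₀, h₁⟩ := exists_face f.le U.2
  obtain ⟨n, k₀, k₁⟩ := exists_face g.le U.2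
  let R : Fan := ⟨S.1 ∩ T.1, fun h => S.2 (Finset.univ_subset_iff.mp
    (h.symm.subset.trans Finset.inter_subset_left))⟩
  have hRS : R ≤ S := Finset.inter_subset_left
  have hRT : R ≤ T := Finset.inter_subset_right
  have hRU : R ≤ U := hRS.trans f.le
  have e := mem_range_faceMap hRU (m + n) ?_ ?_
  · have hx : ∃ z, faceMap hRU z = toricDiagram.map f x := by
      refine (e _).mpr ?_
      rw [show (AddMonoidAlgebra.single (m + n) 1 : ToricRing U.1) =
        AddMonoidAlgebra.single m 1 * AddMonoidAlgebra.single n 1 by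
          rw [AddMonoidAlgebra.single_mul_single, mul_one]]
      intro hmem
      rcases Ideal.IsPrime.mem_or_mem (PrimeSpectrum.isPrime _) hmem with hm | hn
      · exact (mem_range_faceMap f.le m h₀ h₁ _).mp ⟨x, rfl⟩ hm
      · exact (mem_range_faceMap g.le n k₀ k₁ _).mp ⟨y, hxy.symm⟩ hn
    obtain ⟨z, hz⟩ := hx
    refine ⟨R, homOfLE hRS, homOfLE hRT, z, ?_, ?_⟩
    · apply (toricDiagram.map f).isOpenEmbedding.injective
      rw [← hz]
      change (toricDiagram.map (homOfLE hRS) ≫ toricDiagram.map f) z = _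
      rw [← CategoryTheory.Functor.map_comp]
      rfl
    · apply (toricDiagram.map g).isOpenEmbedding.injective
      rw [← hxy, ← hz]
      change (toricDiagram.map (homOfLE hRT) ≫ toricDiagram.map g) z = _
      rw [← CategoryTheory.Functor.map_comp]
      rfl
  · intro i hi
    have := h₀ i (hRS hi)
    have := k₀ i (hRT hi)
    simp only [pair, AddSubmonoid.coe_add, Prod.fst_add, Prod.snd_add] at *
    linarith
  · intro i hi hiR
    have a₁ := m.2 i hi
    have a₂ := n.2 i hi
    have : 0 < pair m (ray i) ∨ 0 < pair n (ray i) := by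
      by_cases hS : i ∈ S.1
      · exact .inr (k₁ i hi fun hT => hiR (Finset.mem_inter.mpr ⟨hS, hT⟩))
      · exact .inl (h₁ i hi hS)
    simp only [pair, AddSubmonoid.coe_add, Prod.fst_add, Prod.snd_add] at *
    rcases this with h | h <;> linarith

/-- The toric surface of the fan. -/
def toricSurface : Scheme.{0} := colimit toricDiagram

/-- The affine toric variety of a cone as an open subscheme of the toric surface. -/
def toricι (S : Fan) : affineToric S.1 ⟶ toricSurface := colimit.ι toricDiagram S

/-- The zero cone. -/
def zeroCone : Fan := ⟨∅, by decide⟩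

/-- The ray spanned by `ray i`. -/
def rayCone (i : Fin 3) : Fan := ⟨{i}, by revert i; decide⟩

/-- The torus as the open orbit of the toric surface. -/
def toricTorusι : torus ⟶ toricSurface :=
  Spec.map (CommRingCat.ofHom (AddMonoidAlgebra.mapDomainRingHom ℂ (dualCone ∅).subtype :
    ToricRing ∅ →+* TorusRing)) ≫ toricι zeroCone

/-- The toric divisor of `ray i`: the closure of the one-dimensional orbit of that ray. -/
def toricDivisor (i : Fin 3) : Set toricSurface :=
  closure (Set.range (toricι (rayCone i)) \ Set.range (toricι zeroCone))

lemma VV_mem (i : Fin 3) : VV i ∈ dualCone {i} := by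
  have h : ∀ i, 0 ≤ pair (VV i) (ray i) := by decide
  intro j hj
  rw [Finset.mem_singleton.mp hj]
  exact h i

lemma ZZ_mem (i : Fin 3) : ZZ i ∈ dualCone {i} := by
  have h : ∀ i, 0 ≤ pair (ZZ i) (ray i) := by decide
  intro j hj
  rw [Finset.mem_singleton.mp hj]
  exact h i

/-- The ideal `(V_i, Z_i + 1)` of the point `V_i = 0`, `Z_i = -1` of the affine toric variety of
the `i`-th ray. -/
def pointIdeal (i : Fin 3) : Ideal (ToricRing {i}) :=
  Ideal.span {AddMonoidAlgebra.single ⟨VV i, VV_mem i⟩ 1,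
    AddMonoidAlgebra.single ⟨ZZ i, ZZ_mem i⟩ 1 + 1}

/-- The inclusion in the toric surface of the point `V_i = 0`, `Z_i = -1`. -/
def pointι (i : Fin 3) : Spec (.of (ToricRing {i} ⧸ pointIdeal i)) ⟶ toricSurface :=
  Spec.map (CommRingCat.ofHom (Ideal.Quotient.mk (pointIdeal i))) ≫ toricι (rayCone i)

/-- The ideal sheaf of the three points. -/
def centre : toricSurface.IdealSheafData := ⨅ i, (pointι i).ker

/-! ### Blowing up -/

/-- The ideal sheaf is invertible: locally generated by one nonzerodivisor. -/
def IsInvertible {X : Scheme.{0}} (I : X.IdealSheafData) : Prop :=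
  ∀ x : X, ∃ U : X.affineOpens, x ∈ U.1 ∧
    ∃ f ∈ nonZeroDivisors Γ(X, U.1), I.ideal U = Ideal.span {f}

/-- `π : B ⟶ Y` is the blowing up of `Y` along the ideal sheaf `I`: the inverse image ideal sheaf of
`I` on `B` is invertible, and `π` is universal with this property. -/
structure IsBlowup {B Y : Scheme.{0}} (π : B ⟶ Y) (I : Y.IdealSheafData) : Prop where
  isInvertible : IsInvertible (I.comap π)
  existsUnique_lift : ∀ {T : Scheme.{0}} (f : T ⟶ Y), IsInvertible (I.comap f) →
    ∃! g : T ⟶ B, g ≫ π = f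

/-- The strict transform of a set `D` under the blowing up `π` of `I`: the closure of the inverse
image of the part of `D` outside of the centre. -/
def strictTransform {B Y : Scheme.{0}} (π : B ⟶ Y) (I : Y.IdealSheafData) (D : Set Y) : Set B :=
  closure (π ⁻¹' (D \ I.support))

/-- The complement of the strict transforms of the three toric divisors. -/
def strictComplement {B : Scheme.{0}} (π : B ⟶ toricSurface) : B.Opens :=
  ⟨(⋃ i, strictTransform π centre (toricDivisor i))ᶜ,
    (isClosed_iUnion_of_finite fun _ => isClosed_closure).isOpen_compl⟩

/-! ### Elliptic fibrations over the affine line -/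

/-- The point `Spec ℂ`. -/
def specC : Scheme.{0} := Spec (.of ℂ)

/-- The affine line over `ℂ`. -/
def affineLine : Scheme.{0} := Spec (.of (Polynomial ℂ))

/-- The structure morphism of the affine line. -/
def affineLineToSpec : affineLine ⟶ specC := Spec.map (CommRingCat.ofHom Polynomial.C)

/-- The closed point `c` of the affine line. -/
def linePoint (c : ℂ) : specC ⟶ affineLine := Spec.map (CommRingCat.ofHom (Polynomial.evalRingHom c))

/-- The scheme-theoretic fibre over `c`, with its structure morphism to `Spec ℂ`. -/
def fibre {X : Scheme.{0}} (W : X ⟶ affineLine) (c : ℂ) : pullback W (linePoint c) ⟶ specC :=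
  pullback.snd W (linePoint c)

/-- The projective plane over `ℂ`. -/
def projPlane : Scheme.{0} := Proj (MvPolynomial.homogeneousSubmodule (Fin 3) ℂ)

/-- The structure morphism of the projective plane. -/
def projPlaneToSpec : projPlane ⟶ specC :=
  Proj.toSpecZero (MvPolynomial.homogeneousSubmodule (Fin 3) ℂ) ≫
    Spec.map (CommRingCat.ofHom
      (algebraMap ℂ (MvPolynomial.homogeneousSubmodule (Fin 3) ℂ 0)))

/-- The points of the projective plane on the Weierstrass cubic
`Y²Z + a₁XYZ + a₃YZ² = X³ + a₂X²Z + a₄XZ² + a₆Z³`. -/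
def cubicLocus (E : WeierstrassCurve ℂ) : Set projPlane :=
  ProjectiveSpectrum.zeroLocus (MvPolynomial.homogeneousSubmodule (Fin 3) ℂ)
    {WeierstrassCurve.Projective.polynomial E}

/-- The `ℂ`-scheme `X` is isomorphic to the projective plane Weierstrass cubic `E`: as `E` is given
by an irreducible polynomial, this says that `X` is reduced and has a closed immersion over `ℂ` in
the projective plane whose image is the cubic. -/
def IsCubic (E : WeierstrassCurve ℂ) {X : Scheme.{0}} (p : X ⟶ specC) : Prop :=
  IsReduced X ∧ ∃ j : X ⟶ projPlane,
    IsClosedImmersion j ∧ j ≫ projPlaneToSpec = p ∧ Set.range j = cubicLocus E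

/-- An elliptic curve over `ℂ`: a smooth projective plane Weierstrass cubic. -/
def IsEllipticCurve {X : Scheme.{0}} (p : X ⟶ specC) : Prop :=
  ∃ E : WeierstrassCurve ℂ, E.IsElliptic ∧ IsCubic E p

/-- A curve of type `I₁`: an irreducible nodal rational curve, that is, a projective plane
Weierstrass cubic with a node (`Δ = 0` and `c₄ ≠ 0`). -/
def IsTypeIOne {X : Scheme.{0}} (p : X ⟶ specC) : Prop :=
  ∃ E : WeierstrassCurve ℂ, E.Δ = 0 ∧ E.c₄ ≠ 0 ∧ IsCubic E p

/-- A proper elliptic fibration over the affine line: a proper flat morphism with a smooth total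
space, all but finitely many of whose fibres are elliptic curves. -/
structure IsProperEllipticFibration {X : Scheme.{0}} (W : X ⟶ affineLine) : Prop where
  proper : IsProper W
  flat : Flat W
  smooth : Smooth (W ≫ affineLineToSpec)
  finite_singular : {c : ℂ | ¬ IsEllipticCurve (fibre W c)}.Finite

/-! ### The potential and the axes of the charts -/

/-- The function `z₁ + z₂ + 1 / (z₁ z₂)` on the torus. -/
def potential : torus ⟶ affineLine :=
  Spec.map (CommRingCat.ofHom (Polynomial.aeval (R := ℂ)
    (chi (1, 0) + chi (0, 1) + chi (-1, -1))).toRingHom)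

/-- The closed subscheme `{v = 0}` of the chart. -/
def axis : Scheme.{0} := Spec (.of (ChartRing ⧸ Ideal.span {vv}))

/-- The inclusion of `{v = 0}` in the chart. -/
def axisι : axis ⟶ chart := Spec.map (CommRingCat.ofHom (Ideal.Quotient.mk (Ideal.span {vv})))

end CPSMirror

end

open CPSMirror

noncomputable section

namespace CPSMirror

attribute [local instance] MvPolynomial.gradedAlgebra

/-! ### The charts -/

/-! Write `z_0 = z_3` and `ζ = u v - 1`. In the `i`-th chart the gluing says `v = 1 / z_{i+1}` and
`ζ = z_{i+2} / z_{i+1}`, hence `u = z_{i+1} + z_{i+2}` and `z_i = v² / ζ`. The sum of the three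
`z_k` is therefore the regular function `u + v² / ζ` in every chart (`transition_chartPotential`).
It restricts to `u` on the axis `v = 0`, so the axes are sections. The same retraction makes `ℂ[t] →
ChartRing` injective, and flatness follows because the chart ring is a domain. Smoothness holds
because the charts are open in the affine plane.

Properness is the valuative criterion. If the product of the `z_k` is `1` and their sum is integral,
two of them share a valuation that is at least `1` (`exists_valuation_eq`). The chart indexed by the
third one then receives the lift (`exists_chart_lift`). Two lifts in different charts force all
`z_k` to be units, so both lie in the torus and agree.

The fibre over `c` is mapped to the plane by `[x : y : z] = [-1 : z_1 : z_2]`. The linear forms `-(c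
x + y + z)`, `y`, `z` are then proportional to `z_0`, `z_1`, `z_2`, and `z_0 z_1 z_2 = 1` becomes
the Weierstrass cubic `y² z + c x y z + y z² = x³`. The charts are the loci of this cubic where two
of the three forms do not vanish. The map is a closed immersion (`isClosedImmersion_fibrePlaneMap`)
with image the cubic (`range_fibrePlaneMap`), and the fibre is reduced because its equation is
irreducible by Eisenstein. Since `Δ = c³ - 27` and `c₄ = c (c³ - 24)`, exactly the three roots of
`c³ = 27` give nodal cubics.

For the toric model, blowing up the ideal `(V, Z + 1)` in a ray chart gives two affine charts. Where
`V` divides `Z + 1` with quotient `u`, one has `Z = u V - 1`, and this is the chart `{u v ≠ 1}`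
(`isBlowupChart_chartHom`). In the other, `V = (Z + 1) V'`, and the points missed by the first chart
are those of `V' = 0`, the strict transform of the divisor. Blowing ups are characterised by their
universal property, constructed on affine pieces and glued (`exists_isBlowup_of_cover`). The
universal property also yields the map from the glued space, an open immersion whose image is the
required complement (`IsBlowup.range_gluedLift`). -/

lemma isUnit_uv : IsUnit (uu * vv - 1) := by
  have := IsLocalization.Away.algebraMap_isUnit (S := ChartRing)
    (MvPolynomial.X 0 * MvPolynomial.X 1 - 1 : MvPolynomial (Fin 2) ℂ)
  rwa [map_sub, map_mul, map_one] at this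

/-- The function `u v - 1` on the chart, as a unit. -/
def zeta : ChartRingˣ := isUnit_uv.unit

lemma zeta_val : (zeta : ChartRing) = uu * vv - 1 := rfl

/-- A homomorphism from the coordinate ring of the chart is given by the images `u`, `v` of the
coordinates, `u v - 1` being a unit. -/
def chartLift {L : Type} [CommRing L] [Algebra ℂ L] (u v : L) (h : IsUnit (u * v - 1)) :
    ChartRing →ₐ[ℂ] L :=
  IsLocalization.liftAlgHom (M := Submonoid.powers
      (MvPolynomial.X 0 * MvPolynomial.X 1 - 1 : MvPolynomial (Fin 2) ℂ))
    (f := MvPolynomial.aeval ![u, v]) (by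
      rintro ⟨_, n, rfl⟩
      simpa using h.pow n)

section

variable {L : Type} [CommRing L] [Algebra ℂ L] (u v : L) (h : IsUnit (u * v - 1))

@[simp]
lemma chartLift_uu : chartLift u v h uu = u := by
  simp [chartLift, uu]

@[simp]
lemma chartLift_vv : chartLift u v h vv = v := by
  simp [chartLift, vv]

end

/-- Stated for ring homomorphisms because points of the glued space over a ring carry no chosen
`ℂ`-structure; agreement on constants is then a separate condition. -/
lemma chart_ringHom_ext {L : Type} [CommRing L] {f g : ChartRing →+* L}
    (hc : ∀ c : ℂ, f (algebraMap ℂ _ c) = g (algebraMap ℂ _ c))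
    (hu : f uu = g uu) (hv : f vv = g vv) : f = g := by
  apply IsLocalization.ringHom_ext (Submonoid.powers
    (MvPolynomial.X 0 * MvPolynomial.X 1 - 1 : MvPolynomial (Fin 2) ℂ))
  apply MvPolynomial.ringHom_ext
  · exact hc
  · intro j
    fin_cases j
    exacts [hu, hv]

lemma transition_algebraMap_complex (i : Fin 3) (c : ℂ) :
    transition i (algebraMap ℂ _ c) = algebraMap ℂ _ c := by
  rw [IsScalarTower.algebraMap_apply ℂ (MvPolynomial (Fin 2) ℂ) ChartRing, transition_algebraMap]
  simp

/-- The transition as a homomorphism of `ℂ`-algebras. -/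
def transitionₐ (i : Fin 3) : ChartRing →ₐ[ℂ] TorusRing :=
  { transition i with commutes' := transition_algebraMap_complex i }

lemma transition_zeta (i : Fin 3) : transition i zeta = chi (ZZ i) := by
  rw [zeta_val, map_sub, map_mul, map_one, transition_u, transition_v]
  linear_combination (1 + chi (ZZ i)) * chi_mul_neg (VV i)

lemma transition_zeta_inv (i : Fin 3) : transition i ↑zeta⁻¹ = chi (-ZZ i) := by
  have h : transition i zeta * transition i ↑zeta⁻¹ = 1 := by
    rw [← map_mul, Units.mul_inv, map_one]
  rw [transition_zeta] at h
  linear_combination chi (-ZZ i) * h - transition i ↑zeta⁻¹ * chi_mul_neg (ZZ i)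

/-- The potential on a chart. -/
def chartPotential : ChartRing := uu + vv ^ 2 * ↑zeta⁻¹

/-- The potential on the torus. -/
def torusPotential : TorusRing := chi (1, 0) + chi (0, 1) + chi (-1, -1)

lemma torusPotential_eq (i : Fin 3) : torusPotential =
    chi (expo i) + chi (expo (i + 1)) + chi (expo (i + 2)) := by
  fin_cases i <;> simp [torusPotential, expo] <;> ring

/-- In the torus `u` becomes `z_{i+1} + z_{i+2}` and `v² / ζ` becomes `z_i`, so one formula serves
all three charts. -/
lemma transition_chartPotential (i : Fin 3) : transition i chartPotential = torusPotential := by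
  rw [chartPotential, map_add, map_mul, map_pow, transition_u, transition_v, transition_zeta_inv,
    pow_two, ← chi_add, ← chi_add, mul_add, mul_one, ← chi_add, torusPotential_eq i]
  fin_cases i <;> simp [VV, ZZ, expo] <;> ring

/-! ### Morphisms from the glued space -/

/-- Gluing morphisms from the torus and the charts. -/
def gluedDesc {Y : Scheme.{0}} (f : torus ⟶ Y) (g : Fin 3 → (chart ⟶ Y))
    (h : ∀ i, torusToChart i ≫ g i = f) : gluedSpace ⟶ Y :=
  colimit.desc gluingDiagram
    { pt := Y
      ι :=
        { app := fun j => match j with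
            | none => f
            | some i => g i
          naturality := by
            rintro _ _ (_ | i)
            · change gluingDiagram.map (𝟙 _) ≫ _ = _ ≫ 𝟙 Y
              rw [CategoryTheory.Functor.map_id, Category.id_comp, Category.comp_id]
            · exact (h i).trans (Category.comp_id _).symm } }

section

variable {Y : Scheme.{0}} (f : torus ⟶ Y) (g : Fin 3 → (chart ⟶ Y))
    (h : ∀ i, torusToChart i ≫ g i = f)

@[simp]
lemma torusι_gluedDesc : torusι ≫ gluedDesc f g h = f :=
  colimit.ι_desc _ _

@[simp]
lemma chartι_gluedDesc (i : Fin 3) : chartι i ≫ gluedDesc f g h = g i :=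
  colimit.ι_desc _ _

end

@[simp]
lemma torusToChart_chartι (i : Fin 3) : torusToChart i ≫ chartι i = torusι :=
  colimit.w gluingDiagram (WidePushoutShape.Hom.init i)

instance (i : Fin 3) : IsOpenImmersion (chartι i) :=
  inferInstanceAs (IsOpenImmersion (colimit.ι gluingDiagram (some i)))

instance : IsOpenImmersion torusι :=
  inferInstanceAs (IsOpenImmersion (colimit.ι gluingDiagram none))

lemma exists_chartι_eq (x : gluedSpace) : ∃ i y, chartι i y = x := by
  obtain ⟨j, y, hy⟩ := Scheme.IsLocallyDirected.ι_jointly_surjective gluingDiagram x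
  rcases j with _ | i
  -- A point of the torus lies in every chart; chart `0` is an arbitrary choice.
  · exact ⟨0, torusToChart 0 y,
      (congrArg (fun f : torus ⟶ gluedSpace => f y) (torusToChart_chartι 0)).trans hy⟩
  · exact ⟨i, y, hy⟩

/-- The cover of the glued space by the three charts. -/
def chartCover : gluedSpace.OpenCover where
  I₀ := Fin 3
  X _ := chart
  f := chartι
  mem₀ := by
    rw [Scheme.presieve₀_mem_precoverage_iff]
    exact ⟨fun x => exists_chartι_eq x, inferInstance⟩

/-- Two charts meet in the torus. -/
lemma exists_torus_of_chartι_eq {i j : Fin 3} (hij : i ≠ j) {x y : chart}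
    (h : chartι i x = chartι j y) : ∃ t, torusToChart i t = x ∧ torusToChart j t = y := by
  obtain ⟨k, fi, fj, z, hx, hy⟩ :=
    (Scheme.IsLocallyDirected.ι_eq_ι_iff gluingDiagram).mp h
  rcases k with _ | k
  · rcases fi with _ | _
    rcases fj with _ | _
    exact ⟨z, hx, hy⟩
  · rcases fi with _ | _
    rcases fj with _ | _
    exact absurd rfl hij

lemma mem_range_torusToChart (i : Fin 3) (x : chart) :
    x ∈ Set.range (torusToChart i) ↔ vv ∉ PrimeSpectrum.asIdeal x := by
  let _ : Algebra ChartRing TorusRing := (transition i).toAlgebra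
  have := transition_isLocalization i
  exact Set.ext_iff.mp (PrimeSpectrum.localization_away_comap_range TorusRing vv) x

/-- The morphism to the affine line given by the potential. -/
def chartMap : chart ⟶ affineLine :=
  Spec.map (CommRingCat.ofHom (Polynomial.aeval (R := ℂ) chartPotential).toRingHom)

lemma transition_comp_aeval (i : Fin 3) :
    (transition i).comp (Polynomial.aeval (R := ℂ) chartPotential).toRingHom =
      (Polynomial.aeval (R := ℂ) torusPotential).toRingHom := by
  apply Polynomial.ringHom_ext
  · intro c
    simpa using transition_algebraMap_complex i c
  · simpa using transition_chartPotential i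

/-- The potential on the glued space. -/
def gluedPotential : gluedSpace ⟶ affineLine :=
  gluedDesc potential (fun _ => chartMap) fun i => by
    refine (Spec.map_comp _ _).symm.trans (congrArg Spec.map (?_ : CommRingCat.ofHom
      ((transition i).comp (Polynomial.aeval (R := ℂ) chartPotential).toRingHom) = _))
    rw [transition_comp_aeval]
    rfl

@[simp]
lemma torusι_gluedPotential : torusι ≫ gluedPotential = potential := torusι_gluedDesc _ _ _

@[simp]
lemma chartι_gluedPotential (i : Fin 3) : chartι i ≫ gluedPotential = chartMap :=
  chartι_gluedDesc _ _ _ i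

/-! ### Flatness, smoothness and the axes -/

lemma uv_ne_zero : (MvPolynomial.X 0 * MvPolynomial.X 1 - 1 : MvPolynomial (Fin 2) ℂ) ≠ 0 := by
  intro h
  have := congrArg (MvPolynomial.eval 0) h
  simp at this

instance : IsDomain ChartRing :=
  IsLocalization.isDomain_localization (powers_le_nonZeroDivisors_of_noZeroDivisors uv_ne_zero)

/-- The restriction of functions on the chart to the axis `v = 0`. -/
def axisHom : ChartRing →ₐ[ℂ] Polynomial ℂ :=
  chartLift Polynomial.X 0 (by rw [mul_zero, zero_sub]; exact isUnit_one.neg)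

@[simp]
lemma axisHom_uu : axisHom uu = Polynomial.X := chartLift_uu _ _ _

@[simp]
lemma axisHom_vv : axisHom vv = 0 := chartLift_vv _ _ _

lemma axisHom_chartPotential : axisHom chartPotential = Polynomial.X := by
  simp [chartPotential]

lemma axisHom_aeval (p : Polynomial ℂ) : axisHom (Polynomial.aeval chartPotential p) = p := by
  rw [← Polynomial.aeval_algHom_apply, axisHom_chartPotential, Polynomial.aeval_X_left_apply]

/-- Over the principal ideal domain `ℂ[t]` flat means torsion-free. The chart ring is a domain, so
injectivity suffices, and `axisHom` is a left inverse. -/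
lemma flat_chartMap : Flat chartMap := by
  let φ : Polynomial ℂ →+* ChartRing := (Polynomial.aeval (R := ℂ) chartPotential).toRingHom
  have hφ : Function.Injective φ := Function.LeftInverse.injective axisHom_aeval
  refine Flat.SpecMap_iff.mpr (?_ : φ.Flat)
  let _ : Algebra (Polynomial ℂ) ChartRing := φ.toAlgebra
  have : Module.IsTorsionFree (Polynomial ℂ) ChartRing := by
    rw [Module.isTorsionFree_iff_faithfulSMul]
    exact (faithfulSMul_iff_algebraMap_injective _ _).mpr hφ
  change Module.Flat (Polynomial ℂ) ChartRing
  infer_instance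

lemma flat_gluedPotential : Flat gluedPotential := by
  have : IsZariskiLocalAtSource @Flat.{0} := HasRingHomProperty.instIsZariskiLocalAtSource
  rw [IsZariskiLocalAtSource.iff_of_openCover (P := @Flat.{0}) chartCover]
  intro i
  exact (chartι_gluedPotential i).symm ▸ flat_chartMap

lemma chartMap_affineLineToSpec : chartMap ≫ affineLineToSpec =
    Spec.map (CommRingCat.ofHom (algebraMap ℂ ChartRing)) := by
  refine (Spec.map_comp _ _).symm.trans (congrArg Spec.map (?_ : CommRingCat.ofHom
    ((Polynomial.aeval (R := ℂ) chartPotential).toRingHom.comp Polynomial.C) = _))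
  congr 1
  ext c
  simp

/-- Each chart is a principal open subset of the affine plane. -/
lemma smooth_gluedPotential : Smooth (gluedPotential ≫ affineLineToSpec) := by
  have : IsZariskiLocalAtSource @Smooth.{0} := HasRingHomProperty.instIsZariskiLocalAtSource
  rw [IsZariskiLocalAtSource.iff_of_openCover (P := @Smooth.{0}) chartCover]
  intro i
  have h : chartCover.f i ≫ gluedPotential ≫ affineLineToSpec =
      Spec.map (CommRingCat.ofHom (algebraMap ℂ ChartRing)) := by
    rw [← chartMap_affineLineToSpec, ← chartι_gluedPotential i, Category.assoc]
    rfl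
  rw [h]
  refine (HasRingHomProperty.Spec_iff (P := @Smooth)).mpr (?_ : (algebraMap ℂ ChartRing).Smooth)
  rw [RingHom.smooth_algebraMap]
  have := Algebra.Smooth.of_isLocalization_Away (A := ChartRing)
    (MvPolynomial.X 0 * MvPolynomial.X 1 - 1 : MvPolynomial (Fin 2) ℂ)
  have : Algebra.Smooth ℂ (MvPolynomial (Fin 2) ℂ) := {}
  exact Algebra.Smooth.comp ℂ (MvPolynomial (Fin 2) ℂ) ChartRing

lemma isIso_axisι_chartMap : IsIso (axisι ≫ chartMap) := by
  let ρ : Polynomial ℂ →+* ChartRing ⧸ Ideal.span {vv} :=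
    (Ideal.Quotient.mk (Ideal.span {vv})).comp
      (Polynomial.aeval (R := ℂ) chartPotential).toRingHom
  let σ : ChartRing ⧸ Ideal.span {vv} →+* Polynomial ℂ :=
    Ideal.Quotient.lift _ axisHom.toRingHom (by
      intro a ha
      obtain ⟨b, rfl⟩ := Ideal.mem_span_singleton.mp ha
      simp)
  have hσρ : ∀ p, σ (ρ p) = p := axisHom_aeval
  have hρσ : ρ.comp σ = RingHom.id _ := by
    apply Ideal.Quotient.ringHom_ext
    apply chart_ringHom_ext
    · intro c
      change ρ (axisHom (algebraMap ℂ _ c)) = _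
      rw [AlgHom.commutes]
      change Ideal.Quotient.mk _ (Polynomial.aeval chartPotential (algebraMap ℂ _ c)) = _
      rw [AlgHom.commutes]
      rfl
    · change ρ (axisHom uu) = _
      rw [axisHom_uu]
      change Ideal.Quotient.mk _ (Polynomial.aeval chartPotential Polynomial.X) = _
      rw [Polynomial.aeval_X]
      -- The potential differs from `u` by `v² / ζ`, a multiple of `v`.
      refine Ideal.Quotient.eq.mpr (Ideal.mem_span_singleton.mpr ⟨vv * ↑zeta⁻¹, ?_⟩)
      rw [chartPotential]
      ring
    · change ρ (axisHom vv) = Ideal.Quotient.mk _ vv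
      rw [axisHom_vv, map_zero, Eq.comm, Ideal.Quotient.eq_zero_iff_mem]
      exact Ideal.mem_span_singleton_self _
  let e : Polynomial ℂ ≃+* ChartRing ⧸ Ideal.span {vv} :=
    RingEquiv.ofRingHom ρ σ hρσ (RingHom.ext hσρ)
  have : axisι ≫ chartMap = Spec.map e.toCommRingCatIso.hom := (Spec.map_comp _ _).symm
  rw [this]
  exact inferInstanceAs (IsIso (Spec.map e.toCommRingCatIso.hom))

lemma isIso_axisι_chartι (i : Fin 3) : IsIso (axisι ≫ chartι i ≫ gluedPotential) := by
  rw [chartι_gluedPotential]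
  exact isIso_axisι_chartMap

instance : IsClosedImmersion axisι :=
  IsClosedImmersion.spec_of_quotient_mk (R := .of ChartRing) _

/-- A section of a separated morphism is a closed immersion. Closedness in the chart alone would not
suffice. -/
lemma isClosedImmersion_axisι_chartι [IsSeparated gluedPotential] (i : Fin 3) :
    IsClosedImmersion (axisι ≫ chartι i) := by
  have h := isIso_axisι_chartι i
  rw [← Category.assoc] at h
  have : IsClosedImmersion ((axisι ≫ chartι i) ≫ gluedPotential) := inferInstance
  exact .of_comp _ gluedPotential

/-- Chart `0` stands for any chart: the image of the torus is `v ≠ 0` in each of them. -/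
lemma range_axisι : Set.range axisι = (Set.range (torusToChart 0))ᶜ := by
  ext x
  rw [Set.mem_compl_iff, mem_range_torusToChart, not_not]
  have := range_comap_of_surjective _ (Ideal.Quotient.mk (Ideal.span {vv}))
    Ideal.Quotient.mk_surjective
  rw [Ideal.mk_ker] at this
  refine (Set.ext_iff.mp this x).trans (SetLike.coe_subset_coe.trans ?_)
  exact Ideal.span_singleton_le_iff_mem _

lemma range_torusToChart (i : Fin 3) : Set.range (torusToChart i) = (Set.range axisι)ᶜ := by
  ext x
  rw [range_axisι, compl_compl, mem_range_torusToChart, mem_range_torusToChart]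

lemma disjoint_axes {i j : Fin 3} (hij : i ≠ j) :
    Disjoint (Set.range (axisι ≫ chartι i)) (Set.range (axisι ≫ chartι j)) := by
  rw [Set.disjoint_left]
  rintro _ ⟨x, rfl⟩ ⟨y, hy⟩
  rw [Scheme.Hom.comp_apply, Scheme.Hom.comp_apply] at hy
  obtain ⟨t, ht, -⟩ := exists_torus_of_chartι_eq hij.symm hy
  have : axisι y ∈ Set.range (torusToChart j) := ⟨t, ht⟩
  rw [range_torusToChart] at this
  exact this ⟨y, rfl⟩

lemma compl_range_torusι : (Set.range torusι)ᶜ = ⋃ i, Set.range (axisι ≫ chartι i) := by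
  have hap : ∀ i t, chartι i (torusToChart i t) = torusι t := fun i t =>
    congrArg (fun f : torus ⟶ gluedSpace => f t) (torusToChart_chartι i)
  ext x
  rw [Set.mem_compl_iff, Set.mem_iUnion]
  constructor
  · intro hx
    obtain ⟨i, y, rfl⟩ := exists_chartι_eq x
    have : y ∈ Set.range axisι := by
      by_contra hy
      rw [← Set.mem_compl_iff, ← range_torusToChart i] at hy
      obtain ⟨t, rfl⟩ := hy
      exact hx ⟨t, (hap i t).symm⟩
    obtain ⟨z, rfl⟩ := this
    exact ⟨i, z, Scheme.Hom.comp_apply _ _ _⟩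
  · rintro ⟨i, z, rfl⟩ ⟨t, ht⟩
    rw [Scheme.Hom.comp_apply, ← hap i t] at ht
    have : axisι z ∈ Set.range (torusToChart i) := ⟨t, (chartι i).isOpenEmbedding.injective ht⟩
    rw [range_torusToChart] at this
    exact this ⟨z, rfl⟩

/-! ### Properness -/

lemma transition_vv (i : Fin 3) : transition i vv = chi (-expo (i + 1)) := transition_v i

lemma transition_uu (i : Fin 3) :
    transition i uu = chi (expo (i + 1)) + chi (expo (i + 2)) := by
  rw [transition_u, mul_add, mul_one, ← chi_add]
  fin_cases i <;> simp [VV, ZZ, expo]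

lemma transition_zeta' (i : Fin 3) :
    transition i zeta = chi (expo (i + 2) - expo (i + 1)) := by
  rw [transition_zeta]
  fin_cases i <;> simp [ZZ, expo]

lemma chi_expo_prod (i : Fin 3) :
    chi (expo i) * chi (expo (i + 1)) * chi (expo (i + 2)) = 1 := by
  rw [← chi_add, ← chi_add, ← chi_zero]
  congr 1
  fin_cases i <;> rfl

/-! ### Ring-valued points of the torus, the charts and the glued space -/

lemma exists_torus_of_isUnit {L : Type} [CommRing L] (i : Fin 3) (φ : ChartRing →+* L)
    (h : IsUnit (φ vv)) : ∃ τ : TorusRing →+* L, τ.comp (transition i) = φ := by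
  let _ : Algebra ChartRing TorusRing := (transition i).toAlgebra
  have := transition_isLocalization i
  exact ⟨IsLocalization.Away.lift (S := TorusRing) vv h, RingHom.ext fun x =>
    IsLocalization.Away.lift_eq (S := TorusRing) vv h x⟩

/-- The point of the chart given by a homomorphism. -/
def chartPoint {L : Type} [CommRing L] (φ : ChartRing →+* L) : Spec (.of L) ⟶ chart :=
  Spec.map (CommRingCat.ofHom φ)

/-- The point of the torus given by a homomorphism. -/
def torusPoint {L : Type} [CommRing L] (τ : TorusRing →+* L) : Spec (.of L) ⟶ torus :=
  Spec.map (CommRingCat.ofHom τ)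

lemma exists_chartPoint {L : Type} [CommRing L] (f : Spec (.of L) ⟶ chart) :
    ∃ φ : ChartRing →+* L, chartPoint φ = f :=
  ⟨(Spec.preimage f).hom, Spec.map_preimage f⟩

lemma chartPoint_injective {L : Type} [CommRing L] {φ ψ : ChartRing →+* L}
    (h : chartPoint φ = chartPoint ψ) : φ = ψ :=
  congrArg CommRingCat.Hom.hom (Spec.map_injective h)

lemma torusPoint_injective {L : Type} [CommRing L] {φ ψ : TorusRing →+* L}
    (h : torusPoint φ = torusPoint ψ) : φ = ψ :=
  congrArg CommRingCat.Hom.hom (Spec.map_injective h)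

lemma torusPoint_torusToChart {L : Type} [CommRing L] (τ : TorusRing →+* L) (i : Fin 3) :
    torusPoint τ ≫ torusToChart i = chartPoint (τ.comp (transition i)) :=
  (Spec.map_comp _ _).symm

lemma chartPoint_comp_transition {L : Type} [CommRing L] (τ : TorusRing →+* L) (i : Fin 3) :
    chartPoint (τ.comp (transition i)) ≫ chartι i = torusPoint τ ≫ torusι := by
  rw [← torusPoint_torusToChart, Category.assoc, torusToChart_chartι]

lemma map_chartPoint {L M : Type} [CommRing L] [CommRing M] (f : L →+* M) (φ : ChartRing →+* L) :
    Spec.map (CommRingCat.ofHom f) ≫ chartPoint φ = chartPoint (f.comp φ) :=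
  (Spec.map_comp _ _).symm

lemma torus_ringHom_ext {L : Type} [CommRing L] (i : Fin 3) {τ τ' : TorusRing →+* L}
    (h : τ.comp (transition i) = τ'.comp (transition i)) : τ = τ' := by
  apply torusPoint_injective
  rw [← cancel_mono (torusToChart i), torusPoint_torusToChart, torusPoint_torusToChart, h]

/-- A point with values in a local ring lies in one of the charts. -/
lemma exists_chartPoint_of_isLocalRing {L : Type} [CommRing L] [IsLocalRing L]
    (f : Spec (.of L) ⟶ gluedSpace) :
    ∃ (i : Fin 3) (φ : ChartRing →+* L), chartPoint φ ≫ chartι i = f := by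
  obtain ⟨i, y, hy⟩ := exists_chartι_eq (f (IsLocalRing.closedPoint L))
  -- An open subset of a local scheme containing the closed point is everything, so the chart of the
  -- closed point contains the whole image.
  have hU : f ⁻¹ᵁ (chartι i).opensRange = ⊤ :=
    (IsLocalRing.closed_point_mem_iff (U := (f ⁻¹ᵁ (chartι i).opensRange : (Spec (.of L)).Opens))).mp
      ⟨y, hy⟩
  have hr : Set.range f ⊆ Set.range (chartι i) := by
    rintro _ ⟨x, rfl⟩
    have : x ∈ f ⁻¹ᵁ (chartι i).opensRange := hU ▸ trivial
    exact this
  obtain ⟨φ, hφ⟩ := exists_chartPoint (IsOpenImmersion.lift (chartι i) f hr)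
  exact ⟨i, φ, by rw [hφ, IsOpenImmersion.lift_fac]⟩

/-- Different charts overlap only in the torus, where `v` does not vanish. -/
lemma chartPoint_vv_ne_zero {K : Type} [Field K] {i j : Fin 3} (hij : i ≠ j)
    {φ ψ : ChartRing →+* K} (h : chartPoint φ ≫ chartι i = chartPoint ψ ≫ chartι j) :
    φ vv ≠ 0 := by
  let x : Spec (.of K) := IsLocalRing.closedPoint K
  have hx : chartι i (chartPoint φ x) = chartι j (chartPoint ψ x) := by
    rw [← Scheme.Hom.comp_apply, h, Scheme.Hom.comp_apply]
  obtain ⟨t, ht, -⟩ := exists_torus_of_chartι_eq hij hx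
  have := (mem_range_torusToChart i _).mp ⟨t, ht⟩
  intro h0
  refine this (?_ : φ vv ∈ PrimeSpectrum.asIdeal (IsLocalRing.closedPoint K))
  rw [h0]
  exact zero_mem _

/-- Gives quasi-separatedness of the potential, a hypothesis of the valuative criterion. -/
lemma isLocallyNoetherian_gluedSpace : IsLocallyNoetherian gluedSpace := by
  rw [isLocallyNoetherian_iff_openCover chartCover]
  intro i
  have : IsNoetherianRing ChartRing := IsLocalization.isNoetherianRing
    (Submonoid.powers (MvPolynomial.X 0 * MvPolynomial.X 1 - 1 : MvPolynomial (Fin 2) ℂ)) _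
      inferInstance
  exact (isLocallyNoetherian_Spec (R := .of ChartRing)).mpr this

lemma compactSpace_gluedSpace : CompactSpace gluedSpace := by
  have h : ∀ i, IsCompact (Set.range (chartι i)) := fun i => by
    have : CompactSpace chart := inferInstanceAs (CompactSpace (Spec (.of ChartRing)))
    exact isCompact_range (chartι i).continuous
  refine ⟨?_⟩
  have e : (Set.univ : Set gluedSpace) = ⋃ i, Set.range (chartι i) := by
    refine (Set.eq_univ_of_forall fun x => ?_).symm
    obtain ⟨i, y, hy⟩ := exists_chartι_eq x
    exact Set.mem_iUnion.mpr ⟨i, y, hy⟩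
  rw [e]
  exact isCompact_iUnion h

instance : IsAffine affineLine := inferInstanceAs (IsAffine (Spec _))

instance : QuasiCompact gluedPotential := by
  have := compactSpace_gluedSpace
  exact (quasiCompact_iff_compactSpace (f := gluedPotential)).mpr this

instance : QuasiSeparated gluedPotential := by
  have := isLocallyNoetherian_gluedSpace
  infer_instance

instance : LocallyOfFiniteType gluedPotential := by
  have := smooth_gluedPotential
  exact locallyOfFiniteType_of_comp gluedPotential affineLineToSpec

/-- If the product of three elements is `1` and their sum is integral, two of them have the same
valuation, which is at least `1`. -/
lemma exists_valuation_eq {K Γ : Type*} [Field K] [LinearOrderedCommGroupWithZero Γ]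
    (w : Valuation K Γ) (z : Fin 3 → K) (hz : ∀ i, z i * z (i + 1) * z (i + 2) = 1)
    (hs : ∀ i, w (z i + z (i + 1) + z (i + 2)) ≤ 1) :
    ∃ j, w (z (j + 1)) = w (z (j + 2)) ∧ 1 ≤ w (z (j + 1)) := by
  obtain ⟨m, hm⟩ := Finite.exists_max fun i => w (z i)
  have h0 : ∀ i, 0 < w (z i) := fun i => by
    rw [zero_lt_iff, Valuation.ne_zero_iff]
    intro h
    simpa [h] using hz i
  -- If the largest valuation were below `1`, so would be that of the product.
  have hm1 : 1 ≤ w (z m) := by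
    by_contra! h
    have hlt : w (z m * z (m + 1) * z (m + 2)) < 1 := by
      rw [map_mul, map_mul, mul_assoc]
      exact mul_lt_one_of_lt_of_le h (mul_le_one' ((hm _).trans h.le) ((hm _).trans h.le))
    rw [hz m, map_one] at hlt
    exact lt_irrefl _ hlt
  -- A maximum exceeding `1` cannot be attained only once: by the ultrametric inequality `z m`,
  -- being the integral sum minus two smaller terms, would have smaller valuation than itself.
  have key : w (z m) = 1 ∨ w (z (m + 1)) = w (z m) ∨ w (z (m + 2)) = w (z m) := by
    by_contra! h
    obtain ⟨h1, h2, h3⟩ := h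
    have h1' : 1 < w (z m) := lt_of_le_of_ne hm1 (Ne.symm h1)
    have h2' := lt_of_le_of_ne (hm (m + 1)) h2
    have h3' := lt_of_le_of_ne (hm (m + 2)) h3
    have : z m = (z m + z (m + 1) + z (m + 2)) - (z (m + 1) + z (m + 2)) := by ring
    have hlt : w (z m) < w (z m) := by
      conv_lhs => rw [this]
      exact Valuation.map_sub_lt w ((hs m).trans_lt h1') (Valuation.map_add_lt w h2' h3')
    exact lt_irrefl _ hlt
  have e3 : ∀ a : Fin 3, a + 1 + 2 = a ∧ a + 2 + 2 = a + 1 ∧ a + 2 + 1 = a ∧ a + 1 + 1 = a + 2 := by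
    decide
  rcases key with h | h | h
  · have hle : ∀ i, w (z i) ≤ 1 := fun i => (hm i).trans h.le
    have hp : w (z m) * w (z (m + 1)) * w (z (m + 2)) = 1 := by
      rw [← map_mul, ← map_mul, hz, map_one]
    rw [h, one_mul] at hp
    have h1 : w (z (m + 1)) = 1 := by
      refine le_antisymm (hle _) (hp.symm.le.trans ?_)
      exact mul_le_of_le_one_right' (hle _)
    rw [h1, one_mul] at hp
    exact ⟨m, by rw [h1, hp], h1.ge⟩
  -- The witness is the index left out: the equal pair is `m`, `m + 1` here, and `m`, `m + 2` in the
  -- last case.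
  · exact ⟨m + 2, by rw [(e3 m).2.2.1, (e3 m).2.1, h], by rw [(e3 m).2.2.1]; exact hm1⟩
  · exact ⟨m + 1, by rw [(e3 m).2.2.2, (e3 m).1, h], by rw [(e3 m).2.2.2, h]; exact hm1⟩


/-- Two distinct equalities among three values make all of them equal; their common cube is `1`, and
in an ordered group only `1` has cube `1`. -/
lemma eq_one_of_rotation {Γ : Type*} [LinearOrderedCommGroupWithZero Γ] (a : Fin 3 → Γ)
    {i j : Fin 3} (hij : i ≠ j) (hi : a (i + 2) = a (i + 1)) (hj : a (j + 2) = a (j + 1))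
    (h : a 0 * a 1 * a 2 = 1) (k : Fin 3) : a k = 1 := by
  have h₁ : a 0 = a 1 ∧ a 1 = a 2 := by
    revert hi hj
    fin_cases i <;> fin_cases j <;> first | exact absurd rfl hij | skip
    · exact fun h₁ h₂ => ⟨h₂.trans h₁, h₁.symm⟩
    · exact fun h₁ h₂ => ⟨h₂.symm, h₁.symm⟩
    · exact fun h₁ h₂ => ⟨h₁.trans h₂, h₂.symm⟩
    · exact fun h₁ h₂ => ⟨h₂.symm, h₂.trans h₁⟩
    · exact fun h₁ h₂ => ⟨h₁.symm, h₂.symm⟩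
    · exact fun h₁ h₂ => ⟨h₁.symm, h₁.trans h₂⟩
  rw [← h₁.2, h₁.1, ← pow_two, ← pow_succ, pow_eq_one_iff_of_nonneg zero_le (by norm_num)] at h
  fin_cases k
  exacts [h₁.1.trans h, h, h₁.2.symm.trans h]

/-! ### Torus points over the fraction field of a valuation ring -/

section ValuativeCriterion

variable {R K : Type} [CommRing R] [IsDomain R] [ValuationRing R] [Field K] [Algebra R K]
  [IsFractionRing R K]

lemma isUnit_of_valuation_eq_one {a : R}
    (h : ValuationRing.valuation R K (algebraMap R K a) = 1) : IsUnit a := by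
  have h0 : algebraMap R K a ≠ 0 := by
    rw [← Valuation.ne_zero_iff (ValuationRing.valuation R K), h]
    exact one_ne_zero
  have : ValuationRing.valuation R K (algebraMap R K a)⁻¹ ≤ 1 := by rw [map_inv₀, h, inv_one]
  obtain ⟨b, hb⟩ := (ValuationRing.mem_integer_iff R K _).mp this
  refine .of_mul_eq_one b (IsFractionRing.injective R K ?_)
  rw [map_mul, hb, mul_inv_cancel₀ h0, map_one]

lemma valuation_eq_one_of_isUnit {a : R} (h : IsUnit a) :
    ValuationRing.valuation R K (algebraMap R K a) = 1 := by
  have hle : ∀ b : R, ValuationRing.valuation R K (algebraMap R K b) ≤ 1 := fun b =>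
    (ValuationRing.mem_integer_iff R K _).mpr ⟨b, rfl⟩
  obtain ⟨b, hb⟩ := h.exists_right_inv
  refine le_antisymm (hle a) ?_
  have := congrArg (fun x => ValuationRing.valuation R K (algebraMap R K x)) hb
  simp only [map_mul, map_one] at this
  rw [← this]
  exact mul_le_of_le_one_right' (hle b)

/-- A torus point over the fraction field on which the potential is integral extends to a chart. -/
lemma exists_chart_lift (τ : TorusRing →+* K) (w : R)
    (hw : algebraMap R K w = τ torusPotential) :
    ∃ (j : Fin 3) (u v : R), algebraMap R K u = τ (transition j uu) ∧
      algebraMap R K v = τ (transition j vv) ∧ IsUnit (u * v - 1) := by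
  obtain ⟨j, h₁, h₂⟩ := exists_valuation_eq (ValuationRing.valuation R K)
    (fun i => τ (chi (expo i)))
    (fun i => by rw [← map_mul, ← map_mul, chi_expo_prod, map_one])
    (fun i => by
      rw [← map_add, ← map_add, ← torusPotential_eq, ← hw]
      exact (ValuationRing.mem_integer_iff R K _).mpr ⟨w, rfl⟩)
  set val := ValuationRing.valuation R K
  have hinv : ∀ m, τ (chi (-m)) = (τ (chi m))⁻¹ := fun m => by
    apply eq_inv_of_mul_eq_one_right
    rw [← map_mul, chi_mul_neg, map_one]
  have hne : ∀ m, τ (chi m) ≠ 0 := fun m => ((isUnit_chi m).map τ).ne_zero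
  -- Since the product is `1`, `z_j` has the valuation of `z_{j+1}⁻²`.
  have h0 : val (τ (chi (expo j))) ≤ 1 := by
    have := congrArg (fun x => val (τ x)) (chi_expo_prod j)
    simp only [map_mul, map_one] at this
    rw [← h₁, mul_assoc] at this
    rw [eq_inv_of_mul_eq_one_left this]
    exact inv_le_one_of_one_le₀ (one_le_mul h₂ h₂)
  obtain ⟨v, hv⟩ : ∃ v, algebraMap R K v = τ (transition j vv) := by
    rw [← ValuationRing.mem_integer_iff, transition_vv, hinv]
    change val _ ≤ 1
    rw [map_inv₀]
    exact inv_le_one_of_one_le₀ h₂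
  obtain ⟨z, hz⟩ : ∃ z, algebraMap R K z = τ (chi (expo j)) :=
    (ValuationRing.mem_integer_iff R K _).mp h0
  -- The summands of `u = z_{j+1} + z_{j+2}` need not be integral, but their sum is the potential
  -- minus `z_j`, and both of these are.
  have hu : algebraMap R K (w - z) = τ (transition j uu) := by
    rw [map_sub, hw, hz, transition_uu, torusPotential_eq j, ← map_sub]
    congr 1
    ring
  refine ⟨j, w - z, v, hu, hv, isUnit_of_valuation_eq_one (K := K) ?_⟩
  have : algebraMap R K ((w - z) * v - 1) = τ (transition j zeta) := by
    simp only [map_sub, map_mul, map_one, hu, hv, zeta_val]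
  -- `ζ = z_{j+2} / z_{j+1}` has valuation `1` by the choice of `j`.
  rw [this, transition_zeta', sub_eq_add_neg, chi_add, map_mul, map_mul, hinv, map_inv₀]
  change val _ * (val _)⁻¹ = 1
  rw [← h₁]
  exact mul_inv_cancel₀ ((Valuation.ne_zero_iff _).mpr (hne _))

end ValuativeCriterion

lemma chartPoint_chartMap {L : Type} [CommRing L] (φ : ChartRing →+* L) :
    chartPoint φ ≫ chartMap = Spec.map (CommRingCat.ofHom
      (φ.comp (Polynomial.aeval (R := ℂ) chartPotential).toRingHom)) :=
  (Spec.map_comp _ _).symm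

lemma chartPoint_potential {L : Type} [CommRing L] (φ : ChartRing →+* L) (i : Fin 3)
    (ψ : Polynomial ℂ →+* L)
    (h : chartPoint φ ≫ chartι i ≫ gluedPotential = Spec.map (CommRingCat.ofHom ψ)) :
    φ.comp (Polynomial.aeval (R := ℂ) chartPotential).toRingHom = ψ := by
  rw [chartι_gluedPotential, chartPoint_chartMap] at h
  exact congrArg CommRingCat.Hom.hom (Spec.map_injective h)

/-- A point of an axis extends along that axis, with `u` the given value of the potential. A point
of the torus extends by `exists_chart_lift`, in general to a chart different from the one it was
given in. -/
lemma valuativeCriterion_existence : ValuativeCriterion.Existence gluedPotential := by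
  rintro ⟨R, K, i₁, i₂, ⟨hw⟩⟩
  obtain ⟨i, φ, rfl⟩ := exists_chartPoint_of_isLocalRing i₁
  obtain ⟨ψ, rfl⟩ : ∃ ψ : Polynomial ℂ →+* R, Spec.map (CommRingCat.ofHom ψ) = i₂ :=
    ⟨(Spec.preimage i₂).hom, Spec.map_preimage i₂⟩
  have hψ : φ.comp (Polynomial.aeval (R := ℂ) chartPotential).toRingHom =
      (algebraMap R K).comp ψ := by
    refine chartPoint_potential φ i _ ?_
    rw [← Category.assoc, hw]
    exact (Spec.map_comp _ _).symm
  have hC : ∀ c : ℂ, φ (algebraMap ℂ _ c) = algebraMap R K (ψ (Polynomial.C c)) := fun c => by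
    simpa using congrArg (fun f => f (Polynomial.C c)) hψ
  have hX : φ chartPotential = algebraMap R K (ψ Polynomial.X) := by
    simpa using congrArg (fun f => f Polynomial.X) hψ
  -- The `ℂ`-structure of `R` is read off from its map to the affine line.
  let _ : Algebra ℂ R := (ψ.comp Polynomial.C).toAlgebra
  -- It is enough to extend the generic point: compatibility with the potential over `R` can be
  -- tested in `K`.
  suffices h : ∃ (j : Fin 3) (χ : ChartRing →+* R),
      chartPoint ((algebraMap R K).comp χ) ≫ chartι j = chartPoint φ ≫ chartι i by
    obtain ⟨j, χ, h⟩ := h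
    refine ⟨⟨⟨chartPoint χ ≫ chartι j, ?_, ?_⟩⟩⟩
    · rw [← Category.assoc, map_chartPoint, h]
    · rw [Category.assoc, chartι_gluedPotential, chartPoint_chartMap]
      congr 2
      have h' := congrArg (fun f => f ≫ gluedPotential) h
      simp only [Category.assoc, chartι_gluedPotential, chartPoint_chartMap] at h'
      have h'' := congrArg CommRingCat.Hom.hom (Spec.map_injective h')
      change _ = φ.comp _ at h''
      rw [hψ] at h''
      exact RingHom.ext fun x =>
        IsFractionRing.injective R K (congrArg (fun f => f x) h'')
  have hext : ∀ (j : Fin 3) (u v : R) (h : IsUnit (u * v - 1)) (χ : ChartRing →+* K),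
      (∀ c : ℂ, χ (algebraMap ℂ _ c) = algebraMap R K (ψ (Polynomial.C c))) →
      algebraMap R K u = χ uu → algebraMap R K v = χ vv →
      (algebraMap R K).comp (chartLift u v h).toRingHom = χ := by
    intro j u v h χ hc hu hv
    apply chart_ringHom_ext
    · intro c
      rw [hc]
      exact congrArg (algebraMap R K) ((chartLift u v h).commutes c)
    · rw [← hu]
      exact congrArg (algebraMap R K) (chartLift_uu u v h)
    · rw [← hv]
      exact congrArg (algebraMap R K) (chartLift_vv u v h)
  by_cases hv : φ vv = 0
  · have hu : φ uu = algebraMap R K (ψ Polynomial.X) := by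
      rw [← hX, chartPotential, map_add, map_mul, map_pow, hv]
      ring
    refine ⟨i, (chartLift (ψ Polynomial.X) 0
      (by rw [mul_zero, zero_sub]; exact isUnit_one.neg)).toRingHom, ?_⟩
    rw [hext i _ _ _ φ hC hu.symm (by rw [hv, map_zero])]
  · obtain ⟨τ, rfl⟩ := exists_torus_of_isUnit i φ (isUnit_iff_ne_zero.mpr hv)
    have hτ : ∀ c : ℂ, τ (algebraMap ℂ _ c) = algebraMap R K (ψ (Polynomial.C c)) := fun c => by
      rw [← hC, RingHom.comp_apply, transition_algebraMap_complex]
    obtain ⟨j, u, v, hu, hv', huv⟩ := exists_chart_lift τ (ψ Polynomial.X)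
      (by rw [← hX, RingHom.comp_apply, transition_chartPotential])
    refine ⟨j, (chartLift u v huv).toRingHom, ?_⟩
    rw [hext j u v huv (τ.comp (transition j)) ?_ hu hv', chartPoint_comp_transition,
      chartPoint_comp_transition]
    intro c
    rw [RingHom.comp_apply, transition_algebraMap_complex, hτ]

/-- Lifts in one chart agree because `R → K` is injective. For lifts in two charts, each chart makes
its `ζ` a unit of `R` and so equates two of the valuations of the `z_k`. All three are then `1`, and
both lifts factor through the affine torus. Compatibility with the potential is not needed for this.
-/
lemma valuativeCriterion_uniqueness : ValuativeCriterion.Uniqueness gluedPotential := by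
  rintro ⟨R, K, i₁, i₂, hsq⟩
  refine ⟨?_⟩
  rintro ⟨l₁, hl₁, -⟩ ⟨l₂, hl₂, -⟩
  suffices h : l₁ = l₂ by subst h; rfl
  obtain ⟨i, φ, rfl⟩ := exists_chartPoint_of_isLocalRing l₁
  obtain ⟨j, χ, rfl⟩ := exists_chartPoint_of_isLocalRing l₂
  have hinj : ∀ {A : Type} [CommRing A] {f g : A →+* R},
      (algebraMap R K).comp f = (algebraMap R K).comp g → f = g := fun h =>
    RingHom.ext fun x => IsFractionRing.injective R K (congrArg (fun f => f x) h)
  have h := hl₁.trans hl₂.symm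
  rw [← Category.assoc, ← Category.assoc, map_chartPoint, map_chartPoint] at h
  by_cases hij : i = j
  · subst hij
    rw [cancel_mono] at h
    rw [hinj (chartPoint_injective h)]
  · have hφ := chartPoint_vv_ne_zero hij h
    have hχ := chartPoint_vv_ne_zero (Ne.symm hij) h.symm
    obtain ⟨τ, hτ⟩ := exists_torus_of_isUnit i _ (isUnit_iff_ne_zero.mpr hφ)
    obtain ⟨τ', hτ'⟩ := exists_torus_of_isUnit j _ (isUnit_iff_ne_zero.mpr hχ)
    rw [← hτ, ← hτ', chartPoint_comp_transition, chartPoint_comp_transition, cancel_mono] at h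
    have := torusPoint_injective h
    subst this
    set val := ValuationRing.valuation R K
    have hinv : ∀ m, val (τ (chi (-m))) = (val (τ (chi m)))⁻¹ := fun m => by
      apply eq_inv_of_mul_eq_one_right
      rw [← map_mul, ← map_mul, chi_mul_neg, map_one, map_one]
    have hne : ∀ m, val (τ (chi m)) ≠ 0 := fun m =>
      (Valuation.ne_zero_iff _).mpr ((isUnit_chi m).map τ).ne_zero
    -- `ζ = z_{k+2} / z_{k+1}` is a unit of `R` at an integral point of chart `k`.
    have key : ∀ (k : Fin 3) (ρ : ChartRing →+* R),
        τ.comp (transition k) = (algebraMap R K).comp ρ →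
        val (τ (chi (expo (k + 2)))) = val (τ (chi (expo (k + 1)))) := by
      intro k ρ hρ
      have h₁ := valuation_eq_one_of_isUnit (K := K) (zeta.isUnit.map ρ)
      rw [← RingHom.comp_apply, ← hρ, RingHom.comp_apply, transition_zeta', sub_eq_add_neg,
        chi_add, map_mul, map_mul] at h₁
      change val _ * val _ = 1 at h₁
      rw [hinv] at h₁
      exact (mul_inv_eq_one₀ (hne _)).mp h₁
    have hone : ∀ k, val (τ (chi (expo k))) = 1 := by
      refine eq_one_of_rotation (fun k => val (τ (chi (expo k)))) hij (key i φ hτ) (key j χ hτ') ?_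
      rw [← map_mul, ← map_mul, ← map_mul, ← map_mul]
      exact (congrArg (fun x => val (τ x)) (chi_expo_prod 0)).trans (by rw [map_one, map_one])
    have hu : ∀ (k : Fin 3) (ρ : ChartRing →+* R),
        τ.comp (transition k) = (algebraMap R K).comp ρ → IsUnit (ρ vv) := by
      intro k ρ hρ
      apply isUnit_of_valuation_eq_one (K := K)
      rw [← RingHom.comp_apply, ← hρ, RingHom.comp_apply, transition_vv]
      change val _ = 1
      rw [hinv, hone, inv_one]
    obtain ⟨σ, rfl⟩ := exists_torus_of_isUnit i φ (hu i φ hτ)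
    obtain ⟨σ', rfl⟩ := exists_torus_of_isUnit j χ (hu j χ hτ')
    have e : σ = σ' := by
      apply hinj
      rw [← torus_ringHom_ext i (hτ.trans (RingHom.comp_assoc _ _ _).symm),
        ← torus_ringHom_ext j (hτ'.trans (RingHom.comp_assoc _ _ _).symm)]
    rw [e, chartPoint_comp_transition, chartPoint_comp_transition]

lemma isProper_gluedPotential : IsProper gluedPotential :=
  .of_valuativeCriterion _ (ValuativeCriterion.iff.mpr
    ⟨valuativeCriterion_existence, valuativeCriterion_uniqueness⟩)

/-! ### Points of the projective plane in homogeneous coordinates -/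

/-- The grading of the homogeneous coordinate ring of the projective plane. -/
abbrev planeGrading : ℕ → Submodule ℂ (MvPolynomial (Fin 3) ℂ) :=
  MvPolynomial.homogeneousSubmodule (Fin 3) ℂ

section ProjPoint

open HomogeneousLocalization MvPolynomial

variable {S S' : Type} [CommRing S] [Algebra ℂ S] [CommRing S'] [Algebra ℂ S']
  (a : Fin 3 → S) {f g : MvPolynomial (Fin 3) ℂ} {m n : ℕ}

/-- Evaluation of homogeneous fractions with denominators powers of `f` at a tuple at which `f`
is invertible. -/
def awayEval (h : IsUnit (aeval a f)) : Away planeGrading f →+* S :=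
  (IsLocalization.Away.lift (S := Localization.Away f) (g := (aeval a).toRingHom) f h).comp
    (algebraMap (Away planeGrading f) (Localization.Away f))

variable {a}

/-- The value of a fraction `x / f ^ k`, with the denominator cleared so that no inverse has to be
named. -/
lemma awayEval_mk (h : IsUnit (aeval a f)) (hf : f ∈ planeGrading m) (k : ℕ)
    (x : MvPolynomial (Fin 3) ℂ) (hx : x ∈ planeGrading (k • m)) :
    awayEval a h (Away.mk planeGrading hf k x hx) * aeval a f ^ k = aeval a x := by
  have key : ∀ y, IsLocalization.Away.lift (S := Localization.Away f) (g := (aeval a).toRingHom) f h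
    (algebraMap _ _ y) = aeval a y := fun y => IsLocalization.Away.lift_eq f h y
  change IsLocalization.Away.lift f h (Away.mk planeGrading hf k x hx).val * _ = _
  rw [Away.val_mk, ← key f, ← map_pow, ← map_mul, ← map_pow, Localization.mk_eq_mk']
  exact (congrArg _ (IsLocalization.mk'_spec (Localization (Submonoid.powers f)) x
    (⟨f ^ k, k, rfl⟩ : Submonoid.powers f))).trans (key x)

/-- As `f` is invertible at `a`, the cleared relation determines the map. Every comparison of
evaluations below is reduced to this. -/
lemma awayEval_eq (h : IsUnit (aeval a f)) (hf : f ∈ planeGrading m)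
    (φ : Away planeGrading f →+* S)
    (H : ∀ k x hx, φ (Away.mk planeGrading hf k x hx) * aeval a f ^ k = aeval a x) :
    φ = awayEval a h := by
  ext y
  obtain ⟨k, x, hx, rfl⟩ := Away.mk_surjective planeGrading hf y
  exact (h.pow k).mul_left_injective ((H k x hx).trans (awayEval_mk h hf k x hx).symm)

lemma awayEval_comp_awayMap (h : IsUnit (aeval a f)) (hf : f ∈ planeGrading m)
    (hg : g ∈ planeGrading n) (hfg : IsUnit (aeval a (f * g))) :
    (awayEval a hfg).comp (awayMap planeGrading hg rfl) = awayEval a h := by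
  refine awayEval_eq h hf _ fun k x hx => ?_
  have hu : IsUnit (aeval a g) := by
    rw [map_mul] at hfg
    exact isUnit_of_mul_isUnit_right hfg
  rw [RingHom.comp_apply, awayMap_mk]
  refine (hu.pow k).mul_left_injective ?_
  have := awayEval_mk hfg (SetLike.mul_mem_graded hf hg) k (x * g ^ k)
    (by rw [smul_add]; exact SetLike.mul_mem_graded hx (SetLike.pow_mem_graded k hg))
  rw [map_mul, mul_pow, map_mul, map_pow, ← mul_assoc] at this
  exact this

/-- The affine open subscheme of the projective plane where `f` does not vanish. -/
def planeι (hf : f ∈ planeGrading m) (hm : 0 < m) :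
    Spec (.of (Away planeGrading f)) ⟶ projPlane :=
  Proj.awayι planeGrading f hf hm

instance (hf : f ∈ planeGrading m) (hm : 0 < m) : IsOpenImmersion (planeι hf hm) :=
  inferInstanceAs (IsOpenImmersion (Proj.awayι planeGrading f hf hm))

variable (a) in
/-- The morphism to the projective plane with homogeneous coordinates `a`, if the homogeneous
polynomial `f` is invertible at `a`. -/
def projPoint (hf : f ∈ planeGrading m) (hm : 0 < m) (h : IsUnit (aeval a f)) :
    Spec (.of S) ⟶ projPlane :=
  Spec.map (CommRingCat.ofHom (awayEval a h)) ≫ planeι hf hm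

lemma projPoint_mul (hf : f ∈ planeGrading m) (hm : 0 < m) (h : IsUnit (aeval a f))
    (hg : g ∈ planeGrading n) (hfg : IsUnit (aeval a (f * g))) :
    projPoint a (SetLike.mul_mem_graded hf hg) (by lia) hfg = projPoint a hf hm h := by
  have e : planeι (SetLike.mul_mem_graded hf hg) (by lia) =
      Spec.map (CommRingCat.ofHom (awayMap planeGrading hg rfl)) ≫ planeι hf hm :=
    (Proj.SpecMap_awayMap_awayι planeGrading hf hm hg rfl).symm
  rw [projPoint, projPoint, ← awayEval_comp_awayMap h hf hg hfg, e, CommRingCat.ofHom_comp,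
    Spec.map_comp, Category.assoc]

/-- Both morphisms factor through the locus `f g ≠ 0`, where they are given by the same evaluation.
-/
lemma projPoint_congr_denom (hf : f ∈ planeGrading m) (hm : 0 < m) (h : IsUnit (aeval a f))
    (hg : g ∈ planeGrading n) (hn : 0 < n) (h' : IsUnit (aeval a g)) :
    projPoint a hf hm h = projPoint a hg hn h' := by
  have hfg : IsUnit (aeval a (f * g)) := by rw [map_mul]; exact h.mul h'
  rw [← projPoint_mul hf hm h hg hfg]
  have hgf : IsUnit (aeval a (g * f)) := by rw [map_mul]; exact h'.mul h
  rw [← projPoint_mul hg hn h' hf hgf]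
  -- `f * g` and `g * f`, like the degrees `m + n` and `n + m`, are equal only propositionally, so
  -- polynomial and degree are made variables before substituting.
  have : ∀ (p q : MvPolynomial (Fin 3) ℂ) (k l : ℕ) (hp : p ∈ planeGrading k)
      (hq : q ∈ planeGrading l) (hk : 0 < k) (hl : 0 < l) (h₁ : IsUnit (aeval a p))
      (h₂ : IsUnit (aeval a q)) (_ : p = q) (_ : k = l),
      projPoint a hp hk h₁ = projPoint a hq hl h₂ := by
    rintro p _ k _ _ _ _ _ _ _ rfl rfl; rfl
  exact this _ _ _ _ _ _ _ _ _ _ (mul_comm _ _) (add_comm _ _)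

lemma aeval_smul_of_mem (c : S) (hf : f ∈ planeGrading m) :
    aeval (fun i => c * a i) f = c ^ m * aeval a f := by
  rw [aeval_def, aeval_def, eval₂_eq', eval₂_eq', Finset.mul_sum]
  refine Finset.sum_congr rfl fun d hd => ?_
  have hd' : ∑ i, d i = m := by
    have := (mem_homogeneousSubmodule m f).mp hf (mem_support_iff.mp hd)
    rwa [Finsupp.weight_apply, Finsupp.sum_fintype _ _ (by simp), Finset.sum_congr rfl
      (fun i _ => show d i • (1 : Fin 3 → ℕ) i = d i by simp)] at this
  simp only [mul_pow, Finset.prod_mul_distrib, Finset.prod_pow_eq_pow_sum, hd']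
  ring

lemma projPoint_smul (c : S) (hf : f ∈ planeGrading m) (hm : 0 < m) (h : IsUnit (aeval a f))
    (h' : IsUnit (aeval (fun i => c * a i) f)) :
    projPoint (fun i => c * a i) hf hm h' = projPoint a hf hm h := by
  have : awayEval _ h = awayEval _ h' := by
    refine awayEval_eq h' hf _ fun k x hx => ?_
    rw [aeval_smul_of_mem c hf, aeval_smul_of_mem c hx, mul_pow, mul_left_comm,
      awayEval_mk h hf k x hx, ← pow_mul, smul_eq_mul, mul_comm m]
  rw [projPoint, projPoint, this]

lemma map_projPoint (φ : S →ₐ[ℂ] S') {b : Fin 3 → S'} (hb : ∀ i, φ (a i) = b i)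
    (hf : f ∈ planeGrading m) (hm : 0 < m) (h : IsUnit (aeval a f)) (h' : IsUnit (aeval b f)) :
    Spec.map (CommRingCat.ofHom φ.toRingHom) ≫ projPoint a hf hm h = projPoint b hf hm h' := by
  have hφ : ∀ x, φ (aeval a x) = aeval b x := fun x => by
    rw [← AlgHom.comp_apply, comp_aeval, ← funext hb]
  have : φ.toRingHom.comp (awayEval _ h) = awayEval _ h' := by
    refine awayEval_eq h' hf _ fun k x hx => ?_
    rw [← hφ, ← hφ, ← awayEval_mk h hf k x hx, map_mul, map_pow]
    rfl
  rw [projPoint, projPoint, ← this, CommRingCat.ofHom_comp, Spec.map_comp, Category.assoc]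

lemma projPoint_mem_basicOpen (hf : f ∈ planeGrading m) (hm : 0 < m) (h : IsUnit (aeval a f))
    (hg : g ∈ planeGrading n) (hn : 0 < n) (p : PrimeSpectrum S) :
    projPoint a hf hm h p ∈ Proj.basicOpen planeGrading g ↔ aeval a g ∉ p.asIdeal := by
  change (Spec.map (CommRingCat.ofHom (awayEval a h)) p) ∈
    (Proj.awayι planeGrading f hf hm ⁻¹ᵁ Proj.basicOpen planeGrading g) ↔ _
  rw [Proj.awayι_preimage_basicOpen planeGrading hf hm hg hn]
  change awayEval a h _ ∉ p.asIdeal ↔ _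
  rw [not_iff_not]
  -- Inside `f ≠ 0` the locus `g ≠ 0` is cut out by the degree-zero fraction `g ^ m / f ^ n`.
  have e := awayEval_mk h hf n (g ^ m)
    (by convert! SetLike.pow_mem_graded m hg using 2; exact mul_comm _ _)
  rw [map_pow] at e
  rw [← p.isPrime.pow_mem_iff_mem (r := aeval a g) m hm, ← e]
  exact ((Ideal.mul_unit_mem_iff_mem _ (h.pow n))).symm

lemma projPoint_projPlaneToSpec (hf : f ∈ planeGrading m) (hm : 0 < m) (h : IsUnit (aeval a f)) :
    projPoint a hf hm h ≫ projPlaneToSpec =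
      Spec.map (CommRingCat.ofHom (algebraMap ℂ S)) := by
  have e : planeι hf hm ≫ projPlaneToSpec = Spec.map (CommRingCat.ofHom
      ((fromZeroRingHom planeGrading (Submonoid.powers f)).comp
        (algebraMap ℂ (planeGrading 0)))) := by
    refine (Category.assoc _ _ _).symm.trans ((congrArg (· ≫ _)
      (Proj.awayι_toSpecZero planeGrading f hf hm)).trans ?_)
    exact (Spec.map_comp _ _).symm
  rw [projPoint, Category.assoc, e]
  refine (Spec.map_comp _ _).symm.trans (congrArg Spec.map (?_ : CommRingCat.ofHom
    ((awayEval a h).comp ((fromZeroRingHom planeGrading (Submonoid.powers f)).comp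
      (algebraMap ℂ (planeGrading 0)))) = _))
  congr 1
  ext c
  have := awayEval_mk h hf 0 (algebraMap ℂ _ c) (by
    rw [zero_smul]; exact (algebraMap ℂ (planeGrading 0) c).2)
  rw [pow_zero, mul_one, AlgHom.commutes] at this
  rw [← this]
  simp only [RingHom.comp_apply]
  congr 1
  ext
  change Localization.mk _ _ = Localization.mk _ _
  congr 1

end ProjPoint

instance : IsSeparated projPlaneToSpec :=
  inferInstanceAs (IsSeparated (Proj.toSpecZero planeGrading ≫
    Spec.map (CommRingCat.ofHom (algebraMap ℂ (planeGrading 0)))))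

/-! ### The morphism to the projective plane -/

/-- The homogeneous coordinates `[-1 : z₁ : z₂]` on the torus. -/
def torusCoord : Fin 3 → TorusRing := ![-1, chi (1, 0), chi (0, 1)]

/-- The homogeneous coordinates on the charts. -/
def chartCoord (i : Fin 3) : Fin 3 → ChartRing :=
  ![![-vv, 1, zeta], ![-vv, vv ^ 3 * ↑zeta⁻¹, 1], ![-vv, zeta, vv ^ 3 * ↑zeta⁻¹]] i

/-- A homogeneous coordinate which is invertible on the chart. -/
def unitCoord : Fin 3 → Fin 3 := ![1, 2, 1]

lemma isUnit_chartCoord (i : Fin 3) : IsUnit (chartCoord i (unitCoord i)) := by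
  fin_cases i
  · exact isUnit_one
  · exact isUnit_one
  · exact zeta.isUnit

lemma isUnit_torusCoord (i : Fin 3) : IsUnit (torusCoord i) := by
  fin_cases i
  · exact isUnit_one.neg
  · exact isUnit_chi _
  · exact isUnit_chi _

/-- The chart coordinates are `v` times `(-1, z_1, z_2)`, with `v z_{i+1} = 1`, `v z_{i+2} = ζ` and
`v z_i = v³ / ζ`. -/
lemma transition_chartCoord (i k : Fin 3) :
    transition i (chartCoord i k) = chi (-expo (i + 1)) * torusCoord k := by
  fin_cases i <;> fin_cases k <;>
    simp [chartCoord, torusCoord, transition_vv, transition_zeta, transition_zeta_inv, pow_succ,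
      ← chi_add, -neg_add_rev] <;>
    rfl

lemma X_mem_planeGrading (k : Fin 3) : MvPolynomial.X k ∈ planeGrading 1 :=
  MvPolynomial.isHomogeneous_X ℂ k

/-- The morphism `[-1 : z₁ : z₂]` to the projective plane on the torus. -/
def torusToPlane : torus ⟶ projPlane :=
  projPoint torusCoord (X_mem_planeGrading 0) one_pos (by
    rw [MvPolynomial.aeval_X]; exact isUnit_torusCoord 0)

/-- The morphism to the projective plane on the charts. -/
def chartToPlane (i : Fin 3) : chart ⟶ projPlane :=
  projPoint (chartCoord i) (X_mem_planeGrading (unitCoord i)) one_pos (by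
    rw [MvPolynomial.aeval_X]; exact isUnit_chartCoord i)

lemma torusToChart_chartToPlane (i : Fin 3) :
    torusToChart i ≫ chartToPlane i = torusToPlane := by
  have hu : IsUnit (MvPolynomial.aeval (R := ℂ) (fun k => chi (-expo (i + 1)) * torusCoord k)
      (MvPolynomial.X (unitCoord i))) := by
    rw [MvPolynomial.aeval_X]
    exact (isUnit_chi _).mul (isUnit_torusCoord _)
  have h₀ : IsUnit (MvPolynomial.aeval (R := ℂ) torusCoord (MvPolynomial.X (unitCoord i))) := by
    rw [MvPolynomial.aeval_X]
    exact isUnit_torusCoord _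
  refine (map_projPoint (transitionₐ i) (transition_chartCoord i) _ one_pos _ hu).trans ?_
  rw [projPoint_smul _ _ _ h₀]
  exact projPoint_congr_denom _ _ _ _ _ _

/-- The morphism `[-1 : z₁ : z₂]` to the projective plane on the glued space. -/
def planeMap : gluedSpace ⟶ projPlane :=
  gluedDesc torusToPlane chartToPlane torusToChart_chartToPlane

@[simp]
lemma chartι_planeMap (i : Fin 3) : chartι i ≫ planeMap = chartToPlane i :=
  chartι_gluedDesc _ _ _ i

/-! ### The fibres of the potential -/

/-- Base change of an algebra over the affine line along a point of the line. -/
lemma isPushout_quotient {A : Type} [CommRing A] (σ : Polynomial ℂ →+* A) (c : ℂ) :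
    IsPushout (CommRingCat.ofHom σ) (CommRingCat.ofHom (Polynomial.evalRingHom c))
      (CommRingCat.ofHom (Ideal.Quotient.mk
        (Ideal.span {σ Polynomial.X - σ (Polynomial.C c)})))
      (CommRingCat.ofHom ((Ideal.Quotient.mk
        (Ideal.span {σ Polynomial.X - σ (Polynomial.C c)})).comp (σ.comp Polynomial.C))) := by
  refine ⟨⟨?_⟩, ⟨PushoutCocone.IsColimit.mk _ (fun s => CommRingCat.ofHom (Ideal.Quotient.lift _
    s.inl.hom ?_)) ?_ ?_ ?_⟩⟩
  · rw [← CommRingCat.ofHom_comp, ← CommRingCat.ofHom_comp]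
    congr 1
    apply Polynomial.ringHom_ext
    · intro r; simp
    · simp only [RingHom.comp_apply, Polynomial.coe_evalRingHom, Polynomial.eval_X]
      exact Ideal.Quotient.eq.mpr (Ideal.mem_span_singleton_self _)
  · have hs : ∀ p, s.inl.hom (σ p) = s.inr.hom (p.eval c) := fun p =>
      congrArg (fun f => f.hom p) s.condition
    intro x hx
    obtain ⟨y, rfl⟩ := Ideal.mem_span_singleton'.mp hx
    rw [map_mul, map_sub, hs, hs]
    simp
  · intro s
    ext x
    simp
  · intro s
    ext x
    have hs : ∀ p, s.inl.hom (σ p) = s.inr.hom (p.eval c) := fun p =>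
      congrArg (fun f => f.hom p) s.condition
    simpa using hs (Polynomial.C x)
  · intro s m h₁ h₂
    apply CommRingCat.hom_ext
    apply Ideal.Quotient.ringHom_ext
    ext x
    simpa using congrArg (fun f => f.hom x) h₁

/-- The coordinate ring of the fibre of the potential on a chart. -/
abbrev FibreRing (c : ℂ) : Type :=
  ChartRing ⧸ Ideal.span {chartPotential - algebraMap ℂ ChartRing c}

/-- The restriction of functions on a chart to the fibre of the potential. -/
def toFibre (c : ℂ) : ChartRing →ₐ[ℂ] FibreRing c := Ideal.Quotient.mkₐ ℂ _

lemma toFibre_surjective (c : ℂ) : Function.Surjective (toFibre c) :=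
  Ideal.Quotient.mk_surjective

lemma toFibre_chartPotential (c : ℂ) : toFibre c chartPotential = algebraMap ℂ _ c := by
  rw [← (toFibre c).commutes]
  exact Ideal.Quotient.eq.mpr (Ideal.mem_span_singleton_self _)

/-- The inclusion of the fibre of the potential on a chart. -/
def fibreToChart (c : ℂ) : Spec (.of (FibreRing c)) ⟶ chart :=
  Spec.map (CommRingCat.ofHom (toFibre c).toRingHom)

/-- The structure morphism of the fibre of the potential on a chart. -/
def fibreToSpec (c : ℂ) : Spec (.of (FibreRing c)) ⟶ specC :=
  Spec.map (CommRingCat.ofHom (algebraMap ℂ (FibreRing c)))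

lemma isPullback_fibreToChart (c : ℂ) :
    IsPullback (fibreToChart c) (fibreToSpec c) chartMap (linePoint c) := by
  have h := isPullback_SpecMap_of_isPushout _ _ _ _
    (isPushout_quotient (Polynomial.aeval (R := ℂ) chartPotential).toRingHom c)
  have e₁ : (Polynomial.aeval (R := ℂ) chartPotential).toRingHom Polynomial.X = chartPotential :=
    Polynomial.aeval_X _
  have e₂ : (Polynomial.aeval (R := ℂ) chartPotential).toRingHom (Polynomial.C c) =
      algebraMap ℂ _ c := Polynomial.aeval_C _ _
  have e₃ : (Polynomial.aeval (R := ℂ) chartPotential).toRingHom.comp Polynomial.C =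
      algebraMap ℂ _ := by ext; exact Polynomial.aeval_C _ _
  rw [e₁, e₂, e₃] at h
  exact h

/-- The `i`-th chart of the fibre of the potential. -/
def fibreι (c : ℂ) (i : Fin 3) :
    Spec (.of (FibreRing c)) ⟶ pullback gluedPotential (linePoint c) :=
  pullback.lift (fibreToChart c ≫ chartι i) (fibreToSpec c) (by
    rw [Category.assoc, chartι_gluedPotential, (isPullback_fibreToChart c).w])

@[simp]
lemma fibreι_fst (c : ℂ) (i : Fin 3) :
    fibreι c i ≫ pullback.fst _ _ = fibreToChart c ≫ chartι i := pullback.lift_fst _ _ _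

@[simp]
lemma fibreι_snd (c : ℂ) (i : Fin 3) :
    fibreι c i ≫ pullback.snd _ _ = fibreToSpec c := pullback.lift_snd _ _ _

/-- Pasting of pullback squares: the fibre of a chart is the preimage of that chart in the whole
fibre, hence open in it. -/
lemma isPullback_fibreι (c : ℂ) (i : Fin 3) :
    IsPullback (fibreToChart c) (fibreι c i) (chartι i)
      (pullback.fst gluedPotential (linePoint c)) := by
  refine (IsPullback.of_right (h₁₁ := fibreι c i) (v₁₁ := fibreToChart c) (v₁₂ := pullback.fst _ _)
    (h₂₁ := chartι i) ?_ (fibreι_fst c i) (IsPullback.of_hasPullback _ _).flip).flip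
  rw [chartι_gluedPotential, fibreι_snd]
  exact (isPullback_fibreToChart c).flip

instance (c : ℂ) (i : Fin 3) : IsOpenImmersion (fibreι c i) :=
  MorphismProperty.of_isPullback (isPullback_fibreι c i) inferInstance

lemma mem_range_fibreι (c : ℂ) (i : Fin 3) {x : ↥(pullback gluedPotential (linePoint c))}
    (hx : pullback.fst gluedPotential (linePoint c) x ∈ Set.range (chartι i)) :
    x ∈ Set.range (fibreι c i) := by
  obtain ⟨y, hy⟩ := hx
  obtain ⟨z, -, hz⟩ := Scheme.Pullback.exists_preimage_pullback _ _ hy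
  refine ⟨(isPullback_fibreι c i).isoPullback.inv z, ?_⟩
  rw [← hz, ← (isPullback_fibreι c i).isoPullback_inv_snd]
  rfl

lemma exists_fibreι_eq (c : ℂ) (x : ↥(pullback gluedPotential (linePoint c))) :
    ∃ i y, fibreι c i y = x := by
  obtain ⟨i, y, hy⟩ := exists_chartι_eq (pullback.fst gluedPotential (linePoint c) x)
  obtain ⟨z, hz⟩ := mem_range_fibreι c i ⟨y, hy⟩
  exact ⟨i, z, hz⟩

/-- The covering of the fibre by its charts. -/
def fibreCover (c : ℂ) : (pullback gluedPotential (linePoint c)).OpenCover where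
  I₀ := Fin 3
  X _ := Spec (.of (FibreRing c))
  f := fibreι c
  mem₀ := by
    rw [Scheme.presieve₀_mem_precoverage_iff]
    exact ⟨fun x => (exists_fibreι_eq c x).imp fun i ⟨y, hy⟩ => ⟨y, hy⟩, fun i => inferInstance⟩

/-! ### The embedding of the fibres -/

/-- The linear forms `t = -(c x + y + z)`, `y`, `z`. -/
def lineForm (c : ℂ) : Fin 3 → MvPolynomial (Fin 3) ℂ :=
  ![-(MvPolynomial.C c * MvPolynomial.X 0 + MvPolynomial.X 1 + MvPolynomial.X 2),
    MvPolynomial.X 1, MvPolynomial.X 2]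

lemma lineForm_mem (c : ℂ) (i : Fin 3) : lineForm c i ∈ planeGrading 1 := by
  fin_cases i
  · refine neg_mem (add_mem (add_mem ?_ (X_mem_planeGrading 1)) (X_mem_planeGrading 2))
    rw [← MvPolynomial.smul_eq_C_mul]
    exact Submodule.smul_mem _ _ (X_mem_planeGrading 0)
  · exact X_mem_planeGrading 1
  · exact X_mem_planeGrading 2

/-- The homogeneous coordinates on the charts of the fibre. -/
def fibreCoord (c : ℂ) (i k : Fin 3) : FibreRing c := toFibre c (chartCoord i k)

/-- The unit `uv - 1` on the charts of the fibre. -/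
def fibreZeta (c : ℂ) : (FibreRing c)ˣ := zeta.map (toFibre c)

lemma fibreZeta_val (c : ℂ) : (fibreZeta c : FibreRing c) = toFibre c zeta := rfl

lemma fibreZeta_inv_val (c : ℂ) : (↑(fibreZeta c)⁻¹ : FibreRing c) = toFibre c ↑zeta⁻¹ := rfl

lemma fibre_relation (c : ℂ) : algebraMap ℂ (FibreRing c) c =
    toFibre c uu + toFibre c vv ^ 2 * ↑(fibreZeta c)⁻¹ := by
  rw [← toFibre_chartPotential, ← map_pow, fibreZeta_inv_val, ← map_mul, ← map_add]
  rfl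

/-- The `k`-th form takes the value `v z_k` on the fibre over `c`. For `k = 0` this uses `z_0 = c -
z_1 - z_2`, the equation of the fibre. -/
lemma aeval_fibreCoord_lineForm (c : ℂ) (i : Fin 3) :
    MvPolynomial.aeval (fibreCoord c i) (lineForm c i) =
        toFibre c vv ^ 3 * ↑(fibreZeta c)⁻¹ ∧
      MvPolynomial.aeval (fibreCoord c i) (lineForm c (i + 1)) = 1 ∧
      MvPolynomial.aeval (fibreCoord c i) (lineForm c (i + 2)) = fibreZeta c := by
  have h := fibre_relation c
  have hz : (fibreZeta c : FibreRing c) = toFibre c uu * toFibre c vv - 1 := by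
    rw [fibreZeta_val, zeta_val, map_sub, map_mul, map_one]
  fin_cases i <;> refine ⟨?_, ?_, ?_⟩ <;>
    simp [lineForm, fibreCoord, chartCoord, ← fibreZeta_val, ← fibreZeta_inv_val, h]
  all_goals linear_combination (-1) * hz

lemma eq_or_eq_add (i k : Fin 3) : k = i ∨ k = i + 1 ∨ k = i + 2 := by
  decide +revert

lemma quadric_mem (c : ℂ) (i : Fin 3) :
    lineForm c (i + 1) * lineForm c (i + 2) ∈ planeGrading (1 + 1) :=
  SetLike.mul_mem_graded (lineForm_mem c _) (lineForm_mem c _)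

lemma aeval_fibreCoord_quadric (c : ℂ) (i : Fin 3) :
    MvPolynomial.aeval (fibreCoord c i) (lineForm c (i + 1) * lineForm c (i + 2)) =
      fibreZeta c := by
  obtain ⟨-, h₁, h₂⟩ := aeval_fibreCoord_lineForm c i
  rw [map_mul, h₁, h₂, one_mul]

lemma isUnit_quadric (c : ℂ) (i : Fin 3) : IsUnit
    (MvPolynomial.aeval (fibreCoord c i) (lineForm c (i + 1) * lineForm c (i + 2))) := by
  rw [aeval_fibreCoord_quadric]
  exact (fibreZeta c).isUnit

lemma fibreCoord_zero (c : ℂ) (i : Fin 3) : fibreCoord c i 0 = -toFibre c vv := by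
  rw [fibreCoord, ← map_neg]
  fin_cases i <;> rfl

/-- The embedding of the fibres in the projective plane on the charts. -/
def fibreToPlane (c : ℂ) (i : Fin 3) : Spec (.of (FibreRing c)) ⟶ projPlane :=
  projPoint (fibreCoord c i) (quadric_mem c i) two_pos (isUnit_quadric c i)

lemma fibreι_planeMap (c : ℂ) (i : Fin 3) :
    fibreι c i ≫ pullback.fst _ _ ≫ planeMap = fibreToPlane c i := by
  rw [← Category.assoc, fibreι_fst, Category.assoc, chartι_planeMap]
  have hu : IsUnit (MvPolynomial.aeval (R := ℂ) (fibreCoord c i)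
      (MvPolynomial.X (unitCoord i))) := by
    rw [MvPolynomial.aeval_X]
    exact (isUnit_chartCoord i).map (toFibre c)
  refine (map_projPoint (toFibre c) (fun _ => rfl) _ one_pos _ hu).trans ?_
  exact projPoint_congr_denom _ _ _ _ _ _

/-- The image contains `v` and `ζ⁻¹`, hence `u = c - v² ζ⁻¹`; these generate the fibre ring. So the
chart is closed in the affine open where the two forms `i + 1`, `i + 2` do not vanish. -/
lemma awayEval_surjective (c : ℂ) (i : Fin 3) :
    Function.Surjective (awayEval (fibreCoord c i) (isUnit_quadric c i)) := by
  set φ := awayEval (fibreCoord c i) (isUnit_quadric c i)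
  have hmk := awayEval_mk (isUnit_quadric c i) (quadric_mem c i)
  obtain ⟨-, h₁, h₂⟩ := aeval_fibreCoord_lineForm c i
  have hC : ∀ r : ℂ, algebraMap ℂ _ r ∈ φ.range := fun r => ⟨_, by
    have := hmk 0 (MvPolynomial.C r) (by rw [zero_smul]; exact MvPolynomial.isHomogeneous_C _ _)
    rw [pow_zero, mul_one, MvPolynomial.aeval_C] at this
    exact this⟩
  -- The denominator, the product of the two forms, evaluates to `1 · ζ`, so quadratic forms divided
  -- by `ζ` are available: `-x` times the form `i + 2` gives `v`, and the square of the form `i + 1`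
  -- gives `ζ⁻¹`.
  have hdiv : ∀ p ∈ planeGrading (1 + 1), MvPolynomial.aeval (fibreCoord c i) p *
      ↑(fibreZeta c)⁻¹ ∈ φ.range := fun p hp => ⟨_, by
    have := hmk 1 p (by rwa [one_smul])
    rw [pow_one, aeval_fibreCoord_quadric] at this
    rw [← this, Units.mul_inv_cancel_right]⟩
  have hv : toFibre c vv ∈ φ.range := by
    have := hdiv (-MvPolynomial.X 0 * lineForm c (i + 2)) (SetLike.mul_mem_graded
      (neg_mem (X_mem_planeGrading 0)) (lineForm_mem c _))
    rwa [map_mul, h₂, map_neg, MvPolynomial.aeval_X, fibreCoord_zero, neg_neg,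
      Units.mul_inv_cancel_right] at this
  have hz : (↑(fibreZeta c)⁻¹ : FibreRing c) ∈ φ.range := by
    have := hdiv (lineForm c (i + 1) * lineForm c (i + 1)) (SetLike.mul_mem_graded
      (lineForm_mem c _) (lineForm_mem c _))
    rwa [map_mul, h₁, one_mul, one_mul] at this
  have hu : toFibre c uu ∈ φ.range := by
    have : toFibre c uu = algebraMap ℂ _ c - toFibre c vv ^ 2 * ↑(fibreZeta c)⁻¹ := by
      rw [fibre_relation]; ring
    rw [this]
    exact sub_mem (hC c) (mul_mem (pow_mem hv 2) hz)
  intro x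
  obtain ⟨x, rfl⟩ := toFibre_surjective c x
  obtain ⟨n, p, hp⟩ := IsLocalization.Away.surj
    (MvPolynomial.X 0 * MvPolynomial.X 1 - 1 : MvPolynomial (Fin 2) ℂ) x
  have hx : x = algebraMap _ _ p * (↑zeta⁻¹ : ChartRing) ^ n := by
    rw [← hp]
    have : algebraMap (MvPolynomial (Fin 2) ℂ) ChartRing
        (MvPolynomial.X 0 * MvPolynomial.X 1 - 1) = zeta := by
      rw [map_sub, map_mul, map_one]; rfl
    rw [this, mul_assoc, ← mul_pow, Units.mul_inv, one_pow, mul_one]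
  rw [hx, map_mul, map_pow]
  refine mul_mem (s := φ.range) ?_ (pow_mem hz n)
  clear hp hx
  induction p using MvPolynomial.induction_on with
  | C r => exact hC r
  | add p q hp hq => rw [map_add, map_add]; exact add_mem hp hq
  | mul_X p k hp =>
    rw [map_mul, map_mul]
    refine mul_mem hp ?_
    fin_cases k
    · exact hu
    · exact hv

instance (c : ℂ) (i : Fin 3) : IsPreimmersion (fibreToPlane c i) := by
  have : IsClosedImmersion (Spec.map (CommRingCat.ofHom
      (awayEval (fibreCoord c i) (isUnit_quadric c i)))) :=
    IsClosedImmersion.spec_of_surjective _ (awayEval_surjective c i)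
  exact inferInstanceAs (IsPreimmersion (_ ≫ _))

/-- The embedding of the fibre in the projective plane. -/
def fibrePlaneMap (c : ℂ) : pullback gluedPotential (linePoint c) ⟶ projPlane :=
  pullback.fst _ _ ≫ planeMap

lemma fibreι_fibrePlaneMap (c : ℂ) (i : Fin 3) :
    fibreι c i ≫ fibrePlaneMap c = fibreToPlane c i := fibreι_planeMap c i

lemma fibreToPlane_projPlaneToSpec (c : ℂ) (i : Fin 3) :
    fibreToPlane c i ≫ projPlaneToSpec = fibreToSpec c :=
  projPoint_projPlaneToSpec _ _ _

lemma fibrePlaneMap_projPlaneToSpec (c : ℂ) :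
    fibrePlaneMap c ≫ projPlaneToSpec = fibre gluedPotential c := by
  refine Scheme.Cover.hom_ext (fibreCover c) _ _ fun (i : Fin 3) => ?_
  change fibreι c i ≫ _ = fibreι c i ≫ pullback.snd _ _
  rw [← Category.assoc, fibreι_fibrePlaneMap, fibreι_snd, fibreToPlane_projPlaneToSpec]

lemma fibrePlaneMap_fibreι_mem (c : ℂ) (i : Fin 3) (x : Spec (.of (FibreRing c)))
    {n : ℕ} (hn : 0 < n) {g : MvPolynomial (Fin 3) ℂ} (hg : g ∈ planeGrading n) :
    fibrePlaneMap c (fibreι c i x) ∈ Proj.basicOpen planeGrading g ↔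
      MvPolynomial.aeval (fibreCoord c i) g ∉ PrimeSpectrum.asIdeal x := by
  have e : fibrePlaneMap c (fibreι c i x) = fibreToPlane c i x :=
    congrArg (fun f : Spec (.of (FibreRing c)) ⟶ projPlane => f x) (fibreι_fibrePlaneMap c i)
  rw [e]
  exact projPoint_mem_basicOpen _ _ _ hg hn x

/-- On chart `i` the form `k ≠ i` does not vanish, while on chart `k` it is `v³ / ζ`. A common image
point thus has `v ≠ 0` in chart `k`, so `x'` comes from the torus and lies in chart `i` too. -/
lemma exists_fibreι_of_ne (c : ℂ) {i k : Fin 3} (hik : i ≠ k) (x x' : Spec (.of (FibreRing c)))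
    (h : fibrePlaneMap c (fibreι c i x) = fibrePlaneMap c (fibreι c k x')) :
    ∃ y, fibreι c i y = fibreι c k x' := by
  have h₁ : fibrePlaneMap c (fibreι c i x) ∈ Proj.basicOpen planeGrading
      (lineForm c (i + 1) * lineForm c (i + 2)) := by
    rw [fibrePlaneMap_fibreι_mem c i x two_pos (quadric_mem c i), aeval_fibreCoord_quadric]
    exact fun h => (PrimeSpectrum.isPrime x).ne_top (Ideal.eq_top_of_isUnit_mem _ h
      (fibreZeta c).isUnit)
  rw [h, fibrePlaneMap_fibreι_mem c k x' two_pos (quadric_mem c i)] at h₁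
  obtain ⟨h₀, -, -⟩ := aeval_fibreCoord_lineForm c k
  have hv : toFibre c vv ∉ PrimeSpectrum.asIdeal x' := by
    intro hv
    have h₃ : MvPolynomial.aeval (fibreCoord c k) (lineForm c k) ∈ PrimeSpectrum.asIdeal x' := by
      rw [h₀]
      exact Ideal.mul_mem_right _ _ (Ideal.pow_mem_of_mem _ hv 3 (by norm_num))
    apply h₁
    rw [map_mul]
    rcases eq_or_eq_add i k with rfl | rfl | rfl
    · exact absurd rfl hik
    · exact Ideal.mul_mem_right _ _ h₃
    · exact Ideal.mul_mem_left _ _ h₃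
  obtain ⟨t, ht⟩ := (mem_range_torusToChart k (fibreToChart c x')).mpr hv
  refine mem_range_fibreι c i ⟨torusToChart i t, ?_⟩
  have e₁ : pullback.fst gluedPotential (linePoint c) (fibreι c k x') =
      chartι k (fibreToChart c x') :=
    congrArg (fun f : Spec (.of (FibreRing c)) ⟶ gluedSpace => f x') (fibreι_fst c k)
  have e₂ : ∀ j, chartι j (torusToChart j t) = torusι t := fun j =>
    congrArg (fun f : torus ⟶ gluedSpace => f t) (torusToChart_chartι j)
  rw [e₁, ← ht, e₂, e₂]

lemma fibrePlaneMap_injective (c : ℂ) : Function.Injective (fibrePlaneMap c) := by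
  have key : ∀ (i : Fin 3) (x x' : Spec (.of (FibreRing c))),
      fibrePlaneMap c (fibreι c i x) = fibrePlaneMap c (fibreι c i x') → x = x' := by
    intro i x x' h
    have e : ∀ x, fibrePlaneMap c (fibreι c i x) = fibreToPlane c i x := fun x =>
      congrArg (fun f : Spec (.of (FibreRing c)) ⟶ projPlane => f x) (fibreι_fibrePlaneMap c i)
    rw [e, e] at h
    exact (fibreToPlane c i).isEmbedding.injective h
  intro y y' h
  obtain ⟨i, x, rfl⟩ := exists_fibreι_eq c y
  obtain ⟨k, x', rfl⟩ := exists_fibreι_eq c y'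
  by_cases hik : i = k
  · subst hik
    rw [key i x x' h]
  · obtain ⟨x'', e⟩ := exists_fibreι_of_ne c hik x x' h
    rw [← e] at h ⊢
    rw [key i x x'' h]

/-- Surjectivity on stalks is local and holds on the charts. The map is proper because the fibre is
proper over `ℂ` and the plane is separated, so, being injective, it is a closed embedding. -/
instance isClosedImmersion_fibrePlaneMap (c : ℂ) : IsClosedImmersion (fibrePlaneMap c) := by
  have h₁ : SurjectiveOnStalks (fibrePlaneMap c) := by
    rw [IsZariskiLocalAtSource.iff_of_openCover (P := @SurjectiveOnStalks) (fibreCover c)]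
    intro (i : Fin 3)
    change SurjectiveOnStalks (fibreι c i ≫ _)
    rw [fibreι_fibrePlaneMap]
    infer_instance
  have h₂ : IsProper (fibrePlaneMap c) := by
    have := isProper_gluedPotential
    have : IsProper (fibrePlaneMap c ≫ projPlaneToSpec) := by
      rw [fibrePlaneMap_projPlaneToSpec]
      exact inferInstanceAs (IsProper (pullback.snd _ _))
    exact IsProper.of_comp _ projPlaneToSpec
  exact ⟨.of_continuous_injective_isClosedMap (fibrePlaneMap c).continuous
    (fibrePlaneMap_injective c) (fibrePlaneMap c).isClosedMap⟩

/-! ### The image of a fibre -/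

/-- The Weierstrass curve `y² + c x y + y = x³`. -/
def fibreCurve (c : ℂ) : WeierstrassCurve ℂ := ⟨c, 0, 1, 0, 0⟩

/-- This is `z_0 z_1 z_2 = 1` made homogeneous: at `x = -1` the constant `1` is `-x³`. -/
lemma fibreCurve_polynomial (c : ℂ) : WeierstrassCurve.Projective.polynomial (fibreCurve c) =
    -(lineForm c 0 * lineForm c 1 * lineForm c 2 + MvPolynomial.X 0 ^ 3) := by
  simp [WeierstrassCurve.Projective.polynomial, fibreCurve, lineForm]
  ring

lemma fibreCurve_polynomial_mem (c : ℂ) :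
    WeierstrassCurve.Projective.polynomial (fibreCurve c) ∈ planeGrading 3 := by
  rw [fibreCurve_polynomial]
  exact neg_mem (add_mem (SetLike.mul_mem_graded (SetLike.mul_mem_graded (lineForm_mem c 0)
    (lineForm_mem c 1)) (lineForm_mem c 2)) (SetLike.pow_mem_graded 3 (X_mem_planeGrading 0)))

lemma prod_rotate {R : Type} [CommRing R] (a : Fin 3 → R) (i : Fin 3) :
    a i * a (i + 1) * a (i + 2) = a 0 * a 1 * a 2 := by
  fin_cases i
  · rfl
  · change a 1 * a 2 * a 0 = _; ring
  · change a 2 * a 0 * a 1 = _; ring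

lemma aeval_fibreCoord_polynomial (c : ℂ) (i : Fin 3) : MvPolynomial.aeval (fibreCoord c i)
    (WeierstrassCurve.Projective.polynomial (fibreCurve c)) = 0 := by
  obtain ⟨h₀, h₁, h₂⟩ := aeval_fibreCoord_lineForm c i
  rw [fibreCurve_polynomial, ← prod_rotate _ i, map_neg, map_add, map_mul, map_mul, h₀, h₁, h₂,
    map_pow, MvPolynomial.aeval_X, fibreCoord_zero, mul_one, Units.inv_mul_cancel_right]
  ring

lemma mem_cubicLocus (E : WeierstrassCurve ℂ) (x : projPlane) : x ∈ cubicLocus E ↔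
    x ∉ Proj.basicOpen planeGrading (WeierstrassCurve.Projective.polynomial E) := by
  refine (ProjectiveSpectrum.mem_zeroLocus _ _ _).trans ?_
  rw [Set.singleton_subset_iff]
  exact not_not.symm

/-- A point of the chart of a fibre from a solution of the cubic equation. -/
lemma exists_fibreRing_hom {K : Type} [Field K] [Algebra ℂ K] (c : ℂ) (a : Fin 3 → K)
    (ha : MvPolynomial.aeval a (WeierstrassCurve.Projective.polynomial (fibreCurve c)) = 0)
    (i : Fin 3) (h₁ : MvPolynomial.aeval a (lineForm c (i + 1)) ≠ 0)
    (h₂ : MvPolynomial.aeval a (lineForm c (i + 2)) ≠ 0) :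
    ∃ φ : FibreRing c →ₐ[ℂ] K,
      ∀ k, MvPolynomial.aeval a (lineForm c (i + 1)) * φ (fibreCoord c i k) = a k := by
  set s := fun k => MvPolynomial.aeval a (lineForm c k) with hs
  have hrel : s i * s (i + 1) * s (i + 2) = -a 0 ^ 3 := by
    rw [prod_rotate, hs]
    rw [fibreCurve_polynomial, map_neg, map_add, map_mul, map_mul, map_pow,
      MvPolynomial.aeval_X] at ha
    linear_combination -ha
  have hsum : s i + s (i + 1) + s (i + 2) = -(algebraMap ℂ K c * a 0) := by
    have : s 0 + s 1 + s 2 = -(algebraMap ℂ K c * a 0) := by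
      simp [hs, lineForm]; ring
    rw [← this]
    fin_cases i
    · rfl
    · change s 1 + s 2 + s 0 = _; ring
    · change s 2 + s 0 + s 1 = _; ring
  change s (i + 1) ≠ 0 at h₁
  change s (i + 2) ≠ 0 at h₂
  change ∃ φ : FibreRing c →ₐ[ℂ] K, ∀ k, s (i + 1) * φ (fibreCoord c i k) = a k
  -- The values are forced: dividing the coordinates by the form `i + 1` gives `v` and `ζ`, and the
  -- equation of the fibre gives `u`.
  let v := -a 0 / s (i + 1)
  let z := s (i + 2) / s (i + 1)
  let u := algebraMap ℂ K c - v ^ 2 * z⁻¹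
  have hz : z ≠ 0 := div_ne_zero h₂ h₁
  -- This uses both the cubic relation and the linear relation among `s 0`, `s 1`, `s 2` and `a 0`.
  have huv : u * v - 1 = z := by
    simp only [u, v, z]
    field_simp
    linear_combination (-(s (i + 1)) * s (i + 2)) * hsum + hrel
  have hu : IsUnit (u * v - 1) := by rw [huv]; exact hz.isUnit
  have hζ : chartLift u v hu zeta = z := by
    rw [zeta_val, map_sub, map_mul, map_one, chartLift_uu, chartLift_vv, huv]
  have hζ' : chartLift u v hu ↑zeta⁻¹ = z⁻¹ := by
    rw [← mul_left_inj' hz, inv_mul_cancel₀ hz, ← hζ, ← map_mul, Units.inv_mul, map_one]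
  have hW : chartLift u v hu chartPotential = algebraMap ℂ K c := by
    rw [chartPotential, map_add, map_mul, map_pow, hζ', chartLift_uu, chartLift_vv]
    simp only [u]; ring
  let φ : FibreRing c →ₐ[ℂ] K := Ideal.Quotient.liftₐ _ (chartLift u v hu) fun x hx => by
    obtain ⟨y, rfl⟩ := Ideal.mem_span_singleton'.mp hx
    rw [map_mul, map_sub, hW, AlgHom.commutes, sub_self, mul_zero]
  have hφ : ∀ x, φ (toFibre c x) = chartLift u v hu x := fun x => rfl
  have hline : ∀ k, φ (MvPolynomial.aeval (fibreCoord c i) (lineForm c k)) =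
      s k / s (i + 1) := by
    obtain ⟨e₀, e₁, e₂⟩ := aeval_fibreCoord_lineForm c i
    intro k
    rcases eq_or_eq_add i k with rfl | rfl | rfl
    · rw [e₀, map_mul, map_pow, fibreZeta_inv_val, hφ, hφ, chartLift_vv, hζ']
      simp only [v, z]
      field_simp
      linear_combination -hrel
    · rw [e₁, map_one, div_self h₁]
    · rw [e₂, fibreZeta_val, hφ, hζ]
  refine ⟨φ, fun k => ?_⟩
  fin_cases k
  · change s (i + 1) * φ (fibreCoord c i 0) = a 0
    rw [fibreCoord_zero, map_neg, hφ, chartLift_vv]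
    simp only [v]
    field_simp
  · have := hline 1
    have e : s 1 = a 1 := by simp [hs, lineForm]
    simp only [lineForm, Matrix.cons_val_one, Matrix.cons_val_zero, MvPolynomial.aeval_X, e] at this
    change s (i + 1) * φ (fibreCoord c i 1) = a 1
    rw [this, mul_div_cancel₀ _ h₁]
  · have := hline 2
    have e : s 2 = a 2 := by simp [hs, lineForm]
    simp only [lineForm, Matrix.cons_val, MvPolynomial.aeval_X, e] at this
    change s (i + 1) * φ (fibreCoord c i 2) = a 2
    rw [this, mul_div_cancel₀ _ h₁]

lemma exists_mem_basicOpen_X (x : projPlane) :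
    ∃ k, x ∈ Proj.basicOpen planeGrading (MvPolynomial.X k) := by
  by_contra! hk
  have := Proj.iSup_basicOpen_eq_top' planeGrading (MvPolynomial.X : Fin 3 → _)
    (fun i => ⟨1, X_mem_planeGrading i⟩) (by
      refine top_le_iff.mp fun p _ => ?_
      have hp : p ∈ Algebra.adjoin ℂ (Set.range (MvPolynomial.X : Fin 3 → _)) := by
        rw [MvPolynomial.adjoin_range_X]; trivial
      induction hp using Algebra.adjoin_induction with
      | mem q hq => exact Algebra.subset_adjoin hq
      | algebraMap r => exact Subalgebra.algebraMap_mem _ (algebraMap ℂ (planeGrading 0) r)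
      | add p q _ _ hp hq => exact add_mem (hp trivial) (hq trivial)
      | mul p q _ _ hp hq => exact mul_mem (hp trivial) (hq trivial))
  have hx : x ∈ (⊤ : (Proj planeGrading).Opens) := trivial
  rw [← this] at hx
  obtain ⟨i, hi⟩ := Opens.mem_iSup.mp hx
  exact hk i hi

/-- A homogeneous prime is determined by its homogeneous elements. Degree zero is recovered by
multiplying with a coordinate that does not vanish at the point. -/
lemma projPlane_ext {x y : projPlane} (h : ∀ n, 0 < n → ∀ g ∈ planeGrading n,
    x ∈ Proj.basicOpen planeGrading g ↔ y ∈ Proj.basicOpen planeGrading g) : x = y := by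
  obtain ⟨k, hk⟩ := exists_mem_basicOpen_X x
  have hk' := (h 1 one_pos _ (X_mem_planeGrading k)).mp hk
  have h' : ∀ n, ∀ g ∈ planeGrading n,
      x ∈ Proj.basicOpen planeGrading g ↔ y ∈ Proj.basicOpen planeGrading g := by
    intro n g hg
    have := h (n + 1) n.succ_pos _ (SetLike.mul_mem_graded hg (X_mem_planeGrading k))
    rw [Proj.basicOpen_mul] at this
    exact ⟨fun hx => (this.mp ⟨hx, hk⟩).1, fun hy => (this.mpr ⟨hy, hk'⟩).1⟩
  exact ProjectiveSpectrum.ext (HomogeneousIdeal.ext' fun n g hg => not_iff_not.mp (h' n g hg))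

/-- All scheme points are treated at once: a point of the plane has its tautological coordinates in
the fraction field of the quotient by its homogeneous prime, and a solution of the cubic there comes
from a point of a chart. -/
lemma range_fibrePlaneMap (c : ℂ) : Set.range (fibrePlaneMap c) = cubicLocus (fibreCurve c) := by
  ext y
  rw [mem_cubicLocus]
  constructor
  · rintro ⟨x, rfl⟩
    obtain ⟨i, x, rfl⟩ := exists_fibreι_eq c x
    rw [fibrePlaneMap_fibreι_mem c i x three_pos (fibreCurve_polynomial_mem c),
      aeval_fibreCoord_polynomial]
    exact not_not.mpr (zero_mem _)
  · intro hy
    let p : Ideal (MvPolynomial (Fin 3) ℂ) := HomogeneousIdeal.toIdeal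
      (ProjectiveSpectrum.asHomogeneousIdeal (𝒜 := planeGrading) y)
    have hp : p.IsPrime := ProjectiveSpectrum.isPrime y
    let K := FractionRing (MvPolynomial (Fin 3) ℂ ⧸ p)
    let ev : MvPolynomial (Fin 3) ℂ →ₐ[ℂ] K :=
      (IsScalarTower.toAlgHom ℂ (MvPolynomial (Fin 3) ℂ ⧸ p) K).comp (Ideal.Quotient.mkₐ ℂ p)
    let a : Fin 3 → K := fun k => ev (MvPolynomial.X k)
    have hev : ∀ g, MvPolynomial.aeval a g = ev g := fun g => by
      rw [MvPolynomial.aeval_unique ev]; rfl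
    have hev₀ : ∀ g, MvPolynomial.aeval a g = 0 ↔ g ∈ p := fun g => by
      rw [hev, ← Ideal.Quotient.eq_zero_iff_mem]
      exact FaithfulSMul.algebraMap_eq_zero_iff (MvPolynomial (Fin 3) ℂ ⧸ p) K
    have hF : MvPolynomial.aeval a
        (WeierstrassCurve.Projective.polynomial (fibreCurve c)) = 0 :=
      (hev₀ _).mpr (not_not.mp hy)
    obtain ⟨k, hk⟩ : ∃ k, a k ≠ 0 := (exists_mem_basicOpen_X y).imp fun k hk hX =>
      hk ((hev₀ (MvPolynomial.X k)).mp (by rwa [MvPolynomial.aeval_X]))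
    -- Otherwise two of the forms vanish. The cubic then gives `x = 0`, so the sum of the forms `-c
    -- x` is zero and the third vanishes too, leaving no nonzero coordinate.
    obtain ⟨i, h₁, h₂⟩ : ∃ i, MvPolynomial.aeval a (lineForm c (i + 1)) ≠ 0 ∧
        MvPolynomial.aeval a (lineForm c (i + 2)) ≠ 0 := by
      by_contra! H
      rw [fibreCurve_polynomial] at hF
      simp only [map_neg, map_add, map_mul, map_pow, lineForm, Matrix.cons_val_zero,
        Matrix.cons_val_one, Matrix.cons_val, MvPolynomial.aeval_X, MvPolynomial.aeval_C] at hF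
      have h₀ := H 0
      have h₁ := H 1
      have h₂ := H 2
      simp only [lineForm, Fin.reduceAdd, map_neg, map_add, map_mul, Matrix.cons_val_zero,
        Matrix.cons_val_one, Matrix.cons_val, MvPolynomial.aeval_X, MvPolynomial.aeval_C] at h₀ h₁ h₂
      have e₀ : a 0 = 0 := by
        by_cases h : a 1 = 0
        · simpa [h] using hF
        · simpa [h₀ h] using hF
      simp only [e₀, mul_zero, zero_add] at h₁ h₂
      have e₁ : a 1 = 0 := by
        by_contra h
        exact h (h₂ (by simpa [h₀ h] using h))
      have e₂ : a 2 = 0 := by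
        by_contra h
        exact h (by simpa [e₁] using h₁ h)
      fin_cases k
      · exact hk e₀
      · exact hk e₁
      · exact hk e₂
    obtain ⟨φ, hφ⟩ := exists_fibreRing_hom c a hF i h₁ h₂
    let q : Spec (.of (FibreRing c)) :=
      ⟨RingHom.ker φ, RingHom.ker_isPrime φ⟩
    refine ⟨fibreι c i q, projPlane_ext fun n hn g hg => ?_⟩
    rw [fibrePlaneMap_fibreι_mem c i q hn hg]
    have e : φ (MvPolynomial.aeval (fibreCoord c i) g) =
        MvPolynomial.aeval (fun k => φ (fibreCoord c i k)) g := by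
      rw [← AlgHom.comp_apply, MvPolynomial.comp_aeval]
    -- Coordinates proportional by a nonzero factor have the same vanishing homogeneous polynomials.
    have e' := aeval_smul_of_mem (a := fun k => φ (fibreCoord c i k))
      (MvPolynomial.aeval a (lineForm c (i + 1))) hg
    simp only [hφ] at e'
    refine not_iff_not.mpr (Iff.trans ?_ (hev₀ g))
    rw [e', ← e, mul_eq_zero, or_iff_right (pow_ne_zero n h₁)]
    exact RingHom.mem_ker

/-! ### Reducedness of the fibres -/

/-- The equation of the fibre of the potential in the affine plane containing a chart. -/
def fibrePoly (c : ℂ) : MvPolynomial (Fin 2) ℂ :=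
  (MvPolynomial.X 0 - MvPolynomial.C c) * (MvPolynomial.X 0 * MvPolynomial.X 1 - 1) +
    MvPolynomial.X 1 ^ 2

/-- The derivative at `c` kills the square of the ideal of `c`, but takes `X - c` to `1`. -/
lemma sub_C_notMem_sq (c : ℂ) : (MvPolynomial.X 0 - MvPolynomial.C c : MvPolynomial (Fin 1) ℂ) ∉
    RingHom.ker (MvPolynomial.aeval (R := ℂ) fun _ : Fin 1 => c) ^ 2 := by
  intro h
  have key : ∀ p ∈ RingHom.ker (MvPolynomial.aeval (R := ℂ) fun _ : Fin 1 => c) ^ 2,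
      MvPolynomial.aeval (fun _ : Fin 1 => c) (MvPolynomial.pderiv 0 p) = 0 := by
    intro p hp
    rw [pow_two] at hp
    induction hp using Submodule.mul_induction_on' with
    | mem_mul_mem a ha b hb =>
      rw [Derivation.leibniz, map_add, smul_eq_mul, smul_eq_mul, map_mul, map_mul,
        RingHom.mem_ker.mp ha, RingHom.mem_ker.mp hb, zero_mul, zero_mul, add_zero]
    | add a _ b _ ha hb => rw [map_add, map_add, ha, hb, add_zero]
  have := key _ h
  simp at this

/-- The equation of the fibre as a quadratic in `v` over `ℂ[u]`, namely `v² + u (u - c) v - (u -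
c)`, is Eisenstein at the prime `(u - c)`. -/
lemma irreducible_eisenstein (c : ℂ) : Irreducible (Polynomial.X ^ 2 +
    (Polynomial.C (MvPolynomial.X 0 * (MvPolynomial.X 0 - MvPolynomial.C c)) * Polynomial.X +
      Polynomial.C (-(MvPolynomial.X 0 - MvPolynomial.C c))) :
        Polynomial (MvPolynomial (Fin 1) ℂ)) := by
  set l : Polynomial (MvPolynomial (Fin 1) ℂ) :=
    Polynomial.C (MvPolynomial.X 0 * (MvPolynomial.X 0 - MvPolynomial.C c)) * Polynomial.X +
      Polynomial.C (-(MvPolynomial.X 0 - MvPolynomial.C c)) with hl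
  have hdeg : l.degree < (2 : ℕ) :=
    lt_of_le_of_lt Polynomial.degree_linear_le (by norm_num)
  have hmonic : (Polynomial.X ^ 2 + l).Monic := Polynomial.monic_X_pow_add hdeg
  have hd : (Polynomial.X ^ 2 + l).degree = 2 := by
    rw [Polynomial.degree_add_eq_left_of_degree_lt] <;> rw [Polynomial.degree_X_pow]
    · rfl
    · exact hdeg
  have hmem : (MvPolynomial.X 0 - MvPolynomial.C c : MvPolynomial (Fin 1) ℂ) ∈
      RingHom.ker (MvPolynomial.aeval (R := ℂ) fun _ : Fin 1 => c) := by
    simp [RingHom.mem_ker]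
  have h₀ : (Polynomial.X ^ 2 + l).coeff 0 = -(MvPolynomial.X 0 - MvPolynomial.C c) := by
    simp [hl]
  refine Polynomial.irreducible_of_eisenstein_criterion (RingHom.ker_isPrime
    (MvPolynomial.aeval (R := ℂ) fun _ : Fin 1 => c)) ?_ ?_ ?_ ?_ hmonic.isPrimitive
  · rw [hmonic.leadingCoeff, RingHom.mem_ker, map_one]
    exact one_ne_zero
  · intro n hn
    rw [hd] at hn
    have hn : n < 2 := by exact_mod_cast hn
    interval_cases n
    · rw [h₀]; exact neg_mem hmem
    · have : (Polynomial.X ^ 2 + l).coeff 1 =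
          MvPolynomial.X 0 * (MvPolynomial.X 0 - MvPolynomial.C c) := by
        simp [hl, Polynomial.coeff_X_pow, Polynomial.coeff_C]
      rw [this]; exact Ideal.mul_mem_left _ _ hmem
  · rw [hd]; norm_num
  · rw [h₀, neg_mem_iff]
    exact sub_C_notMem_sq c

lemma irreducible_fibrePoly (c : ℂ) : Irreducible (fibrePoly c) := by
  -- `finSuccEquiv` singles out the variable `0`, so the variables are swapped to make `v` the main
  -- one.
  let e := (MvPolynomial.renameEquiv ℂ (Equiv.swap (0 : Fin 2) 1)).trans
    (MvPolynomial.finSuccEquiv ℂ 1)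
  rw [← MulEquiv.irreducible_iff e]
  convert irreducible_eisenstein c using 1
  have h₀ : e (MvPolynomial.X 0) = Polynomial.C (MvPolynomial.X 0) := by
    simpa [e] using MvPolynomial.finSuccEquiv_X_succ (R := ℂ) (n := 1) (j := 0)
  have h₁ : e (MvPolynomial.X 1) = Polynomial.X := by
    simpa [e] using MvPolynomial.finSuccEquiv_X_zero (R := ℂ) (n := 1)
  have hc : e (MvPolynomial.C c) = Polynomial.C (MvPolynomial.C c) := by
    simpa using e.commutes c
  simp only [fibrePoly, map_add, map_mul, map_sub, map_pow, map_one, map_neg, h₀, h₁, hc]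
  ring

/-- Multiplying by the unit `ζ` clears the denominator of the potential. -/
lemma span_fibre_eq (c : ℂ) : Ideal.span {chartPotential - algebraMap ℂ ChartRing c} =
    (Ideal.span {fibrePoly c}).map (algebraMap _ ChartRing) := by
  rw [Ideal.map_span, Set.image_singleton]
  have : algebraMap (MvPolynomial (Fin 2) ℂ) ChartRing (fibrePoly c) =
      (chartPotential - algebraMap ℂ ChartRing c) * zeta := by
    have hu : algebraMap (MvPolynomial (Fin 2) ℂ) ChartRing (MvPolynomial.X 0) = uu := rfl
    have hv : algebraMap (MvPolynomial (Fin 2) ℂ) ChartRing (MvPolynomial.X 1) = vv := rfl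
    have hc : algebraMap (MvPolynomial (Fin 2) ℂ) ChartRing (MvPolynomial.C c) =
      algebraMap ℂ ChartRing c := rfl
    rw [fibrePoly, map_add, map_mul, map_sub, map_sub, map_mul, map_pow, map_one, hu, hv, hc,
      ← zeta_val, chartPotential]
    linear_combination (-vv ^ 2) * zeta.inv_mul
  rw [this, Ideal.span_singleton_mul_right_unit zeta.isUnit]

/-- Radicals commute with localization, so the extension of a prime ideal is radical, whether or not
it is proper. -/
instance (c : ℂ) : _root_.IsReduced (FibreRing c) := by
  rw [← Ideal.isRadical_iff_quotient_reduced, span_fibre_eq]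
  have hp : (Ideal.span {fibrePoly c}).IsPrime :=
    (Ideal.span_singleton_prime (irreducible_fibrePoly c).ne_zero).mpr
      (irreducible_fibrePoly c).prime
  have e := IsLocalization.map_radical (Submonoid.powers (MvPolynomial.X 0 * MvPolynomial.X 1 - 1 :
    MvPolynomial (Fin 2) ℂ)) ChartRing (Ideal.span {fibrePoly c})
  rw [← Ideal.radical_eq_iff, ← e, hp.isRadical.radical]

instance isReduced_fibre (c : ℂ) :
    AlgebraicGeometry.IsReduced (pullback gluedPotential (linePoint c)) := by
  have : ∀ x : ↥(pullback gluedPotential (linePoint c)),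
      _root_.IsReduced ((pullback gluedPotential (linePoint c)).presheaf.stalk x) := by
    intro x
    obtain ⟨i, y, rfl⟩ := exists_fibreι_eq c x
    exact isReduced_of_injective ((fibreι c i).stalkMap y).hom
      (asIso ((fibreι c i).stalkMap y)).commRingCatIsoToRingEquiv.injective
  exact isReduced_of_isReduced_stalk _

lemma isCubic_fibre (c : ℂ) : IsCubic (fibreCurve c) (fibre gluedPotential c) :=
  ⟨isReduced_fibre c, fibrePlaneMap c, isClosedImmersion_fibrePlaneMap c,
    fibrePlaneMap_projPlaneToSpec c, range_fibrePlaneMap c⟩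

/-! ### The singular fibres -/

lemma fibreCurve_Δ (c : ℂ) : (fibreCurve c).Δ = c ^ 3 - 27 := by
  simp [fibreCurve, WeierstrassCurve.Δ, WeierstrassCurve.b₂, WeierstrassCurve.b₄,
    WeierstrassCurve.b₆, WeierstrassCurve.b₈]
  ring

lemma fibreCurve_c₄ (c : ℂ) : (fibreCurve c).c₄ = c * (c ^ 3 - 24) := by
  simp [fibreCurve, WeierstrassCurve.c₄, WeierstrassCurve.b₂, WeierstrassCurve.b₄]
  ring

/-- The critical values of the potential. -/
def criticalValues : Finset ℂ := (Polynomial.nthRootsFinset 3 (1 : ℂ)).image (3 * ·)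

lemma mem_criticalValues {c : ℂ} : c ∈ criticalValues ↔ c ^ 3 = 27 := by
  simp only [criticalValues, Finset.mem_image, Polynomial.mem_nthRootsFinset three_pos]
  constructor
  · rintro ⟨w, hw, rfl⟩
    linear_combination 27 * hw
  · intro h
    exact ⟨c / 3, by linear_combination h / 27, by ring⟩

lemma card_criticalValues : criticalValues.card = 3 := by
  rw [criticalValues, Finset.card_image_of_injective _ (mul_right_injective₀ three_ne_zero),
    (Complex.isPrimitiveRoot_exp 3 three_ne_zero).card_nthRootsFinset]

lemma isTypeIOne_fibre {c : ℂ} (hc : c ∈ criticalValues) :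
    IsTypeIOne (fibre gluedPotential c) := by
  rw [mem_criticalValues] at hc
  refine ⟨fibreCurve c, by rw [fibreCurve_Δ, hc, sub_self], ?_, isCubic_fibre c⟩
  rw [fibreCurve_c₄, hc]
  refine mul_ne_zero ?_ (by norm_num)
  rintro rfl
  norm_num at hc

lemma isEllipticCurve_fibre {c : ℂ} (hc : c ∉ criticalValues) :
    IsEllipticCurve (fibre gluedPotential c) := by
  rw [mem_criticalValues] at hc
  refine ⟨fibreCurve c, ⟨?_⟩, isCubic_fibre c⟩
  rw [fibreCurve_Δ]
  exact (sub_ne_zero.mpr hc).isUnit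

lemma isProperEllipticFibration_gluedPotential : IsProperEllipticFibration gluedPotential :=
  ⟨isProper_gluedPotential, flat_gluedPotential, smooth_gluedPotential,
    criticalValues.finite_toSet.subset fun _ hc => by
      by_contra h
      exact hc (isEllipticCurve_fibre h)⟩

/-! ### Ideal sheaves on affine schemes -/

section SpecIdeal

variable {R S : Type} [CommRing R] [CommRing S]

/-- The ideal of global sections of an ideal sheaf on an affine scheme. -/
def specIdeal (I : (Spec (.of S)).IdealSheafData) : Ideal S :=
  (I.ideal ⟨⊤, isAffineOpen_top _⟩).comap (Scheme.ΓSpecIso (.of S)).inv.hom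

/-- The identification of a ring with the global sections of its spectrum. -/
def specEquiv (S : Type) [CommRing S] : S ≃+* Γ(Spec (.of S), ⊤) :=
  (Scheme.ΓSpecIso (.of S)).symm.commRingCatIsoToRingEquiv

lemma specIdeal_eq (I : (Spec (.of S)).IdealSheafData) :
    specIdeal I = (I.ideal ⟨⊤, isAffineOpen_top _⟩).comap (specEquiv S : S →+* _) := rfl

lemma specIdeal_le_iff {I J : (Spec (.of S)).IdealSheafData} :
    specIdeal I ≤ specIdeal J ↔ I ≤ J := by
  refine ⟨fun h => Scheme.IdealSheafData.le_of_isAffine fun f hf => ?_,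
    fun h f hf => h _ hf⟩
  obtain ⟨f, rfl⟩ := (specEquiv S).surjective f
  exact h hf

lemma exists_specIdeal_eq (K : Ideal S) :
    ∃ I : (Spec (.of S)).IdealSheafData, specIdeal I = K := by
  let K' : Ideal Γ(Spec (.of S), ⊤) := K.comap ((specEquiv S).symm : Γ(Spec (.of S), ⊤) →+* S)
  refine ⟨.ofIdealTop K', ?_⟩
  have : (Scheme.IdealSheafData.ofIdealTop K').ideal ⟨⊤, isAffineOpen_top _⟩ = K' :=
    (Scheme.IdealSheafData.equivOfIsAffine (X := Spec (.of S))).right_inv _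
  rw [specIdeal_eq, this, Ideal.comap_comap]
  simp

lemma specIdeal_map (φ : R →+* S) (K : (Spec (.of S)).IdealSheafData) :
    specIdeal (K.map (Spec.map (CommRingCat.ofHom φ))) = (specIdeal K).comap φ := by
  rw [specIdeal, Scheme.IdealSheafData.ideal_map_of_isAffineHom, specIdeal, Ideal.comap_comap,
    Ideal.comap_comap]
  have := congrArg CommRingCat.Hom.hom (Scheme.ΓSpecIso_inv_naturality (CommRingCat.ofHom φ))
  exact congrArg (fun f => Ideal.comap f _) this.symm

/-- Inverse image of ideal sheaves is left adjoint to direct image, as extension of ideals is to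
contraction. The direct image being contraction, the left adjoints agree. -/
lemma specIdeal_comap (φ : R →+* S) (I : (Spec (.of R)).IdealSheafData) :
    specIdeal (I.comap (Spec.map (CommRingCat.ofHom φ))) = (specIdeal I).map φ := by
  refine eq_of_forall_ge_iff fun K => ?_
  obtain ⟨K, rfl⟩ := exists_specIdeal_eq K
  rw [specIdeal_le_iff, ← Scheme.IdealSheafData.le_map_iff_comap_le, ← specIdeal_le_iff,
    specIdeal_map, Ideal.map_le_iff_le_comap]

lemma specIdeal_bot : specIdeal (⊥ : (Spec (.of S)).IdealSheafData) = ⊥ := by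
  rw [specIdeal_eq]
  exact (RingHom.ker_eq_comap_bot _).symm.trans (RingHom.ker_coe_equiv (specEquiv S))

lemma specIdeal_ker (φ : R →+* S) :
    specIdeal (Spec.map (CommRingCat.ofHom φ)).ker = RingHom.ker φ := by
  rw [← Scheme.IdealSheafData.map_bot, specIdeal_map, specIdeal_bot, RingHom.ker_eq_comap_bot]

lemma specIdeal_iInf {ι : Type} [Finite ι] (I : ι → (Spec (.of S)).IdealSheafData) :
    specIdeal (⨅ i, I i) = ⨅ i, specIdeal (I i) := by
  rw [specIdeal, Scheme.IdealSheafData.ideal_iInf, iInf_apply, Ideal.comap_iInf]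
  rfl

lemma mem_support_iff_specIdeal_le (I : (Spec (.of S)).IdealSheafData) (x : Spec (.of S)) :
    x ∈ I.support ↔ specIdeal I ≤ PrimeSpectrum.asIdeal x := by
  rw [Scheme.IdealSheafData.mem_support_iff_of_mem (U := ⟨⊤, isAffineOpen_top _⟩) trivial,
    Scheme.mem_zeroLocus_iff]
  have key : ∀ f : S, x ∉ (Spec (.of S)).basicOpen (U := ⊤) (specEquiv S f) ↔
      f ∈ PrimeSpectrum.asIdeal x := fun f => by
    have e : (Spec (.of S)).basicOpen (U := ⊤) (specEquiv S f) = PrimeSpectrum.basicOpen f :=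
      basicOpen_eq_of_affine (R := .of S) f
    rw [e]
    exact not_not
  constructor
  · exact fun h f hf => (key f).mp (h _ hf)
  · intro h f hf
    obtain ⟨f, rfl⟩ := (specEquiv S).surjective f
    exact (key f).mpr (h hf)

/-- The ideal of an ideal sheaf on an affine open subscheme. -/
lemma exists_specIdeal_comap_eq {X : Scheme.{0}} (I : X.IdealSheafData) (j : Spec (.of S) ⟶ X)
    [IsOpenImmersion j] (U : X.affineOpens) (hU : U.1 = j.opensRange) :
    ∃ e : S ≃+* Γ(X, U.1), specIdeal (I.comap j) = (I.ideal U).comap (e : S →+* Γ(X, U.1)) := by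
  obtain ⟨U, hU'⟩ := U
  obtain rfl : U = j ''ᵁ ⊤ := hU.trans j.image_top_eq_opensRange.symm
  refine ⟨(specEquiv S).trans (j.appIso ⊤).symm.commRingCatIsoToRingEquiv, ?_⟩
  rw [specIdeal, Scheme.IdealSheafData.ideal_comap_of_isOpenImmersion, Ideal.comap_comap]
  rfl

end SpecIdeal

/-! ### Invertible ideal sheaves -/

lemma comap_mem_nonZeroDivisors {R S : Type} [CommRing R] [CommRing S] (e : R ≃+* S) {f : S}
    (hf : f ∈ nonZeroDivisors S) : e.symm f ∈ nonZeroDivisors R := by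
  rw [mem_nonZeroDivisors_iff_right] at hf ⊢
  intro x hx
  have := hf (e x) (by rw [← e.apply_symm_apply f, ← map_mul, hx, map_zero])
  exact (map_eq_zero_iff e e.injective).mp this

lemma comap_span_equiv {R S : Type} [CommRing R] [CommRing S] (e : R ≃+* S) (f : S) :
    (Ideal.span {f}).comap (e : R →+* S) = Ideal.span {e.symm f} := by
  have := Ideal.map_symm (I := Ideal.span {f}) e
  rw [Ideal.map_span, Set.image_singleton] at this
  exact this.symm

/-- Replaces affine open subsets by open immersions from spectra of rings, which compose and
restrict freely. -/
lemma isInvertible_iff {X : Scheme.{0}} {I : X.IdealSheafData} : IsInvertible I ↔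
    ∀ x : X, ∃ (S : Type) (_ : CommRing S) (j : Spec (.of S) ⟶ X), IsOpenImmersion j ∧
      x ∈ Set.range j ∧ ∃ f ∈ nonZeroDivisors S, specIdeal (I.comap j) = Ideal.span {f} := by
  constructor
  · intro h x
    obtain ⟨U, hx, f, hf, hI⟩ := h x
    let j : Spec (.of Γ(X, U.1)) ⟶ X := U.2.fromSpec
    have hj : IsOpenImmersion j := IsAffineOpen.isOpenImmersion_fromSpec U.2
    obtain ⟨e, he⟩ := exists_specIdeal_comap_eq I j U U.2.opensRange_fromSpec.symm
    refine ⟨Γ(X, U.1), inferInstance, j, hj, ?_, e.symm f, comap_mem_nonZeroDivisors e hf, ?_⟩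
    · change x ∈ Set.range U.2.fromSpec
      rwa [U.2.range_fromSpec]
    · rw [he, hI, comap_span_equiv]
  · intro h x
    obtain ⟨S, _, j, hj, hx, f, hf, hI⟩ := h x
    obtain ⟨e, he⟩ := exists_specIdeal_comap_eq I j ⟨j.opensRange, isAffineOpen_opensRange j⟩ rfl
    refine ⟨⟨j.opensRange, isAffineOpen_opensRange j⟩, hx, e f, ?_, ?_⟩
    · exact comap_mem_nonZeroDivisors e.symm hf
    · have h2 : (I.ideal ⟨j.opensRange, isAffineOpen_opensRange j⟩) =
          (Ideal.span {f}).comap (e.symm : _ →+* S) := by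
        rw [← hI, he, Ideal.comap_comap]
        simp
      rw [h2, comap_span_equiv]
      rfl

/-! ### Basic open subschemes and locality of invertibility -/

/-- The inclusion of the basic open subscheme where `s` is invertible. -/
def basicι {S : Type} [CommRing S] (s : S) : Spec (.of (Localization.Away s)) ⟶ Spec (.of S) :=
  Spec.map (CommRingCat.ofHom (algebraMap S (Localization.Away s)))

instance {S : Type} [CommRing S] (s : S) : IsOpenImmersion (basicι s) :=
  IsOpenImmersion.of_isLocalization s

lemma mem_range_basicι {S : Type} [CommRing S] (s : S) (x : Spec (.of S)) :
    x ∈ Set.range (basicι s) ↔ s ∉ PrimeSpectrum.asIdeal x :=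
  Set.ext_iff.mp (PrimeSpectrum.localization_away_comap_range (Localization.Away s) s) x

lemma exists_basicι {S : Type} [CommRing S] {x : Spec (.of S)} {U : Set (Spec (.of S))}
    (hU : IsOpen U) (hx : x ∈ U) :
    ∃ s : S, x ∈ Set.range (basicι s) ∧ Set.range (basicι s) ⊆ U := by
  obtain ⟨_, ⟨s, rfl⟩, hs, hsU⟩ :=
    PrimeSpectrum.isTopologicalBasis_basic_opens.exists_subset_of_mem_open hx hU
  exact ⟨s, (mem_range_basicι s x).mpr hs, fun y hy => hsU ((mem_range_basicι s y).mp hy)⟩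

lemma algebraMap_mem_nonZeroDivisors {S : Type} [CommRing S] (s : S) {f : S}
    (hf : f ∈ nonZeroDivisors S) :
    algebraMap S (Localization.Away s) f ∈ nonZeroDivisors (Localization.Away s) :=
  IsLocalization.map_nonZeroDivisors_le (Submonoid.powers s) _ ⟨f, hf, rfl⟩

/-- The affine neighbourhood is shrunk to a basic open one that factors through `g`; nonzerodivisors
stay such under localization. -/
lemma IsInvertible.comap {X U : Scheme.{0}} {I : X.IdealSheafData} (h : IsInvertible I)
    (g : U ⟶ X) [IsOpenImmersion g] : IsInvertible (I.comap g) := by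
  rw [isInvertible_iff] at h ⊢
  intro x
  obtain ⟨S, _, j, hj, ⟨y, hy⟩, f, hf, hI⟩ := h (g x)
  obtain ⟨s, hs, hsU⟩ := exists_basicι (x := y) (U := j ⁻¹' Set.range g)
    (g.isOpenEmbedding.isOpen_range.preimage j.continuous) ⟨x, hy.symm⟩
  obtain ⟨z, hz⟩ := hs
  have hr : Set.range (basicι s ≫ j) ⊆ Set.range g := by
    rintro _ ⟨w, rfl⟩
    exact hsU ⟨w, rfl⟩
  let l := IsOpenImmersion.lift g (basicι s ≫ j) hr
  have hl : l ≫ g = basicι s ≫ j := IsOpenImmersion.lift_fac g _ hr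
  have : IsOpenImmersion (l ≫ g) := by rw [hl]; infer_instance
  refine ⟨_, _, l, .of_comp l g, ⟨z, g.isOpenEmbedding.injective ?_⟩, _,
    algebraMap_mem_nonZeroDivisors s hf, ?_⟩
  · change (l ≫ g) z = g x
    rw [hl, ← hy, ← hz]
    rfl
  · rw [← Scheme.IdealSheafData.comap_comp, hl, Scheme.IdealSheafData.comap_comp, basicι,
      specIdeal_comap, hI, Ideal.map_span, Set.image_singleton]

lemma isInvertible_of_cover {X : Scheme.{0}} {I : X.IdealSheafData}
    (h : ∀ x : X, ∃ (U : Scheme.{0}) (g : U ⟶ X), IsOpenImmersion g ∧ x ∈ Set.range g ∧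
      IsInvertible (I.comap g)) : IsInvertible I := by
  rw [isInvertible_iff]
  intro x
  obtain ⟨U, g, hg, ⟨y, rfl⟩, hI⟩ := h x
  obtain ⟨S, _, j, hj, ⟨z, rfl⟩, f, hf, e⟩ := isInvertible_iff.mp hI y
  exact ⟨S, _, j ≫ g, inferInstance, ⟨z, rfl⟩, f, hf, by
    rw [Scheme.IdealSheafData.comap_comp, e]⟩

lemma isInvertible_of_specIdeal_eq {S : Type} [CommRing S] {I : (Spec (.of S)).IdealSheafData}
    {f : S} (hf : f ∈ nonZeroDivisors S) (h : specIdeal I = Ideal.span {f}) : IsInvertible I :=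
  isInvertible_iff.mpr fun x => ⟨S, _, 𝟙 _, inferInstance, ⟨x, rfl⟩, f, hf, by
    rw [Scheme.IdealSheafData.comap_id, h]⟩

lemma isInvertible_top {X : Scheme.{0}} : IsInvertible (⊤ : X.IdealSheafData) := by
  intro x
  obtain ⟨_, ⟨U, hU, rfl⟩, hxU, -⟩ :=
    X.isBasis_affineOpens.exists_subset_of_mem_open (Set.mem_univ x) isOpen_univ
  exact ⟨⟨U, hU⟩, hxU, 1, one_mem _, Ideal.span_singleton_one.symm⟩

/-! ### Blowing up is local on the base -/

/-- An open cover indexed by the points. -/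
def pointCover {T : Scheme.{0}} (U : T → Scheme.{0}) (j : ∀ x, U x ⟶ T)
    (hj : ∀ x, IsOpenImmersion (j x)) (hx : ∀ x, x ∈ Set.range (j x)) : T.OpenCover where
  I₀ := T
  X := U
  f := j
  mem₀ := by
    rw [Scheme.presieve₀_mem_precoverage_iff]
    exact ⟨fun x => ⟨x, hx x⟩, hj⟩

lemma hom_ext_of_local {T Z : Scheme.{0}} {g g' : T ⟶ Z}
    (h : ∀ x : T, ∃ (U : Scheme.{0}) (j : U ⟶ T), IsOpenImmersion j ∧ x ∈ Set.range j ∧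
      j ≫ g = j ≫ g') : g = g' := by
  choose U j hj hx e using h
  exact Scheme.Cover.hom_ext (pointCover U j hj hx) _ _ e

/-- Local uniqueness gives uniqueness. Applied on overlaps, where the inverse image ideal is still
invertible, it makes local lifts agree and hence glue. -/
lemma isBlowup_of_local {B Y : Scheme.{0}} {π : B ⟶ Y} {I : Y.IdealSheafData}
    (hinv : IsInvertible (I.comap π))
    (huniq : ∀ {T : Scheme.{0}} (g g' : T ⟶ B), g ≫ π = g' ≫ π → IsInvertible (I.comap (g ≫ π)) →
      ∀ x : T, ∃ (U : Scheme.{0}) (j : U ⟶ T), IsOpenImmersion j ∧ x ∈ Set.range j ∧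
        j ≫ g = j ≫ g')
    (hex : ∀ {T : Scheme.{0}} (f : T ⟶ Y), IsInvertible (I.comap f) →
      ∀ x : T, ∃ (U : Scheme.{0}) (j : U ⟶ T), IsOpenImmersion j ∧ x ∈ Set.range j ∧
        ∃ g : U ⟶ B, g ≫ π = j ≫ f) : IsBlowup π I := by
  refine ⟨hinv, fun {T} f hf => ?_⟩
  have hu : ∀ {T : Scheme.{0}} (g g' : T ⟶ B), g ≫ π = g' ≫ π → IsInvertible (I.comap (g ≫ π)) →
      g = g' := fun g g' e h => hom_ext_of_local (huniq g g' e h)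
  choose U j hj hx g hg using hex f hf
  have hglue : ∀ x y, pullback.fst (j x) (j y) ≫ g x = pullback.snd (j x) (j y) ≫ g y := by
    intro x y
    refine hu _ _ ?_ ?_
    · rw [Category.assoc, Category.assoc, hg, hg, pullback.condition_assoc]
    · rw [Category.assoc, hg, ← Category.assoc, Scheme.IdealSheafData.comap_comp]
      exact hf.comap _
  let 𝒰 := pointCover U j hj hx
  have e : 𝒰.glueMorphisms g hglue ≫ π = f := by
    refine 𝒰.hom_ext _ _ fun x => ?_
    refine (Category.assoc _ _ _).symm.trans (Eq.trans ?_ (hg x))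
    exact congrArg (· ≫ π) (𝒰.ι_glueMorphisms g hglue x)
  exact ⟨𝒰.glueMorphisms g hglue, e, fun g' e' => hu _ _ (e'.trans e.symm) (by rwa [e'])⟩

lemma IsBlowup.of_isPullback {B Y B' V : Scheme.{0}} {π : B ⟶ Y} {I : Y.IdealSheafData}
    (h : IsBlowup π I) {j : V ⟶ Y} [IsOpenImmersion j] {j' : B' ⟶ B} {π' : B' ⟶ V}
    (sq : IsPullback j' π' π j) : IsBlowup π' (I.comap j) := by
  have : IsOpenImmersion j' := MorphismProperty.of_isPullback sq.flip inferInstance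
  refine ⟨?_, fun {T} f hf => ?_⟩
  · rw [← Scheme.IdealSheafData.comap_comp, ← sq.w, Scheme.IdealSheafData.comap_comp]
    exact h.isInvertible.comap j'
  · rw [← Scheme.IdealSheafData.comap_comp] at hf
    obtain ⟨g, hg, hu⟩ := h.existsUnique_lift (f ≫ j) hf
    refine ⟨sq.lift g f hg, sq.lift_snd _ _ _, fun g' hg' => ?_⟩
    apply sq.hom_ext
    · rw [sq.lift_fst]
      refine hu _ ?_
      change (g' ≫ j') ≫ π = _
      rw [Category.assoc, sq.w, ← hg', Category.assoc]
    · rw [sq.lift_snd, hg']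

lemma IsBlowup.isIso {B B' Y : Scheme.{0}} {π : B ⟶ Y} {π' : B' ⟶ Y} {I : Y.IdealSheafData}
    (h : IsBlowup π I) (h' : IsBlowup π' I) (g : B' ⟶ B) (hg : g ≫ π = π') : IsIso g := by
  obtain ⟨k, hk, -⟩ := h'.existsUnique_lift π h.isInvertible
  refine ⟨k, ?_, ?_⟩
  · exact (h'.existsUnique_lift π' h'.isInvertible).unique
      (by rw [Category.assoc, hk, hg]) (Category.id_comp _)
  · exact (h.existsUnique_lift π h.isInvertible).unique
      (by rw [Category.assoc, hg, hk]) (Category.id_comp _)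

/-- The restriction of a blowing up to an open subscheme is a blowing up there, so the comparison
map is an isomorphism by the universal property. -/
lemma IsBlowup.isPullback {B Y B' V : Scheme.{0}} {π : B ⟶ Y} {I : Y.IdealSheafData}
    (h : IsBlowup π I) {j : V ⟶ Y} [IsOpenImmersion j] {π' : B' ⟶ V}
    (h' : IsBlowup π' (I.comap j)) (m : B' ⟶ B) (hm : m ≫ π = π' ≫ j) : IsPullback m π' π j := by
  have hP := h.of_isPullback (IsPullback.of_hasPullback π j)
  have : IsIso (pullback.lift m π' hm) := hP.isIso h' _ (pullback.lift_snd _ _ _)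
  exact .of_iso_pullback ⟨hm⟩ (asIso (pullback.lift m π' hm)) (pullback.lift_fst _ _ _)
    (pullback.lift_snd _ _ _)

lemma isBlowup_id (Y : Scheme.{0}) : IsBlowup (𝟙 Y) ⊤ :=
  ⟨by rw [Scheme.IdealSheafData.comap_id]; exact isInvertible_top,
    fun f _ => ⟨f, Category.comp_id f, fun _ h => (Category.comp_id _).symm.trans h⟩⟩

/-- The ideal sheaf has a blowing up. -/
def HasBlowup {Y : Scheme.{0}} (I : Y.IdealSheafData) : Prop :=
  ∃ (B : Scheme.{0}) (π : B ⟶ Y), IsBlowup π I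

lemma HasBlowup.comap {Y V : Scheme.{0}} {I : Y.IdealSheafData} (h : HasBlowup I) (j : V ⟶ Y)
    [IsOpenImmersion j] : HasBlowup (I.comap j) := by
  obtain ⟨B, π, hπ⟩ := h
  exact ⟨_, _, hπ.of_isPullback (IsPullback.of_hasPullback π j)⟩

/-! ### Gluing blowing ups over an open cover of the base -/

section Gluing

variable {Y : Scheme.{0}} (I : Y.IdealSheafData)

/-- The open subschemes over which the ideal sheaf has a blowing up. -/
structure BlowupOpens : Type where
  /-- The open subscheme. -/
  opens : Y.Opens
  hasBlowup : HasBlowup (I.comap opens.ι)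

instance : Preorder (BlowupOpens I) := Preorder.lift BlowupOpens.opens

variable {I}

/-- The blowing up over an open subscheme. -/
def BlowupOpens.blowup (V : BlowupOpens I) : Scheme.{0} := V.hasBlowup.choose

/-- The projection of the blowing up over an open subscheme. -/
def BlowupOpens.proj (V : BlowupOpens I) : V.blowup ⟶ V.opens.toScheme := V.hasBlowup.choose_spec.choose

lemma BlowupOpens.isBlowup (V : BlowupOpens I) : IsBlowup V.proj (I.comap V.opens.ι) :=
  V.hasBlowup.choose_spec.choose_spec

lemma exists_blowupOpens_le (V : BlowupOpens I) {U : Y.Opens} (h : U ≤ V.opens) :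
    ∃ V' : BlowupOpens I, V'.opens = U := by
  refine ⟨⟨U, ?_⟩, rfl⟩
  rw [← Scheme.homOfLE_ι Y h, Scheme.IdealSheafData.comap_comp]
  exact V.hasBlowup.comap _

lemma BlowupOpens.existsUnique_map {V V' : BlowupOpens I} (h : V ≤ V') :
    ∃! g : V.blowup ⟶ V'.blowup, g ≫ V'.proj = V.proj ≫ Y.homOfLE h := by
  apply V'.isBlowup.existsUnique_lift
  rw [← Scheme.IdealSheafData.comap_comp, Category.assoc, Scheme.homOfLE_ι,
    Scheme.IdealSheafData.comap_comp]
  exact V.isBlowup.isInvertible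

/-- The inclusion of blowing ups over open subschemes. -/
def BlowupOpens.map {V V' : BlowupOpens I} (h : V ≤ V') : V.blowup ⟶ V'.blowup :=
  (BlowupOpens.existsUnique_map h).choose

lemma BlowupOpens.map_proj {V V' : BlowupOpens I} (h : V ≤ V') :
    BlowupOpens.map h ≫ V'.proj = V.proj ≫ Y.homOfLE h :=
  (BlowupOpens.existsUnique_map h).choose_spec.1

/-- The blowing ups over open subschemes. -/
def blowupFunctor : BlowupOpens I ⥤ Scheme.{0} where
  obj V := V.blowup
  map f := BlowupOpens.map f.le
  map_id V := (BlowupOpens.existsUnique_map le_rfl).unique (BlowupOpens.map_proj _)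
    (by rw [Category.id_comp, Scheme.homOfLE_rfl, Category.comp_id])
  map_comp {V V' V''} f g := (BlowupOpens.existsUnique_map _).unique (BlowupOpens.map_proj _)
    (by rw [Category.assoc, BlowupOpens.map_proj, ← Category.assoc, BlowupOpens.map_proj,
      Category.assoc, Scheme.homOfLE_homOfLE])

variable (hcov : ∀ y : Y, ∃ V : BlowupOpens I, y ∈ V.opens)

/-- The cover by the open subschemes over which there is a blowing up. -/
def blowupCover : Y.OpenCover where
  I₀ := BlowupOpens I
  X V := V.opens.toScheme
  f V := V.opens.ι
  mem₀ := by
    rw [Scheme.presieve₀_mem_precoverage_iff]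
    refine ⟨fun y => (hcov y).imp fun V hV => ?_, fun V => inferInstance⟩
    rw [Scheme.Opens.range_ι]
    exact hV

instance : Preorder (blowupCover hcov).I₀ := inferInstanceAs (Preorder (BlowupOpens I))

/-- Every open subset of an admissible one is admissible, so the admissible ones form a basis. -/
instance blowupCover_locallyDirected : (blowupCover hcov).LocallyDirected :=
  .ofIsBasisOpensRange
    (fun {V V'} => by
      change V.opens ≤ V'.opens ↔ V.opens.ι.opensRange ≤ V'.opens.ι.opensRange
      rw [Scheme.Opens.opensRange_ι, Scheme.Opens.opensRange_ι])
    (by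
      rw [Opens.isBasis_iff_nbhd]
      intro U x hx
      obtain ⟨V, hV⟩ := hcov x
      obtain ⟨V', hV'⟩ := exists_blowupOpens_le V (U := U ⊓ V.opens) inf_le_right
      refine ⟨_, ⟨V', rfl⟩, ?_, ?_⟩
      · change x ∈ V'.opens.ι.opensRange
        rw [Scheme.Opens.opensRange_ι, hV']
        exact ⟨hx, hV⟩
      · change V'.opens.ι.opensRange ≤ U
        rw [Scheme.Opens.opensRange_ι, hV']
        exact inf_le_left)

lemma blowupCover_trans {V V' : BlowupOpens I} (h : V ≤ V') :
    (blowupCover hcov).trans (i := V) (j := V') (homOfLE h) = Y.homOfLE h := by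
  refine (cancel_mono V'.opens.ι).mp ?_
  exact (Scheme.Cover.trans_map (blowupCover hcov) (i := V) (j := V') (homOfLE h)).trans
    (Scheme.homOfLE_ι Y h).symm

lemma BlowupOpens.isPullback_map {V V' : BlowupOpens I} (f : V ⟶ V') :
    IsPullback (BlowupOpens.map f.le) V.proj V'.proj
      ((blowupCover hcov).trans (i := V) (j := V') f) := by
  have e : (blowupCover hcov).trans (i := V) (j := V') f = Y.homOfLE f.le :=
    blowupCover_trans hcov f.le
  rw [e]
  refine V'.isBlowup.isPullback ?_ _ (BlowupOpens.map_proj f.le)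
  rw [← Scheme.IdealSheafData.comap_comp, Scheme.homOfLE_ι]
  exact V.isBlowup

/-- The gluing datum of the blowing ups over open subschemes. -/
def blowupGluing : (blowupCover hcov).RelativeGluingData where
  functor := blowupFunctor (I := I)
  natTrans :=
    { app := fun V => BlowupOpens.proj V
      naturality := fun V _ f => (BlowupOpens.map_proj f.le).trans
        (congrArg (BlowupOpens.proj V ≫ ·) (blowupCover_trans hcov f.le).symm) }
  equifibered := fun _ _ f => BlowupOpens.isPullback_map hcov f

/-- The glued scheme restricts over each `V` to the chosen blowing up. A lift over the preimage of
`V` is therefore the same as a lift to that blowing up, and the universal property is checked there.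
-/
lemma exists_isBlowup_of_cover (hcov : ∀ y : Y, ∃ V : BlowupOpens I, y ∈ V.opens) :
    HasBlowup I := by
  let d := blowupGluing hcov
  have hsq : ∀ V : BlowupOpens I, ∃ k : V.blowup ⟶ d.glued,
      IsPullback V.proj k V.opens.ι d.toBase := fun V =>
    ⟨_, d.isPullback_natTrans_ι_toBase V⟩
  refine ⟨d.glued, d.toBase, isBlowup_of_local ?_ ?_ ?_⟩
  · refine isInvertible_of_cover fun x => ?_
    obtain ⟨V, hV⟩ := hcov (d.toBase x)
    obtain ⟨k, hk⟩ := hsq V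
    have hko : IsOpenImmersion k := MorphismProperty.of_isPullback hk inferInstance
    refine ⟨_, k, hko, ?_, ?_⟩
    · obtain ⟨z, -, hz⟩ := Scheme.exists_preimage_of_isPullback hk ⟨_, hV⟩ x rfl
      exact ⟨z, hz⟩
    · rw [← Scheme.IdealSheafData.comap_comp, ← hk.w, Scheme.IdealSheafData.comap_comp]
      exact V.isBlowup.isInvertible
  · intro T g g' e hI x
    obtain ⟨V, hV⟩ := hcov ((g ≫ d.toBase) x)
    obtain ⟨k, hk⟩ := hsq V
    let j := pullback.fst (g ≫ d.toBase) V.opens.ι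
    let p := pullback.snd (g ≫ d.toBase) V.opens.ι
    have hp : j ≫ g ≫ d.toBase = p ≫ V.opens.ι := pullback.condition
    have hp' : j ≫ g' ≫ d.toBase = p ≫ V.opens.ι := by rw [← e, hp]
    refine ⟨_, j, inferInstance, ?_, ?_⟩
    · obtain ⟨z, hz, -⟩ := Scheme.Pullback.exists_preimage_pullback
        (f := g ≫ d.toBase) (g := V.opens.ι) x ⟨_, hV⟩ rfl
      exact ⟨z, hz⟩
    · have hpI : IsInvertible ((I.comap V.opens.ι).comap p) := by
        rw [← Scheme.IdealSheafData.comap_comp, ← hp, Scheme.IdealSheafData.comap_comp]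
        exact hI.comap j
      have h := (V.isBlowup.existsUnique_lift p hpI).unique
        (hk.lift_fst p (j ≫ g) (by rw [Category.assoc, hp]))
        (hk.lift_fst p (j ≫ g') (by rw [Category.assoc, hp']))
      rw [← hk.lift_snd p (j ≫ g) (by rw [Category.assoc, hp]), h, hk.lift_snd]
  · intro T f hI x
    obtain ⟨V, hV⟩ := hcov (f x)
    obtain ⟨k, hk⟩ := hsq V
    let j := pullback.fst f V.opens.ι
    let p := pullback.snd f V.opens.ι
    have hp : j ≫ f = p ≫ V.opens.ι := pullback.condition
    refine ⟨_, j, inferInstance, ?_, ?_⟩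
    · obtain ⟨z, hz, -⟩ := Scheme.Pullback.exists_preimage_pullback
        (f := f) (g := V.opens.ι) x ⟨_, hV⟩ rfl
      exact ⟨z, hz⟩
    · have hpI : IsInvertible ((I.comap V.opens.ι).comap p) := by
        rw [← Scheme.IdealSheafData.comap_comp, ← hp, Scheme.IdealSheafData.comap_comp]
        exact hI.comap j
      obtain ⟨g, hg, -⟩ := V.isBlowup.existsUnique_lift p hpI
      exact ⟨g ≫ k, by rw [Category.assoc, ← hk.w, reassoc_of% hg, hp]⟩

end Gluing

/-- An ideal sheaf has a blowing up if it has one locally. -/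
lemma hasBlowup_of_local {Y : Scheme.{0}} {I : Y.IdealSheafData}
    (h : ∀ y : Y, ∃ (V : Scheme.{0}) (j : V ⟶ Y), IsOpenImmersion j ∧ y ∈ Set.range j ∧
      HasBlowup (I.comap j)) : HasBlowup I := by
  refine exists_isBlowup_of_cover fun y => ?_
  obtain ⟨V, j, hj, hy, hI⟩ := h y
  refine ⟨⟨j.opensRange, ?_⟩, hy⟩
  have e : j.isoOpensRange.inv ≫ j = j.opensRange.ι := j.isoOpensRange_inv_comp
  rw [← e, Scheme.IdealSheafData.comap_comp]
  exact hI.comap _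

/-! ### Blowing up an ideal with two generators -/

/-- The affine chart of the blowing up of `(a, b)` where `a` divides `b`, with the quotient `t`. -/
structure IsBlowupChart {R A : Type} [CommRing R] [CommRing A] (ρ : R →+* A) (a b : R) (t : A) :
    Prop where
  map_eq : ρ b = ρ a * t
  mem_nonZeroDivisors : ρ a ∈ nonZeroDivisors A
  existsUnique_lift : ∀ {S : Type} [CommRing S] (φ : R →+* S) (t' : S), φ b = φ a * t' →
    ∃! ψ : A →+* S, ψ.comp ρ = φ ∧ ψ t = t'

section TwoCharts

variable {R A E : Type} [CommRing R] [CommRing A] [CommRing E] {ρ : R →+* A} {σ : R →+* E}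
  {a b : R} {t : A} {s : E}

lemma IsBlowupChart.ringHom_ext (hA : IsBlowupChart ρ a b t) {S : Type} [CommRing S]
    {ψ ψ' : A →+* S} (h : ψ.comp ρ = ψ'.comp ρ) (ht : ψ t = ψ' t) : ψ = ψ' :=
  (hA.existsUnique_lift (ψ'.comp ρ) (ψ' t) (by simp [hA.map_eq])).unique ⟨h, ht⟩ ⟨rfl, rfl⟩

/-- The homomorphism of charts on the locus where the quotients are invertible. -/
lemma IsBlowupChart.exists_transition (hA : IsBlowupChart ρ a b t) (hE : IsBlowupChart σ b a s) :
    ∃ κ : E →+* Localization.Away t, κ.comp σ = (algebraMap A (Localization.Away t)).comp ρ ∧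
      κ s * algebraMap A (Localization.Away t) t = 1 := by
  have hu : IsUnit (algebraMap A (Localization.Away t) t) := IsLocalization.Away.algebraMap_isUnit t
  obtain ⟨κ, ⟨h₁, h₂⟩, -⟩ := hE.existsUnique_lift ((algebraMap A (Localization.Away t)).comp ρ)
    ↑hu.unit⁻¹ (by
      simp only [RingHom.comp_apply, hA.map_eq, map_mul]
      rw [mul_assoc, hu.mul_val_inv, mul_one])
  exact ⟨κ, h₁, by rw [h₂]; exact hu.val_inv_mul⟩

lemma IsBlowupChart.transition_comp (hA : IsBlowupChart ρ a b t)
    {κ : E →+* Localization.Away t} {μ : A →+* Localization.Away s}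
    (hκ : κ.comp σ = (algebraMap A (Localization.Away t)).comp ρ)
    (hκs : κ s * algebraMap A (Localization.Away t) t = 1)
    (hμ : μ.comp ρ = (algebraMap E (Localization.Away s)).comp σ)
    (hμt : μ t * algebraMap E (Localization.Away s) s = 1)
    {f : Localization.Away s →+* Localization.Away t} {g : Localization.Away t →+* Localization.Away s}
    (hf : ∀ x, f (algebraMap E _ x) = κ x) (hg : ∀ x, g (algebraMap A _ x) = μ x) :
    f.comp g = RingHom.id _ := by
  apply IsLocalization.ringHom_ext (Submonoid.powers t)
  apply hA.ringHom_ext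
  · ext r
    have h₁ := congrArg (fun h => h r) hκ
    have h₂ := congrArg (fun h => h r) hμ
    simp only [RingHom.comp_apply, RingHom.id_apply] at h₁ h₂ ⊢
    rw [hg, h₂, hf, h₁]
  · simp only [RingHom.comp_apply, RingHom.id_apply]
    rw [hg]
    have h₁ := congrArg f hμt
    rw [map_mul, hf, map_one] at h₁
    linear_combination (algebraMap A (Localization.Away t) t) * h₁ - f (μ t) * hκs

/-- The quotients `t = b / a` and `s = a / b` are mutually inverse on the overlap, so by the two
universal properties the localizations at `t` and at `s` are isomorphic. -/
lemma IsBlowupChart.isOpenImmersion_transition (hA : IsBlowupChart ρ a b t)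
    (hE : IsBlowupChart σ b a s) {κ : E →+* Localization.Away t}
    (hκ : κ.comp σ = (algebraMap A (Localization.Away t)).comp ρ)
    (hκs : κ s * algebraMap A (Localization.Away t) t = 1) :
    IsOpenImmersion (Spec.map (CommRingCat.ofHom κ)) ∧
      ∀ y : Spec (.of E), s ∉ PrimeSpectrum.asIdeal y →
        y ∈ Set.range (Spec.map (CommRingCat.ofHom κ)) := by
  obtain ⟨μ, hμ, hμt⟩ := hE.exists_transition hA
  let f : Localization.Away s →+* Localization.Away t :=
    IsLocalization.Away.lift s (g := κ) (.of_mul_eq_one _ hκs)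
  have hf : ∀ x, f (algebraMap E _ x) = κ x := fun x => IsLocalization.Away.lift_eq s _ x
  let g : Localization.Away t →+* Localization.Away s :=
    IsLocalization.Away.lift t (g := μ) (.of_mul_eq_one _ hμt)
  have hg : ∀ x, g (algebraMap A _ x) = μ x := fun x => IsLocalization.Away.lift_eq t _ x
  let e : Localization.Away s ≃+* Localization.Away t := RingEquiv.ofRingHom f g
    (hA.transition_comp hκ hκs hμ hμt hf hg) (hE.transition_comp hμ hμt hκ hκs hg hf)
  let i : Spec (.of (Localization.Away t)) ≅ Spec (.of (Localization.Away s)) :=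
    Scheme.Spec.mapIso e.toCommRingCatIso.op
  have hi : i.hom = Spec.map (CommRingCat.ofHom f) := rfl
  have e₁ : Spec.map (CommRingCat.ofHom κ) = i.hom ≫ basicι s := by
    rw [hi]
    refine Eq.trans ?_ (Spec.map_comp _ _)
    exact congrArg (fun h : E →+* Localization.Away t => Spec.map (CommRingCat.ofHom h))
      (RingHom.ext fun x => (hf x).symm)
  rw [e₁]
  refine ⟨inferInstance, fun y hy => ?_⟩
  obtain ⟨z, rfl⟩ := (mem_range_basicι s y).mpr hy
  refine ⟨i.inv z, ?_⟩
  change (i.inv ≫ i.hom ≫ basicι s) z = _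
  rw [i.inv_hom_id_assoc]

/-- The two charts of a blowing up, glued. -/
structure IsBlowupGluing {B : Scheme.{0}} (π : B ⟶ Spec (.of R)) (ρ : R →+* A) (σ : R →+* E)
    (t : A) (s : E) (j : Spec (.of A) ⟶ B) (k : Spec (.of E) ⟶ B) : Prop where
  left_isOpenImmersion : IsOpenImmersion j
  right_isOpenImmersion : IsOpenImmersion k
  left_comp : j ≫ π = Spec.map (CommRingCat.ofHom ρ)
  right_comp : k ≫ π = Spec.map (CommRingCat.ofHom σ)
  mem_range (y : B) : y ∈ Set.range j ∨ y ∈ Set.range k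
  left_mem (x : Spec (.of A)) : t ∉ PrimeSpectrum.asIdeal x → j x ∈ Set.range k
  right_mem (x : Spec (.of E)) : s ∉ PrimeSpectrum.asIdeal x → k x ∈ Set.range j

lemma IsBlowupGluing.symm {B : Scheme.{0}} {π : B ⟶ Spec (.of R)} {j : Spec (.of A) ⟶ B}
    {k : Spec (.of E) ⟶ B} (h : IsBlowupGluing π ρ σ t s j k) : IsBlowupGluing π σ ρ s t k j :=
  ⟨h.2, h.1, h.4, h.3, fun y => (h.5 y).symm, h.7, h.6⟩

lemma exists_isBlowupGluing (hA : IsBlowupChart ρ a b t) (hE : IsBlowupChart σ b a s) :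
    ∃ (B : Scheme.{0}) (π : B ⟶ Spec (.of R)) (j : Spec (.of A) ⟶ B) (k : Spec (.of E) ⟶ B),
      IsBlowupGluing π ρ σ t s j k := by
  obtain ⟨κ, hκ, hκs⟩ := hA.exists_transition hE
  obtain ⟨hκo, hκm⟩ := hA.isOpenImmersion_transition hE hκ hκs
  let p := basicι t
  let q : Spec (.of (Localization.Away t)) ⟶ Spec (.of E) := Spec.map (CommRingCat.ofHom κ)
  have : IsOpenImmersion q := hκo
  let j : Spec (.of A) ⟶ pushout p q := pushout.inl p q
  let k : Spec (.of E) ⟶ pushout p q := pushout.inr p q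
  have w : p ≫ Spec.map (CommRingCat.ofHom ρ) = q ≫ Spec.map (CommRingCat.ofHom σ) := by
    refine (Spec.map_comp _ _).symm.trans (Eq.trans ?_ (Spec.map_comp _ _))
    exact congrArg (fun h : R →+* Localization.Away t => Spec.map (CommRingCat.ofHom h)) hκ.symm
  have hjk : p ≫ j = q ≫ k := pushout.condition
  refine ⟨pushout p q, pushout.desc _ _ w, j, k,
    inferInstanceAs (IsOpenImmersion (colimit.ι (span p q) WalkingSpan.left)),
    inferInstanceAs (IsOpenImmersion (colimit.ι (span p q) WalkingSpan.right)),
    pushout.inl_desc _ _ w, pushout.inr_desc _ _ w, fun y => ?_, fun x hx => ?_, fun x hx => ?_⟩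
  · obtain ⟨l, z, hz⟩ := Scheme.IsLocallyDirected.ι_jointly_surjective (span p q) y
    rcases l with _ | _ | _
    · left
      refine ⟨p z, Eq.trans ?_ hz⟩
      exact congrArg (fun f : _ ⟶ pushout p q => f z) (colimit.w (span p q) WalkingSpan.Hom.fst)
    · exact .inl ⟨z, hz⟩
    · exact .inr ⟨z, hz⟩
  · obtain ⟨z, rfl⟩ := (mem_range_basicι t x).mpr hx
    exact ⟨q z, (congrArg (fun f : _ ⟶ pushout p q => f z) hjk).symm⟩
  · obtain ⟨z, rfl⟩ := hκm x hx
    exact ⟨p z, congrArg (fun f : _ ⟶ pushout p q => f z) hjk⟩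

lemma exists_ringHom_eq {L : Type} [CommRing L] (f : Spec (.of L) ⟶ Spec (.of R)) :
    ∃ φ : R →+* L, Spec.map (CommRingCat.ofHom φ) = f :=
  ⟨(Spec.preimage f).hom, Spec.map_preimage f⟩

lemma ringHom_eq_of_specMap_eq {L : Type} [CommRing L] {φ ψ : R →+* L}
    (h : Spec.map (CommRingCat.ofHom φ) = Spec.map (CommRingCat.ofHom ψ)) : φ = ψ :=
  congrArg CommRingCat.Hom.hom (Spec.map_injective h)

lemma specMap_comp {L M : Type} [CommRing L] [CommRing M] (φ : R →+* L) (ψ : L →+* M) :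
    Spec.map (CommRingCat.ofHom (ψ.comp φ)) =
      Spec.map (CommRingCat.ofHom ψ) ≫ Spec.map (CommRingCat.ofHom φ) :=
  Spec.map_comp _ _

/-- Morphisms along which `a` generates the ideal `(a, b)` factor through the chart of `a`. -/
lemma IsBlowupGluing.exists_eq {B : Scheme.{0}} {π : B ⟶ Spec (.of R)} {j : Spec (.of A) ⟶ B}
    {k : Spec (.of E) ⟶ B} (h : IsBlowupGluing π ρ σ t s j k) (hA : IsBlowupChart ρ a b t)
    (hE : IsBlowupChart σ b a s) {L : Type} [CommRing L] {φ : R →+* L} {t' : L}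
    (ht : φ b = φ a * t') (ha : φ a ∈ nonZeroDivisors L) {g : Spec (.of L) ⟶ B}
    (hg : g ≫ π = Spec.map (CommRingCat.ofHom φ)) :
    ∃ ψ : A →+* L, (ψ.comp ρ = φ ∧ ψ t = t') ∧ Spec.map (CommRingCat.ofHom ψ) ≫ j = g := by
  have := h.left_isOpenImmersion
  have := h.right_isOpenImmersion
  have hr : Set.range g ⊆ Set.range j := by
    rintro _ ⟨x, rfl⟩
    rcases h.mem_range (g x) with hx | ⟨y, hy⟩
    · exact hx
    obtain ⟨r, ⟨z, rfl⟩, hrU⟩ := exists_basicι (x := x) (U := g ⁻¹' Set.range k)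
      (k.isOpenEmbedding.isOpen_range.preimage g.continuous) ⟨y, hy⟩
    have hr' : Set.range (basicι r ≫ g) ⊆ Set.range k := by
      rintro _ ⟨w, rfl⟩
      exact hrU ⟨w, rfl⟩
    obtain ⟨θ, hθ⟩ := exists_ringHom_eq (IsOpenImmersion.lift k (basicι r ≫ g) hr')
    have hθk : Spec.map (CommRingCat.ofHom θ) ≫ k = basicι r ≫ g := by
      rw [hθ]
      exact IsOpenImmersion.lift_fac k _ hr'
    have hθσ : θ.comp σ = (algebraMap L (Localization.Away r)).comp φ := by
      apply ringHom_eq_of_specMap_eq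
      rw [specMap_comp, specMap_comp, ← hg, ← h.right_comp, ← Category.assoc, hθk]
      rfl
    have e₁ := congrArg (fun f => f a) hθσ
    have e₂ := congrArg (fun f => f b) hθσ
    simp only [RingHom.comp_apply, hE.map_eq, map_mul, ht] at e₁ e₂
    -- In the second chart `a = b s = a t' s`. Cancelling the nonzerodivisor `a` shows that `s` is
    -- invertible, so the point already lies in the first chart.
    have hz : IsUnit (θ s) := by
      refine .of_mul_eq_one (algebraMap L (Localization.Away r) t') ?_
      have h₀ := mem_nonZeroDivisors_iff_right.mp (algebraMap_mem_nonZeroDivisors r ha)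
        (θ s * algebraMap L (Localization.Away r) t' - 1)
      rw [← sub_eq_zero]
      apply h₀
      linear_combination e₁ - (θ s) * e₂
    have hgz : g (basicι r z) = k (Spec.map (CommRingCat.ofHom θ) z) :=
      (congrArg (fun f : _ ⟶ B => f z) hθk).symm
    rw [hgz]
    apply h.right_mem
    intro hs
    exact (PrimeSpectrum.isPrime z).ne_top (Ideal.eq_top_of_isUnit_mem _ hs hz)
  obtain ⟨ψ, hψ⟩ := exists_ringHom_eq (IsOpenImmersion.lift j g hr)
  have hψj : Spec.map (CommRingCat.ofHom ψ) ≫ j = g := by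
    rw [hψ]
    exact IsOpenImmersion.lift_fac j _ hr
  have hψρ : ψ.comp ρ = φ := by
    apply ringHom_eq_of_specMap_eq
    rw [specMap_comp, ← hg, ← h.left_comp, ← Category.assoc, hψj]
  refine ⟨ψ, ⟨hψρ, ?_⟩, hψj⟩
  have e₁ := congrArg (fun f => f a) hψρ
  have e₂ := congrArg (fun f => f b) hψρ
  simp only [RingHom.comp_apply, hA.map_eq, map_mul, ht] at e₁ e₂
  rw [← sub_eq_zero]
  apply mem_nonZeroDivisors_iff_right.mp ha
  rw [e₁] at e₂
  linear_combination e₂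

/-- If `a = α g`, `b = β g` and the nonzerodivisor `g` is a combination of `a` and `b`, then `α` and
`β` generate the unit ideal. Near each point one of them is invertible, and `a` or `b` alone
generates. -/
lemma exists_local_generator {T : Scheme.{0}} {I : (Spec (.of R)).IdealSheafData}
    (hI : specIdeal I = Ideal.span {a, b}) (f : T ⟶ Spec (.of R)) (hf : IsInvertible (I.comap f))
    (x : T) : ∃ (L : Type) (_ : CommRing L) (l : Spec (.of L) ⟶ T) (φ : R →+* L),
      IsOpenImmersion l ∧ x ∈ Set.range l ∧ l ≫ f = Spec.map (CommRingCat.ofHom φ) ∧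
      ((∃ c, φ b = φ a * c ∧ φ a ∈ nonZeroDivisors L) ∨
        ∃ c, φ a = φ b * c ∧ φ b ∈ nonZeroDivisors L) := by
  obtain ⟨L, _, l, hl, ⟨y, rfl⟩, g, hg, e⟩ := isInvertible_iff.mp hf x
  obtain ⟨φ, hφ⟩ := exists_ringHom_eq (l ≫ f)
  rw [← Scheme.IdealSheafData.comap_comp, ← hφ, specIdeal_comap, hI, Ideal.map_span,
    Set.image_pair] at e
  have h₁ : φ a ∈ Ideal.span {g} := e ▸ Ideal.subset_span (by simp)
  have h₂ : φ b ∈ Ideal.span {g} := e ▸ Ideal.subset_span (by simp)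
  have h₃ : g ∈ Ideal.span {φ a, φ b} := e ▸ Ideal.mem_span_singleton_self g
  obtain ⟨α, hα⟩ := Ideal.mem_span_singleton'.mp h₁
  obtain ⟨β, hβ⟩ := Ideal.mem_span_singleton'.mp h₂
  obtain ⟨γ, δ, hγδ⟩ := Ideal.mem_span_pair.mp h₃
  have hone : γ * α + δ * β = 1 := by
    rw [← sub_eq_zero]
    apply mem_nonZeroDivisors_iff_right.mp hg
    linear_combination hγδ + γ * hα + δ * hβ
  have key : ∀ {a b : R} {α β : L}, α * g = φ a → β * g = φ b → α ∉ PrimeSpectrum.asIdeal y →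
      ∃ (L' : Type) (_ : CommRing L') (l' : Spec (.of L') ⟶ T) (φ' : R →+* L'),
      IsOpenImmersion l' ∧ l y ∈ Set.range l' ∧ l' ≫ f = Spec.map (CommRingCat.ofHom φ') ∧
      ∃ c, φ' b = φ' a * c ∧ φ' a ∈ nonZeroDivisors L' := by
    intro a b α β hα hβ hy
    obtain ⟨z, rfl⟩ := (mem_range_basicι α y).mpr hy
    have hu : IsUnit (algebraMap L (Localization.Away α) α) :=
      IsLocalization.Away.algebraMap_isUnit α
    refine ⟨_, inferInstance, basicι α ≫ l, (algebraMap L (Localization.Away α)).comp φ,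
      inferInstance, ⟨z, rfl⟩, ?_, ↑hu.unit⁻¹ * algebraMap L _ β, ?_, ?_⟩
    · rw [specMap_comp, hφ]
      exact Category.assoc _ _ _
    · simp only [RingHom.comp_apply, ← hα, ← hβ, map_mul]
      linear_combination - (algebraMap L (Localization.Away α) β) *
        (algebraMap L (Localization.Away α) g) * hu.mul_val_inv
    · simp only [RingHom.comp_apply, ← hα, map_mul]
      exact mul_mem hu.mem_nonZeroDivisors (algebraMap_mem_nonZeroDivisors α hg)
  by_cases hy : α ∈ PrimeSpectrum.asIdeal y
  · have hy' : β ∉ PrimeSpectrum.asIdeal y := fun hβ' =>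
      (PrimeSpectrum.isPrime y).ne_top ((Ideal.eq_top_iff_one _).mpr (hone ▸
        add_mem (Ideal.mul_mem_left _ _ hy) (Ideal.mul_mem_left _ _ hβ')))
    obtain ⟨L', i, l', φ', h, h', h'', h'''⟩ := key hβ hα hy'
    exact ⟨L', i, l', φ', h, h', h'', .inr h'''⟩
  · obtain ⟨L', i, l', φ', h, h', h'', h'''⟩ := key hα hβ hy
    exact ⟨L', i, l', φ', h, h', h'', .inl h'''⟩

lemma IsBlowupChart.isInvertible (hA : IsBlowupChart ρ a b t) {I : (Spec (.of R)).IdealSheafData}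
    (hI : specIdeal I = Ideal.span {a, b}) :
    IsInvertible (I.comap (Spec.map (CommRingCat.ofHom ρ))) := by
  refine isInvertible_of_specIdeal_eq hA.mem_nonZeroDivisors ?_
  rw [specIdeal_comap, hI, Ideal.map_span, Set.image_pair, hA.map_eq]
  refine le_antisymm (Ideal.span_le.mpr ?_) (Ideal.span_mono (by simp))
  rintro _ (rfl | rfl)
  · exact Ideal.mem_span_singleton_self _
  · exact Ideal.mul_mem_right _ _ (Ideal.mem_span_singleton_self _)

/-- Locally on the source one generator divides the other, and every lift then goes through the
corresponding chart, where the universal property of its ring applies. -/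
lemma IsBlowupGluing.isBlowup {B : Scheme.{0}} {π : B ⟶ Spec (.of R)} {j : Spec (.of A) ⟶ B}
    {k : Spec (.of E) ⟶ B} (h : IsBlowupGluing π ρ σ t s j k) (hA : IsBlowupChart ρ a b t)
    (hE : IsBlowupChart σ b a s) {I : (Spec (.of R)).IdealSheafData}
    (hI : specIdeal I = Ideal.span {a, b}) : IsBlowup π I := by
  have hI' : specIdeal I = Ideal.span {b, a} := by rw [hI, Set.pair_comm]
  refine isBlowup_of_local ?_ ?_ ?_
  · refine isInvertible_of_cover fun y => ?_
    rcases h.mem_range y with hy | hy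
    · refine ⟨_, j, h.left_isOpenImmersion, hy, ?_⟩
      rw [← Scheme.IdealSheafData.comap_comp, h.left_comp]
      exact hA.isInvertible hI
    · refine ⟨_, k, h.right_isOpenImmersion, hy, ?_⟩
      rw [← Scheme.IdealSheafData.comap_comp, h.right_comp]
      exact hE.isInvertible hI'
  · intro T g g' e hg x
    obtain ⟨L, _, l, φ, hl, hx, hφ, hc⟩ := exists_local_generator hI (g ≫ π) hg x
    refine ⟨_, l, hl, hx, ?_⟩
    have h₁ : (l ≫ g) ≫ π = Spec.map (CommRingCat.ofHom φ) := by rw [Category.assoc, hφ]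
    have h₂ : (l ≫ g') ≫ π = Spec.map (CommRingCat.ofHom φ) := by rw [Category.assoc, ← e, hφ]
    rcases hc with ⟨c, hc, hn⟩ | ⟨c, hc, hn⟩
    · obtain ⟨ψ, hψ, e₁⟩ := h.exists_eq hA hE hc hn h₁
      obtain ⟨ψ', hψ', e₂⟩ := h.exists_eq hA hE hc hn h₂
      rw [← e₁, ← e₂, (hA.existsUnique_lift φ c hc).unique hψ hψ']
    · obtain ⟨ψ, hψ, e₁⟩ := h.symm.exists_eq hE hA hc hn h₁
      obtain ⟨ψ', hψ', e₂⟩ := h.symm.exists_eq hE hA hc hn h₂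
      rw [← e₁, ← e₂, (hE.existsUnique_lift φ c hc).unique hψ hψ']
  · intro T f hf x
    obtain ⟨L, _, l, φ, hl, hx, hφ, hc⟩ := exists_local_generator hI f hf x
    refine ⟨_, l, hl, hx, ?_⟩
    rcases hc with ⟨c, hc, -⟩ | ⟨c, hc, -⟩
    · obtain ⟨ψ, ⟨hψ, -⟩, -⟩ := hA.existsUnique_lift φ c hc
      exact ⟨Spec.map (CommRingCat.ofHom ψ) ≫ j, by
        rw [Category.assoc, h.left_comp, hφ, ← specMap_comp, hψ]⟩
    · obtain ⟨ψ, ⟨hψ, -⟩, -⟩ := hE.existsUnique_lift φ c hc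
      exact ⟨Spec.map (CommRingCat.ofHom ψ) ≫ k, by
        rw [Category.assoc, h.right_comp, hφ, ← specMap_comp, hψ]⟩

end TwoCharts

/-! ### The affine toric charts of the rays -/

/-- The coordinate `V_i` of the affine toric chart of a ray. -/
def rayV (i : Fin 3) : ToricRing {i} := AddMonoidAlgebra.single ⟨VV i, VV_mem i⟩ 1

lemma neg_ZZ_mem (i : Fin 3) : -ZZ i ∈ dualCone {i} := by
  have h : ∀ i, 0 ≤ pair (-ZZ i) (ray i) := by decide
  intro j hj
  rw [Finset.mem_singleton.mp hj]
  exact h i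

/-- The invertible coordinate `Z_i` of the affine toric chart of a ray. -/
def rayZ (i : Fin 3) : (ToricRing {i})ˣ where
  val := AddMonoidAlgebra.single ⟨ZZ i, ZZ_mem i⟩ 1
  inv := AddMonoidAlgebra.single ⟨-ZZ i, neg_ZZ_mem i⟩ 1
  val_inv := by
    rw [AddMonoidAlgebra.single_mul_single, mul_one, AddMonoidAlgebra.one_def]
    congr 1
    exact Subtype.ext (add_neg_cancel (ZZ i))
  inv_val := by
    rw [AddMonoidAlgebra.single_mul_single, mul_one, AddMonoidAlgebra.one_def]
    congr 1
    exact Subtype.ext (neg_add_cancel (ZZ i))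

/-- The one-parameter subgroup dual to `Z_i` which is trivial on `V_i`. -/
def coray : Fin 3 → ℤ × ℤ := ![(0, 1), (-1, 0), (1, -1)]

lemma pair_add_left (a b n : ℤ × ℤ) : pair (a + b) n = pair a n + pair b n := by
  simp [pair]; ring

lemma pair_VV (i : Fin 3) : pair (VV i) (ray i) = 1 ∧ pair (VV i) (coray i) = 0 := by
  revert i; decide

lemma pair_ZZ (i : Fin 3) : pair (ZZ i) (ray i) = 0 ∧ pair (ZZ i) (coray i) = 1 := by
  revert i; decide

/-- `V_i`, `Z_i` is a basis of the characters with dual basis `ray i`, `coray i`; hence the chart is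
`ℂ × ℂˣ` in these coordinates. -/
lemma eq_smul_VV_add_smul_ZZ (i : Fin 3) (m : ℤ × ℤ) :
    m = pair m (ray i) • VV i + pair m (coray i) • ZZ i := by
  obtain ⟨x, y⟩ := m
  fin_cases i <;> refine Prod.ext ?_ ?_ <;> simp [pair, ray, coray, VV, ZZ, expo] <;> ring

lemma pair_ray_nonneg {i : Fin 3} (m : dualCone {i}) : 0 ≤ pair m (ray i) :=
  m.2 i (Finset.mem_singleton_self i)

lemma rayZ_zpow (i : Fin 3) (q : ℤ) : ∃ h : q • ZZ i ∈ dualCone {i},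
    ((rayZ i ^ q : (ToricRing {i})ˣ) : ToricRing {i}) = AddMonoidAlgebra.single ⟨q • ZZ i, h⟩ 1 := by
  obtain ⟨n, rfl | rfl⟩ := q.eq_nat_or_neg
  · refine ⟨by rw [natCast_zsmul]; exact nsmul_mem (ZZ_mem i) n, ?_⟩
    rw [zpow_natCast, Units.val_pow_eq_pow_val, rayZ, AddMonoidAlgebra.single_pow, one_pow]
    exact congrArg (fun m : dualCone {i} => (AddMonoidAlgebra.single m 1 : ToricRing {i}))
      (Subtype.ext (natCast_zsmul _ _).symm)
  · refine ⟨by rw [neg_smul, ← smul_neg, natCast_zsmul]; exact nsmul_mem (neg_ZZ_mem i) n, ?_⟩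
    rw [zpow_neg, zpow_natCast, ← inv_pow, Units.val_pow_eq_pow_val]
    change (AddMonoidAlgebra.single (⟨-ZZ i, neg_ZZ_mem i⟩ : dualCone {i}) (1 : ℂ)) ^ n = _
    rw [AddMonoidAlgebra.single_pow, one_pow]
    refine congrArg (fun m : dualCone {i} => (AddMonoidAlgebra.single m 1 : ToricRing {i}))
      (Subtype.ext ?_)
    change n • -ZZ i = -(n : ℤ) • ZZ i
    rw [neg_smul, ← smul_neg, natCast_zsmul]

lemma single_eq_rayV_mul_rayZ {i : Fin 3} (m : dualCone {i}) :
    (AddMonoidAlgebra.single m 1 : ToricRing {i}) = rayV i ^ (pair m (ray i)).toNat *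
      ((rayZ i ^ pair m (coray i) : (ToricRing {i})ˣ) : ToricRing {i}) := by
  obtain ⟨h, e⟩ := rayZ_zpow i (pair m (coray i))
  rw [e, rayV, AddMonoidAlgebra.single_pow, AddMonoidAlgebra.single_mul_single, one_pow, mul_one]
  congr 1
  refine Subtype.ext ?_
  change (m : ℤ × ℤ) = (pair m (ray i)).toNat • VV i + pair m (coray i) • ZZ i
  rw [← natCast_zsmul, Int.toNat_of_nonneg (pair_ray_nonneg m)]
  exact eq_smul_VV_add_smul_ZZ i m

/-- The constants of the affine toric chart. -/
def toricC (S : Finset (Fin 3)) : ℂ →+* ToricRing S := AddMonoidAlgebra.singleZeroRingHom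

lemma rayRing_hom_ext {L : Type} [CommRing L] {i : Fin 3} {f g : ToricRing {i} →+* L}
    (hC : f.comp (toricC {i}) = g.comp (toricC {i})) (hV : f (rayV i) = g (rayV i))
    (hZ : f (rayZ i) = g (rayZ i)) : f = g := by
  refine AddMonoidAlgebra.ringHom_ext (fun c => congrArg (fun h => h c) hC) fun m => ?_
  have hZ' : Units.map (f : ToricRing {i} →* L) (rayZ i) = Units.map (g : ToricRing {i} →* L) (rayZ i) :=
    Units.ext hZ
  have key : ∀ q : ℤ, f ((rayZ i ^ q : (ToricRing {i})ˣ) : ToricRing {i}) =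
      g ((rayZ i ^ q : (ToricRing {i})ˣ) : ToricRing {i}) := fun q => by
    have := congrArg (fun u : Lˣ => ((u ^ q : Lˣ) : L)) hZ'
    simpa only [← map_zpow, Units.coe_map, MonoidHom.coe_coe] using this
  rw [single_eq_rayV_mul_rayZ, map_mul, map_mul, map_pow, map_pow, hV, key]

/-- A homomorphism from the coordinate ring of the affine toric chart of a ray, given by its values
on constants and on the coordinates. -/
def rayLift {L : Type} [CommRing L] (i : Fin 3) (c : ℂ →+* L) (v : L) (z : Lˣ) :
    ToricRing {i} →+* L :=
  AddMonoidAlgebra.liftNCRingHom c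
    { toFun := fun m => v ^ (pair m.toAdd (ray i)).toNat * ((z ^ pair m.toAdd (coray i) : Lˣ) : L)
      map_one' := by simp [pair]
      map_mul' := fun m n => by
        simp only [toAdd_mul, AddSubmonoid.coe_add, pair_add_left]
        rw [Int.toNat_add (pair_ray_nonneg _) (pair_ray_nonneg _), pow_add, zpow_add, Units.val_mul]
        ring }
    fun _ _ => Commute.all _ _

section

variable {L : Type} [CommRing L] (i : Fin 3) (c : ℂ →+* L) (v : L) (z : Lˣ)

lemma rayLift_single (m : dualCone {i}) (a : ℂ) : rayLift i c v z (AddMonoidAlgebra.single m a) =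
    c a * (v ^ (pair m (ray i)).toNat * ((z ^ pair m (coray i) : Lˣ) : L)) :=
  AddMonoidAlgebra.liftNCRingHom_single c _ _ m a

lemma rayLift_comp_toricC : (rayLift i c v z).comp (toricC {i}) = c := by
  ext a
  refine (rayLift_single i c v z 0 a).trans ?_
  simp [pair]

lemma rayLift_toricC (a : ℂ) : rayLift i c v z (toricC {i} a) = c a :=
  congrArg (fun h => h a) (rayLift_comp_toricC i c v z)

lemma rayLift_rayV : rayLift i c v z (rayV i) = v := by
  refine (rayLift_single i c v z ⟨VV i, VV_mem i⟩ 1).trans ?_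
  change c 1 * (v ^ (pair (VV i) (ray i)).toNat * ((z ^ pair (VV i) (coray i) : Lˣ) : L)) = v
  rw [(pair_VV i).1, (pair_VV i).2]
  simp

lemma rayLift_rayZ : rayLift i c v z (rayZ i) = z := by
  refine (rayLift_single i c v z ⟨ZZ i, ZZ_mem i⟩ 1).trans ?_
  change c 1 * (v ^ (pair (ZZ i) (ray i)).toNat * ((z ^ pair (ZZ i) (coray i) : Lˣ) : L)) = z
  rw [(pair_ZZ i).1, (pair_ZZ i).2]
  simp

end

/-- The inclusion of the torus in an affine toric chart, on coordinate rings. -/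
def toTorus (S : Finset (Fin 3)) : ToricRing S →+* TorusRing :=
  AddMonoidAlgebra.mapDomainRingHom ℂ (dualCone S).subtype

lemma toTorus_single {S : Finset (Fin 3)} (m : dualCone S) (c : ℂ) :
    toTorus S (AddMonoidAlgebra.single m c) = AddMonoidAlgebra.single (m : ℤ × ℤ) c := by
  simp [toTorus]

lemma toTorus_injective (S : Finset (Fin 3)) : Function.Injective (toTorus S) :=
  AddMonoidAlgebra.mapDomain_injective Subtype.val_injective

instance (S : Finset (Fin 3)) : IsDomain (ToricRing S) := (toTorus_injective S).isDomain _

lemma rayZ_add_one_ne_zero (i : Fin 3) : (rayZ i : ToricRing {i}) + 1 ≠ 0 := by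
  intro h
  have := congrArg (rayLift i (RingHom.id ℂ) 0 1) h
  rw [map_add, rayLift_rayZ, map_one, map_zero, Units.val_one] at this
  norm_num at this

/-- The projection of the chart of the glued space to the affine toric chart of a ray, on coordinate
rings. -/
def chartHom (i : Fin 3) : ToricRing {i} →+* ChartRing := rayLift i (algebraMap ℂ ChartRing) vv zeta

lemma transition_comp_chartHom (i : Fin 3) : (transition i).comp (chartHom i) = toTorus {i} := by
  apply rayRing_hom_ext
  · refine RingHom.ext fun c => ?_
    simp only [RingHom.comp_apply]
    rw [chartHom, rayLift_toricC, transition_algebraMap_complex]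
    exact (toTorus_single 0 c).symm
  · simp only [RingHom.comp_apply]
    rw [chartHom, rayLift_rayV, transition_v]
    exact (toTorus_single ⟨VV i, VV_mem i⟩ 1).symm
  · simp only [RingHom.comp_apply]
    rw [chartHom, rayLift_rayZ, transition_zeta]
    exact (toTorus_single ⟨ZZ i, ZZ_mem i⟩ 1).symm

lemma vv_ne_zero : (vv : ChartRing) ≠ 0 := by
  intro h
  have := transition_v 0
  rw [h, map_zero] at this
  exact (isUnit_chi _).ne_zero this.symm

/-- `Z + 1 = V u` eliminates `Z = u V - 1`. What remains is a pair `u`, `V` with `u V - 1`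
invertible, which is what `ChartRing` classifies. -/
lemma isBlowupChart_chartHom (i : Fin 3) :
    IsBlowupChart (chartHom i) (rayV i) ((rayZ i : ToricRing {i}) + 1) uu := by
  refine ⟨?_, ?_, fun {S} _ φ t' h => ?_⟩
  · rw [map_add, map_one, chartHom, rayLift_rayV, rayLift_rayZ, zeta_val]
    ring
  · rw [chartHom, rayLift_rayV]
    exact mem_nonZeroDivisors_of_ne_zero vv_ne_zero
  · let _ : Algebra ℂ S := (φ.comp (toricC {i})).toAlgebra
    have hu : t' * φ (rayV i) - 1 = φ (rayZ i) := by
      rw [map_add, map_one] at h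
      linear_combination -h
    have hu' : IsUnit (t' * φ (rayV i) - 1) := by
      rw [hu]
      exact (rayZ i).isUnit.map φ
    refine ⟨(chartLift t' (φ (rayV i)) hu' : ChartRing →ₐ[ℂ] S).toRingHom, ⟨?_, chartLift_uu _ _ _⟩,
      fun ψ hψ => ?_⟩
    · apply rayRing_hom_ext
      · ext c
        change chartLift t' (φ (rayV i)) hu' (chartHom i (toricC {i} c)) = φ (toricC {i} c)
        rw [chartHom, rayLift_toricC, AlgHom.commutes]
        rfl
      · change chartLift t' (φ (rayV i)) hu' (chartHom i (rayV i)) = φ (rayV i)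
        rw [chartHom, rayLift_rayV, chartLift_vv]
      · change chartLift t' (φ (rayV i)) hu' (chartHom i (rayZ i)) = φ (rayZ i)
        rw [chartHom, rayLift_rayZ, zeta_val, map_sub, map_mul, chartLift_uu, chartLift_vv, map_one,
          hu]
    · apply chart_ringHom_ext
      · intro c
        refine Eq.trans ?_ (AlgHom.commutes (chartLift t' (φ (rayV i)) hu') c).symm
        have := congrArg (fun h => h (toricC {i} c)) hψ.1
        simp only [RingHom.comp_apply] at this
        rwa [chartHom, rayLift_toricC] at this
      · exact hψ.2.trans (chartLift_uu _ _ _).symm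
      · refine Eq.trans ?_ (chartLift_vv _ _ _).symm
        have := congrArg (fun h => h (rayV i)) hψ.1
        simp only [RingHom.comp_apply] at this
        rwa [chartHom, rayLift_rayV] at this

/-- The other chart of the blowing up of the point `V_i = 0`, `Z_i = -1`. -/
def otherHom (i : Fin 3) : ToricRing {i} →+* ToricRing {i} :=
  rayLift i (toricC {i}) (((rayZ i : ToricRing {i}) + 1) * rayV i) (rayZ i)

/-- `V = (Z + 1) V'` eliminates `V`, so this chart is again `ℂ × ℂˣ`, with coordinates `V'` and `Z`.
-/
lemma isBlowupChart_otherHom (i : Fin 3) :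
    IsBlowupChart (otherHom i) ((rayZ i : ToricRing {i}) + 1) (rayV i) (rayV i) := by
  have hZ : otherHom i ((rayZ i : ToricRing {i}) + 1) = (rayZ i : ToricRing {i}) + 1 := by
    rw [map_add, map_one, otherHom, rayLift_rayZ]
  have hV : otherHom i (rayV i) = ((rayZ i : ToricRing {i}) + 1) * rayV i := rayLift_rayV _ _ _ _
  refine ⟨by rw [hZ, hV], ?_, fun {S} _ φ t' h => ?_⟩
  · rw [hZ]
    exact mem_nonZeroDivisors_of_ne_zero (rayZ_add_one_ne_zero i)
  · let z : Sˣ := Units.map (φ : ToricRing {i} →* S) (rayZ i)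
    have hz : (z : S) = φ (rayZ i) := rfl
    refine ⟨rayLift i (φ.comp (toricC {i})) t' z, ⟨?_, rayLift_rayV _ _ _ _⟩, fun ψ hψ => ?_⟩
    · apply rayRing_hom_ext
      · ext c
        simp only [RingHom.comp_apply]
        rw [otherHom, rayLift_toricC, rayLift_toricC]
        rfl
      · simp only [RingHom.comp_apply]
        rw [hV, map_mul, map_add, map_one, rayLift_rayZ, rayLift_rayV, h, hz, map_add, map_one]
      · simp only [RingHom.comp_apply]
        rw [otherHom, rayLift_rayZ, rayLift_rayZ]
        rfl
    · apply rayRing_hom_ext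
      · ext c
        have := congrArg (fun h => h (toricC {i} c)) hψ.1
        simp only [RingHom.comp_apply] at this ⊢
        rw [otherHom, rayLift_toricC] at this
        rw [this, rayLift_toricC]
        rfl
      · rw [hψ.2, rayLift_rayV]
      · have := congrArg (fun h => h (rayZ i : ToricRing {i})) hψ.1
        simp only [RingHom.comp_apply] at this
        rw [otherHom, rayLift_rayZ] at this
        rw [this, rayLift_rayZ, hz]

/-! ### Inverse images of ideal sheaves under open immersions -/

lemma comap_iInf {X Y : Scheme.{0}} {ι : Type} [Finite ι] (I : ι → Y.IdealSheafData) (j : X ⟶ Y)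
    [IsOpenImmersion j] : (⨅ k, I k).comap j = ⨅ k, (I k).comap j := by
  apply Scheme.IdealSheafData.ext
  funext U
  rw [Scheme.IdealSheafData.ideal_comap_of_isOpenImmersion, Scheme.IdealSheafData.ideal_iInf,
    Scheme.IdealSheafData.ideal_iInf, iInf_apply, iInf_apply, Ideal.comap_iInf]
  exact iInf_congr fun k =>
    (Scheme.IdealSheafData.ideal_comap_of_isOpenImmersion (I k) j U).symm

lemma comap_ker {X Y U V : Scheme.{0}} {f : X ⟶ Y} {f' : U ⟶ V} {iU : U ⟶ X} {iV : V ⟶ Y}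
    [IsOpenImmersion iV] [QuasiCompact f] (H : IsPullback f' iU iV f) :
    f.ker.comap iV = f'.ker := by
  apply Scheme.IdealSheafData.ext
  funext W
  rw [Scheme.ker_ideal_of_isPullback_of_isOpenImmersion f f' iU iV H,
    Scheme.IdealSheafData.ideal_comap_of_isOpenImmersion]

lemma comap_ker_comp {X U Y : Scheme.{0}} (p : X ⟶ U) (j : U ⟶ Y) [IsOpenImmersion j]
    [QuasiCompact (p ≫ j)] : (p ≫ j).ker.comap j = p.ker := by
  apply comap_ker (iU := 𝟙 X)
  refine ⟨⟨(Category.id_comp _).symm⟩, ⟨PullbackCone.IsLimit.mk _ (fun s => s.snd) (fun s => ?_)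
    (fun s => Category.comp_id _) fun s m _ h => ?_⟩⟩
  · rw [← cancel_mono j, Category.assoc]
    exact s.condition.symm
  · exact (Category.comp_id m).symm.trans h

lemma comap_ker_eq_top {X U Y : Scheme.{0}} (f : X ⟶ Y) (j : U ⟶ Y) [IsOpenImmersion j]
    [QuasiCompact f] (h : ∀ x y, f x ≠ j y) : f.ker.comap j = ⊤ := by
  rw [comap_ker (IsPullback.of_hasPullback j f)]
  have : IsEmpty (pullback j f : Scheme.{0}) := by
    refine ⟨fun z => h (pullback.snd j f z) (pullback.fst j f z) ?_⟩
    exact congrArg (fun g : pullback j f ⟶ Y => g z) pullback.condition.symm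
  exact Scheme.ker_eq_top_of_isEmpty _

lemma specIdeal_comap_ker {R Q : Type} [CommRing R] [CommRing Q] (φ : R →+* Q) {X : Scheme.{0}}
    (j : Spec (.of R) ⟶ X) [IsOpenImmersion j] (f : Spec (.of Q) ⟶ X) [QuasiCompact f]
    (h : Spec.map (CommRingCat.ofHom φ) ≫ j = f) : specIdeal (f.ker.comap j) = RingHom.ker φ := by
  subst h
  rw [comap_ker_comp, specIdeal_ker]

/-! ### The charts of the toric surface -/

instance (S : Fan) : IsOpenImmersion (toricι S) :=
  inferInstanceAs (IsOpenImmersion (colimit.ι toricDiagram S))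

lemma faceMap_toricι {S T : Fan} (h : S ≤ T) : faceMap h ≫ toricι T = toricι S :=
  colimit.w toricDiagram (homOfLE h)

lemma exists_toricι_eq (x : toricSurface) : ∃ (S : Fan) (y : affineToric S.1), toricι S y = x :=
  Scheme.IsLocallyDirected.ι_jointly_surjective toricDiagram x

lemma exists_of_toricι_eq {S T : Fan} {x : affineToric S.1} {y : affineToric T.1}
    (h : toricι S x = toricι T y) : ∃ (R : Fan) (hS : R ≤ S) (hT : R ≤ T) (z : affineToric R.1),
      faceMap hS z = x ∧ faceMap hT z = y := by
  obtain ⟨R, f, g, z, hx, hy⟩ := (Scheme.IsLocallyDirected.ι_eq_ι_iff toricDiagram).mp h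
  exact ⟨R, f.le, g.le, z, hx, hy⟩

lemma toricι_faceMap {S T : Fan} (h : S ≤ T) (x : affineToric S.1) :
    toricι T (faceMap h x) = toricι S x :=
  congrArg (fun f : affineToric S.1 ⟶ toricSurface => f x) (faceMap_toricι h)

lemma zeroCone_le (S : Fan) : zeroCone ≤ S := Finset.empty_subset _

lemma rayCone_le {i : Fin 3} {S : Fan} (h : i ∈ S.1) : rayCone i ≤ S :=
  Finset.singleton_subset_iff.mpr h

lemma rayV_notMem_iff {i : Fin 3} (x : affineToric {i}) :
    rayV i ∉ PrimeSpectrum.asIdeal x ↔ toricι (rayCone i) x ∈ Set.range (toricι zeroCone) := by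
  have e := mem_range_faceMap (zeroCone_le (rayCone i)) ⟨VV i, VV_mem i⟩
    (fun i hi => absurd hi (Finset.notMem_empty i))
    (fun j hj _ => by
      rw [Finset.mem_singleton.mp hj]
      change 0 < pair (VV i) (ray i)
      rw [(pair_VV i).1]
      exact one_pos) x
  refine e.symm.trans ⟨?_, ?_⟩
  · rintro ⟨y, rfl⟩
    exact ⟨y, (toricι_faceMap (zeroCone_le (rayCone i)) y).symm⟩
  · rintro ⟨y, hy⟩
    refine ⟨y, (toricι (rayCone i)).isOpenEmbedding.injective ?_⟩
    rw [← hy]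
    exact toricι_faceMap (zeroCone_le (rayCone i)) y

/-- A point in two charts lies in the open orbit if the cones meet trivially. -/
lemma mem_range_zeroCone {S T : Fan} {x : affineToric S.1} {y : affineToric T.1}
    (h : toricι S x = toricι T y) (hST : ∀ i ∈ S.1, i ∉ T.1) :
    toricι S x ∈ Set.range (toricι zeroCone) := by
  obtain ⟨R, hS, hT, z, rfl, -⟩ := exists_of_toricι_eq h
  have hR : R = zeroCone := Subtype.ext (Finset.eq_empty_of_forall_notMem fun i hi =>
    hST i (hS hi) (hT hi))
  subst hR
  exact ⟨z, (toricι_faceMap hS z).symm⟩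

/-! ### The centre -/

/-- The evaluation at the point `V_i = 0`, `Z_i = -1`. -/
def pointEval (i : Fin 3) : ToricRing {i} →+* ℂ := rayLift i (RingHom.id ℂ) 0 (-1)

/-- Modulo the ideal every function is congruent to its value at the point; thus `ℂ` surjects onto
the quotient, and values can replace functions. -/
lemma mk_pointIdeal_eq (i : Fin 3) :
    Ideal.Quotient.mk (pointIdeal i) =
      ((Ideal.Quotient.mk (pointIdeal i)).comp (toricC {i})).comp (pointEval i) := by
  apply rayRing_hom_ext
  · refine RingHom.ext fun c => ?_
    simp only [RingHom.comp_apply]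
    rw [pointEval, rayLift_toricC]
    rfl
  · simp only [RingHom.comp_apply]
    rw [pointEval, rayLift_rayV, map_zero, map_zero, Ideal.Quotient.eq_zero_iff_mem]
    exact Ideal.subset_span (by left; rfl)
  · simp only [RingHom.comp_apply]
    rw [pointEval, rayLift_rayZ, Units.val_neg, Units.val_one, map_neg, map_neg, map_one, map_one,
      eq_neg_iff_add_eq_zero, ← map_one (Ideal.Quotient.mk (pointIdeal i)), ← map_add,
      Ideal.Quotient.eq_zero_iff_mem]
    exact Ideal.subset_span (by right; rfl)

lemma isNoetherianRing_quotient_pointIdeal (i : Fin 3) :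
    IsNoetherianRing (ToricRing {i} ⧸ pointIdeal i) := by
  refine isNoetherianRing_of_surjective ℂ _ ((Ideal.Quotient.mk (pointIdeal i)).comp (toricC {i})) ?_
  intro x
  obtain ⟨y, rfl⟩ := Ideal.Quotient.mk_surjective x
  exact ⟨pointEval i y, (congrArg (fun f => f y) (mk_pointIdeal_eq i)).symm⟩

instance (i : Fin 3) : QuasiCompact (pointι i) := by
  have := isNoetherianRing_quotient_pointIdeal i
  infer_instance

/-- The affine toric chart as the spectrum of its coordinate ring. -/
def toricChart (S : Fan) : Spec (.of (ToricRing S.1)) ⟶ toricSurface := toricι S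

instance (S : Fan) : IsOpenImmersion (toricChart S) := inferInstanceAs (IsOpenImmersion (toricι S))

/-- The ideal of an ideal sheaf on an affine toric chart. -/
def toricIdeal (S : Fan) (I : toricSurface.IdealSheafData) : Ideal (ToricRing S.1) :=
  specIdeal (I.comap (toricChart S))

lemma toricIdeal_iInf (S : Fan) (I : Fin 3 → toricSurface.IdealSheafData) :
    toricIdeal S (⨅ i, I i) = ⨅ i, toricIdeal S (I i) :=
  (congrArg (specIdeal (S := ToricRing S.1)) (comap_iInf I (toricChart S))).trans
    (specIdeal_iInf fun i => (I i).comap (toricChart S))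

lemma mem_support_iff_toricIdeal_le {S : Fan} (I : toricSurface.IdealSheafData)
    (x : affineToric S.1) :
    toricι S x ∈ I.support ↔ toricIdeal S I ≤ PrimeSpectrum.asIdeal x := by
  refine Iff.trans ?_ (mem_support_iff_specIdeal_le (S := ToricRing S.1) _ x)
  exact (congrArg (x ∈ ·) (Scheme.IdealSheafData.support_comap I (toricChart S))).symm.to_iff

lemma toricIdeal_ker_pointι_of_mem {i : Fin 3} {S : Fan} (h : i ∈ S.1) :
    toricIdeal S (pointι i).ker =
      (pointIdeal i).comap (toricRes (Finset.singleton_subset_iff.mpr h)) := by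
  let r : ToricRing S.1 →+* ToricRing {i} := toricRes (Finset.singleton_subset_iff.mpr h)
  refine (specIdeal_comap_ker ((Ideal.Quotient.mk (pointIdeal i)).comp r) (toricChart S) (pointι i) ?_).trans ?_
  · refine (congrArg (· ≫ toricι S) (Spec.map_comp (CommRingCat.ofHom r)
      (CommRingCat.ofHom (Ideal.Quotient.mk (pointIdeal i))))).trans ((Category.assoc _ _ _).trans ?_)
    exact congrArg (Spec.map (CommRingCat.ofHom (Ideal.Quotient.mk (pointIdeal i))) ≫ ·)
      (faceMap_toricι (rayCone_le h))
  · rw [← RingHom.comap_ker, Ideal.mk_ker]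

lemma pointIdeal_le_asIdeal {i : Fin 3} (w : Spec (.of (ToricRing {i} ⧸ pointIdeal i))) :
    pointIdeal i ≤ PrimeSpectrum.asIdeal
      (Spec.map (CommRingCat.ofHom (Ideal.Quotient.mk (pointIdeal i))) w) := by
  intro f hf
  change Ideal.Quotient.mk (pointIdeal i) f ∈ PrimeSpectrum.asIdeal w
  rw [Ideal.Quotient.eq_zero_iff_mem.mpr hf]
  exact zero_mem _

/-- A point of the chart of ray `i` that also lies in the chart of a cone without that ray is in the
open orbit, where `V_i ≠ 0`. The `i`-th centre point has `V_i = 0`. -/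
lemma toricIdeal_ker_pointι_of_notMem {i : Fin 3} {S : Fan} (h : i ∉ S.1) :
    toricIdeal S (pointι i).ker = ⊤ := by
  refine congrArg (specIdeal (S := ToricRing S.1)) (comap_ker_eq_top _ (toricChart S) fun w y hwy => ?_)
  let x : affineToric {i} := Spec.map (CommRingCat.ofHom (Ideal.Quotient.mk (pointIdeal i))) w
  have hx : toricι (rayCone i) x = toricι S y := hwy
  refine (rayV_notMem_iff x).mpr (mem_range_zeroCone hx fun j hj => ?_)
    (pointIdeal_le_asIdeal w (Ideal.subset_span (by left; rfl)))
  rw [Finset.mem_singleton.mp hj]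
  exact h

lemma toricIdeal_centre (S : Fan) :
    toricIdeal S centre = ⨅ i, toricIdeal S (pointι i).ker :=
  toricIdeal_iInf S _

lemma toricIdeal_rayCone_centre (i : Fin 3) : toricIdeal (rayCone i) centre = pointIdeal i := by
  have hi : toricIdeal (rayCone i) (pointι i).ker = pointIdeal i := by
    refine (toricIdeal_ker_pointι_of_mem (S := rayCone i) (Finset.mem_singleton_self i)).trans ?_
    have : toricRes (Finset.Subset.refl {i}) = RingHom.id _ :=
      AddMonoidAlgebra.mapDomainRingHom_id
    exact (congrArg (fun f => Ideal.comap f (pointIdeal i)) this).trans (Ideal.comap_id _)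
  rw [toricIdeal_centre]
  refine le_antisymm ((iInf_le _ i).trans hi.le) (le_iInf fun k => ?_)
  by_cases hk : k = i
  · subst hk
    exact hi.ge
  · exact le_top.trans (toricIdeal_ker_pointι_of_notMem (S := rayCone i)
      fun h => hk (Finset.mem_singleton.mp h)).ge

/-- The centre lies in the union of the affine toric charts of the rays. -/
lemma exists_rayCone_of_mem_support {x : toricSurface} (h : x ∈ centre.support) :
    ∃ i, x ∈ Set.range (toricι (rayCone i)) := by
  obtain ⟨S, x, rfl⟩ := exists_toricι_eq x
  rw [mem_support_iff_toricIdeal_le, toricIdeal_centre, ← Finset.inf_univ_eq_iInf] at h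
  obtain ⟨i, -, hi⟩ := (Ideal.IsPrime.inf_le' (PrimeSpectrum.isPrime x)).mp h
  have hS : i ∈ S.1 := by
    by_contra hS
    rw [toricIdeal_ker_pointι_of_notMem hS] at hi
    exact (PrimeSpectrum.isPrime x).ne_top (top_le_iff.mp hi)
  obtain ⟨m, h₀, h₁⟩ := exists_face (Finset.singleton_subset_iff.mpr hS) S.2
  refine ⟨i, ?_⟩
  let r : ToricRing S.1 →+* ToricRing {i} := toricRes (Finset.singleton_subset_iff.mpr hS)
  let u : ToricRing S.1 := AddMonoidAlgebra.single m 1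
  -- The character cutting out the face is trivial on ray `i`, so its value `c` at the `i`-th point
  -- is nonzero. It is congruent to `c` modulo the ideal of that point, so it cannot vanish at `x`.
  have hu : u ∉ PrimeSpectrum.asIdeal x := by
    intro hu
    let c : ℂ := pointEval i (r u)
    have hc : c ≠ 0 := by
      have e : r u = AddMonoidAlgebra.single (AddSubmonoid.inclusion
          (dualCone_anti (Finset.singleton_subset_iff.mpr hS)) m) 1 := by
        simp [r, u, toricRes]
      change pointEval i (r u) ≠ 0
      rw [e, pointEval, rayLift_single]
      have : pair (m : ℤ × ℤ) (ray i) = 0 := h₀ i (Finset.mem_singleton_self i)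
      change _ * ((0 : ℂ) ^ (pair (m : ℤ × ℤ) (ray i)).toNat * _) ≠ 0
      rw [this]
      simp only [map_one, Int.toNat_zero, pow_zero, one_mul]
      exact Units.ne_zero _
    have hmem : u - toricC S.1 c ∈ PrimeSpectrum.asIdeal x := by
      apply hi
      rw [toricIdeal_ker_pointι_of_mem hS, Ideal.mem_comap]
      change r (u - toricC S.1 c) ∈ pointIdeal i
      have e : r (toricC S.1 c) = toricC {i} c := by
        simp [r, toricC, toricRes]
      rw [map_sub, e, ← Ideal.Quotient.eq_zero_iff_mem, map_sub, sub_eq_zero]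
      exact congrArg (fun f => f (r u)) (mk_pointIdeal_eq i)
    have hcmem : toricC S.1 c ∈ PrimeSpectrum.asIdeal x := by
      have := sub_mem hu hmem
      rwa [sub_sub_cancel] at this
    refine (PrimeSpectrum.isPrime x).ne_top (Ideal.eq_top_of_isUnit_mem _ hcmem ?_)
    exact (isUnit_iff_ne_zero.mpr hc).map (toricC S.1)
  obtain ⟨y, hy⟩ := (mem_range_faceMap (Finset.singleton_subset_iff.mpr hS) m h₀ h₁ x).mpr hu
  refine ⟨y, ?_⟩
  rw [← hy]
  exact (toricι_faceMap (rayCone_le hS) y).symm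

/-! ### The generic points of the toric divisors -/

/-- The restriction of functions to the divisor `V_i = 0`. -/
def divisorHom (i : Fin 3) : ToricRing {i} →+* ToricRing {i} := rayLift i (toricC {i}) 0 (rayZ i)

/-- The generic point of the toric divisor in the affine toric chart of its ray. -/
def genericPoint (i : Fin 3) : PrimeSpectrum (ToricRing {i}) :=
  ⟨RingHom.ker (divisorHom i), RingHom.ker_isPrime _⟩

lemma rayV_mem_genericPoint (i : Fin 3) : rayV i ∈ (genericPoint i).asIdeal := rayLift_rayV _ _ _ _

lemma rayZ_add_one_notMem_genericPoint (i : Fin 3) :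
    (rayZ i : ToricRing {i}) + 1 ∉ (genericPoint i).asIdeal := by
  intro h
  have h' : divisorHom i ((rayZ i : ToricRing {i}) + 1) = 0 := h
  rw [divisorHom, map_add, rayLift_rayZ, map_one] at h'
  exact rayZ_add_one_ne_zero i h'

lemma mk_comp_divisorHom (i : Fin 3) : (Ideal.Quotient.mk (Ideal.span {rayV i})).comp (divisorHom i) =
    Ideal.Quotient.mk (Ideal.span {rayV i}) := by
  apply rayRing_hom_ext
  · refine RingHom.ext fun c => ?_
    simp only [RingHom.comp_apply]
    rw [divisorHom, rayLift_toricC]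
  · simp only [RingHom.comp_apply]
    rw [divisorHom, rayLift_rayV, map_zero]
    exact (Ideal.Quotient.eq_zero_iff_mem.mpr (Ideal.mem_span_singleton_self _)).symm
  · simp only [RingHom.comp_apply]
    rw [divisorHom, rayLift_rayZ]

/-- `divisorHom` is the identity modulo `V_i`, so its kernel is contained in `(V_i)`. -/
lemma genericPoint_le {i : Fin 3} {x : PrimeSpectrum (ToricRing {i})} (h : rayV i ∈ x.asIdeal) :
    genericPoint i ≤ x := by
  intro f hf
  have hf' : divisorHom i f = 0 := hf
  have e := congrArg (fun g => g f) (mk_comp_divisorHom i)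
  simp only [RingHom.comp_apply, hf', map_zero] at e
  obtain ⟨g, rfl⟩ := Ideal.mem_span_singleton'.mp (Ideal.Quotient.eq_zero_iff_mem.mp e.symm)
  exact Ideal.mul_mem_left _ _ h

lemma divisorHom_single_of_pos {i : Fin 3} {m : dualCone {i}} (h : 0 < pair m (ray i)) (c : ℂ) :
    divisorHom i (AddMonoidAlgebra.single m c) = 0 := by
  rw [divisorHom, rayLift_single, zero_pow (by omega), zero_mul, mul_zero]

lemma divisorHom_single_of_eq_zero {i : Fin 3} {m : dualCone {i}} (h : pair m (ray i) = 0) (c : ℂ) :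
    divisorHom i (AddMonoidAlgebra.single m c) = AddMonoidAlgebra.single m c := by
  have e := single_eq_rayV_mul_rayZ m
  rw [h, Int.toNat_zero, pow_zero, one_mul] at e
  rw [divisorHom, rayLift_single, h, Int.toNat_zero, pow_zero, one_mul, ← e]
  change AddMonoidAlgebra.single 0 c * _ = _
  rw [AddMonoidAlgebra.single_mul_single, zero_add, mul_one]

lemma toricRes_single {S T : Finset (Fin 3)} (h : S ⊆ T) (m : dualCone T) (c : ℂ) :
    toricRes h (AddMonoidAlgebra.single m c) =
      AddMonoidAlgebra.single (AddSubmonoid.inclusion (dualCone_anti h) m) c := by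
  simp [toricRes]

lemma toricRes_injective {S T : Finset (Fin 3)} (h : S ⊆ T) : Function.Injective (toricRes h) :=
  AddMonoidAlgebra.mapDomain_injective (AddSubmonoid.inclusion_injective _)

/-- A point of an affine toric chart at which the characters which are positive on the `i`-th ray
vanish is a specialization of the generic point of the toric divisor. -/
lemma faceMap_genericPoint_le {i : Fin 3} {S : Finset (Fin 3)} (h : {i} ⊆ S)
    {x : PrimeSpectrum (ToricRing S)}
    (hx : ∀ m : dualCone S, 0 < pair m (ray i) → AddMonoidAlgebra.single m 1 ∈ x.asIdeal) :
    (genericPoint i).asIdeal.comap (toricRes h) ≤ x.asIdeal := by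
  -- `g` keeps the terms of `f` that are trivial on ray `i`. The others vanish at `x` and are killed
  -- by `divisorHom`.
  have key : ∀ f : ToricRing S, ∃ g : ToricRing S,
      f - g ∈ x.asIdeal ∧ divisorHom i (toricRes h f) = toricRes h g := by
    intro f
    induction f using AddMonoidAlgebra.induction_linear with
    | zero => exact ⟨0, by simp⟩
    | add f f' hf hf' =>
      obtain ⟨g, hg, e⟩ := hf
      obtain ⟨g', hg', e'⟩ := hf'
      refine ⟨g + g', ?_, by rw [map_add, map_add, map_add, e, e']⟩
      have := add_mem hg hg'
      rwa [← add_sub_add_comm] at this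
    | single m c =>
      rcases (m.2 i (h (Finset.mem_singleton_self i))).lt_or_eq with hm | hm
      · refine ⟨0, ?_, ?_⟩
        · have e : (AddMonoidAlgebra.single m c : ToricRing S) =
              AddMonoidAlgebra.single 0 c * AddMonoidAlgebra.single m 1 := by
            rw [AddMonoidAlgebra.single_mul_single, zero_add, mul_one]
          rw [sub_zero, e]
          exact Ideal.mul_mem_left _ _ (hx m hm)
        · rw [toricRes_single, map_zero]
          exact divisorHom_single_of_pos
            (m := AddSubmonoid.inclusion (dualCone_anti h) m) hm c
      · refine ⟨AddMonoidAlgebra.single m c, by simp, ?_⟩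
        rw [toricRes_single]
        exact divisorHom_single_of_eq_zero
          (m := AddSubmonoid.inclusion (dualCone_anti h) m) hm.symm c
  intro f hf
  obtain ⟨g, hg, e⟩ := key f
  have hf' : divisorHom i (toricRes h f) = 0 := hf
  rw [hf'] at e
  have hg0 : g = 0 := toricRes_injective h (by rw [← e, map_zero])
  rwa [hg0, sub_zero] at hg

lemma genericPoint_mem (i : Fin 3) :
    toricChart (rayCone i) (genericPoint i) ∈
      Set.range (toricι (rayCone i)) \ Set.range (toricι zeroCone) :=
  ⟨⟨genericPoint i, rfl⟩, fun h => (rayV_notMem_iff (genericPoint i)).mpr h (rayV_mem_genericPoint i)⟩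

/-- Every point outside of the affine toric charts of the rays lies on a toric divisor. -/
lemma exists_mem_toricDivisor {x : toricSurface}
    (hx : ∀ i, x ∉ Set.range (toricι (rayCone i))) : ∃ i, x ∈ toricDivisor i := by
  obtain ⟨S, x, rfl⟩ := exists_toricι_eq x
  have hne : S.1.Nonempty := by
    by_contra hS
    have : S = zeroCone := Subtype.ext (Finset.not_nonempty_iff_eq_empty.mp hS)
    subst this
    exact hx 0 ⟨_, toricι_faceMap (zeroCone_le (rayCone 0)) x⟩
  obtain ⟨i, hi⟩ := hne
  obtain ⟨k, hk, hik⟩ : ∃ k ∈ S.1, k ≠ i := by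
    by_contra! hS
    have : S = rayCone i := Subtype.ext (Finset.eq_singleton_iff_unique_mem.mpr ⟨hi, hS⟩)
    subst this
    exact hx i ⟨x, rfl⟩
  obtain ⟨n, h₀, h₁⟩ := exists_face (Finset.singleton_subset_iff.mpr hk) S.2
  have hn : (AddMonoidAlgebra.single n 1 : ToricRing S.1) ∈ PrimeSpectrum.asIdeal x := by
    by_contra hn
    obtain ⟨y, hy⟩ := (mem_range_faceMap (Finset.singleton_subset_iff.mpr hk) n h₀ h₁ x).mpr hn
    refine hx k ⟨y, ?_⟩
    rw [← hy]
    exact (toricι_faceMap (rayCone_le hk) y).symm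
  -- Cones of the fan have at most two rays.
  have hS : ∀ l ∈ S.1, l = i ∨ l = k := by
    intro l hl
    by_contra! h
    refine S.2 (Finset.eq_univ_of_forall fun j => ?_)
    have : ∀ i k l j : Fin 3, k ≠ i → l ≠ i → l ≠ k → j = i ∨ j = k ∨ j = l := by decide
    rcases this i k l j hik h.1 h.2 with rfl | rfl | rfl <;> assumption
  have hpos : ∀ m : dualCone S.1, 0 < pair m (ray i) →
      (AddMonoidAlgebra.single m 1 : ToricRing S.1) ∈ PrimeSpectrum.asIdeal x := by
    intro m hm
    -- A character `m` positive on ray `i` pairs with it to at least `1`, so `N m - n` lies in the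
    -- dual cone. Hence `n`, which vanishes at `x`, divides the `N`-th power of `m`.
    let N := (pair n (ray i)).toNat
    have hmem : -(n : ℤ × ℤ) + N • (m : ℤ × ℤ) ∈ dualCone S.1 := by
      intro l hl
      rw [pair_add_smul]
      have e : pair (-(n : ℤ × ℤ)) (ray l) = - pair n (ray l) := by simp [pair]; ring
      rw [e]
      rcases hS l hl with rfl | rfl
      · have : pair n (ray l) ≤ N := Int.self_le_toNat _
        nlinarith
      · rw [h₀ l (Finset.mem_singleton_self l), neg_zero, zero_add]
        exact mul_nonneg (Int.natCast_nonneg _) (m.2 l hl)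
    have e : (AddMonoidAlgebra.single m 1 : ToricRing S.1) ^ N =
        AddMonoidAlgebra.single ⟨_, hmem⟩ 1 * AddMonoidAlgebra.single n 1 := by
      rw [AddMonoidAlgebra.single_pow, AddMonoidAlgebra.single_mul_single, one_pow, mul_one]
      refine congrArg (fun m : dualCone S.1 => (AddMonoidAlgebra.single m 1 : ToricRing S.1))
        (Subtype.ext ?_)
      change N • (m : ℤ × ℤ) = (-(n : ℤ × ℤ) + N • (m : ℤ × ℤ)) + (n : ℤ × ℤ)
      rw [add_comm, add_neg_cancel_left]
    refine (PrimeSpectrum.isPrime x).mem_of_pow_mem N ?_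
    rw [e]
    exact Ideal.mul_mem_left _ _ hn
  have hle := faceMap_genericPoint_le (Finset.singleton_subset_iff.mpr hi) hpos
  have hsp : faceMap (Finset.singleton_subset_iff.mpr hi) (genericPoint i) ⤳ x :=
    (PrimeSpectrum.le_iff_specializes _ _).mp hle
  refine ⟨i, (hsp.map (toricι S).continuous).mem_closed isClosed_closure (subset_closure ?_)⟩
  have := genericPoint_mem i
  exact (toricι_faceMap (rayCone_le hi) (genericPoint i)).symm ▸ this

/-! ### The blowing up of the toric surface -/

lemma IsBlowup.exists_charts {R A E : Type} [CommRing R] [CommRing A] [CommRing E] {ρ : R →+* A}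
    {σ : R →+* E} {t : A} {s : E} {Y B B' : Scheme.{0}} {I : Y.IdealSheafData} {π : B ⟶ Y}
    (h : IsBlowup π I) (c : Spec (.of R) ⟶ Y) [IsOpenImmersion c] {π' : B' ⟶ Spec (.of R)}
    {j : Spec (.of A) ⟶ B'} {k : Spec (.of E) ⟶ B'} (hg : IsBlowupGluing π' ρ σ t s j k)
    (hB : IsBlowup π' (I.comap c)) :
    ∃ (j : Spec (.of A) ⟶ B) (k : Spec (.of E) ⟶ B), IsOpenImmersion j ∧
      j ≫ π = Spec.map (CommRingCat.ofHom ρ) ≫ c ∧ k ≫ π = Spec.map (CommRingCat.ofHom σ) ≫ c ∧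
      ∀ y, π y ∈ Set.range c → y ∈ Set.range j ∨
        ∃ x : Spec (.of E), s ∈ PrimeSpectrum.asIdeal x ∧ k x = y := by
  obtain ⟨m, hm, -⟩ := h.existsUnique_lift (π' ≫ c) (by
    rw [Scheme.IdealSheafData.comap_comp]
    exact hB.isInvertible)
  have sq := h.isPullback hB m hm
  have : IsOpenImmersion m := MorphismProperty.of_isPullback sq.flip inferInstance
  have := hg.left_isOpenImmersion
  refine ⟨j ≫ m, k ≫ m, inferInstance, ?_, ?_, ?_⟩
  · rw [Category.assoc, hm, ← Category.assoc, hg.left_comp]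
  · rw [Category.assoc, hm, ← Category.assoc, hg.right_comp]
  · rintro y ⟨x, hx⟩
    obtain ⟨z, hz, -⟩ := Scheme.exists_preimage_of_isPullback sq y x hx.symm
    subst hz
    rcases hg.mem_range z with ⟨w, rfl⟩ | ⟨w, rfl⟩
    · exact .inl ⟨w, rfl⟩
    · by_cases hw : s ∈ PrimeSpectrum.asIdeal w
      · exact .inr ⟨w, hw, rfl⟩
      · obtain ⟨w', hw'⟩ := hg.right_mem w hw
        exact .inl ⟨w', congrArg m hw'⟩

/-- The affine toric chart of a ray. -/
def rayChart (i : Fin 3) : Spec (.of (ToricRing {i})) ⟶ toricSurface := toricι (rayCone i)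

instance (i : Fin 3) : IsOpenImmersion (rayChart i) :=
  inferInstanceAs (IsOpenImmersion (toricι (rayCone i)))

lemma specIdeal_comap_rayChart (i : Fin 3) : specIdeal (centre.comap (rayChart i)) =
    Ideal.span {rayV i, (rayZ i : ToricRing {i}) + 1} :=
  toricIdeal_rayCone_centre i


/-- The chart of the glued space over the affine toric chart of a ray. -/
def chartToToric (i : Fin 3) : chart ⟶ toricSurface :=
  Spec.map (CommRingCat.ofHom (chartHom i)) ≫ rayChart i

lemma torusToChart_chartToToric (i : Fin 3) : torusToChart i ≫ chartToToric i = toricTorusι := by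
  refine (Category.assoc _ _ _).symm.trans ?_
  have e₁ : torusToChart i ≫ Spec.map (CommRingCat.ofHom (chartHom i)) =
      Spec.map (CommRingCat.ofHom (toTorus {i})) :=
    (specMap_comp _ _).symm.trans
      (congrArg (fun f => Spec.map (CommRingCat.ofHom f)) (transition_comp_chartHom i))
  have e₂ : (toTorus ∅).comp (toricRes (Finset.empty_subset {i})) = toTorus {i} :=
    (AddMonoidAlgebra.mapDomainRingHom_comp _ _).symm
  refine (congrArg (· ≫ rayChart i) (e₁.trans ((congrArg
    (fun f => Spec.map (CommRingCat.ofHom f)) e₂.symm).trans (specMap_comp _ _)))).trans ?_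
  refine (Category.assoc _ _ _).trans ?_
  exact congrArg (Spec.map (CommRingCat.ofHom (toTorus ∅)) ≫ ·)
    (faceMap_toricι (zeroCone_le (rayCone i)))

/-- The projection of the glued space to the toric surface. -/
def gluedToToric : gluedSpace ⟶ toricSurface :=
  gluedDesc toricTorusι chartToToric torusToChart_chartToToric

lemma chartι_gluedToToric (i : Fin 3) : chartι i ≫ gluedToToric = chartToToric i :=
  chartι_gluedDesc _ _ _ i

lemma torusι_gluedToToric : torusι ≫ gluedToToric = toricTorusι := torusι_gluedDesc _ _ _

lemma chartι_gluedToToric_apply (i : Fin 3) (x : chart) :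
    gluedToToric (chartι i x) = chartToToric i x :=
  congrArg (fun f : chart ⟶ toricSurface => f x) (chartι_gluedToToric i)

lemma isInvertible_comap_chartToToric (i : Fin 3) : IsInvertible (centre.comap (chartToToric i)) := by
  have := (isBlowupChart_chartHom i).isInvertible (specIdeal_comap_rayChart i)
  rwa [← Scheme.IdealSheafData.comap_comp] at this

lemma isInvertible_comap_gluedToToric : IsInvertible (centre.comap gluedToToric) := by
  refine isInvertible_of_cover fun x => ?_
  obtain ⟨i, y, rfl⟩ := exists_chartι_eq x
  refine ⟨chart, chartι i, inferInstance, ⟨y, rfl⟩, ?_⟩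
  rw [← Scheme.IdealSheafData.comap_comp, chartι_gluedToToric]
  exact isInvertible_comap_chartToToric i

lemma exists_rayBlowup (i : Fin 3) : ∃ (B : Scheme.{0}) (π : B ⟶ Spec (.of (ToricRing {i})))
    (j : Spec (.of ChartRing) ⟶ B) (k : Spec (.of (ToricRing {i})) ⟶ B),
      IsBlowupGluing π (chartHom i) (otherHom i) uu (rayV i) j k ∧
        IsBlowup π (centre.comap (rayChart i)) := by
  obtain ⟨B, π, j, k, h⟩ := exists_isBlowupGluing (isBlowupChart_chartHom i) (isBlowupChart_otherHom i)
  exact ⟨B, π, j, k, h, h.isBlowup (isBlowupChart_chartHom i) (isBlowupChart_otherHom i)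
    (specIdeal_comap_rayChart i)⟩

/-- In the ray charts the two-chart construction applies; elsewhere the centre is empty and the
identity is a blowing up. -/
lemma hasBlowup_centre : HasBlowup centre := by
  refine hasBlowup_of_local fun y => ?_
  by_cases hy : ∃ i, y ∈ Set.range (toricι (rayCone i))
  · obtain ⟨i, hi⟩ := hy
    obtain ⟨B, π, -, -, -, h⟩ := exists_rayBlowup i
    exact ⟨_, rayChart i, inferInstance, hi, B, π, h⟩
  · let U : toricSurface.Opens := ⟨(centre.support : Set toricSurface)ᶜ, centre.support.isClosed.isOpen_compl⟩
    have hU : y ∈ U := fun h => hy (exists_rayCone_of_mem_support h)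
    refine ⟨U.toScheme, U.ι, inferInstance, ?_, U.toScheme, 𝟙 _, ?_⟩
    · rw [Scheme.Opens.range_ι]
      exact hU
    · have e : centre.comap U.ι = ⊤ := by
        rw [← Scheme.IdealSheafData.support_eq_bot_iff, Scheme.IdealSheafData.support_comap]
        apply SetLike.coe_injective
        refine Set.eq_empty_of_forall_notMem fun z hz => ?_
        exact z.2 hz
      rw [e]
      exact isBlowup_id _

section

variable {B : Scheme.{0}} {π : B ⟶ toricSurface}

lemma IsBlowup.exists_rayCharts (h : IsBlowup π centre) (i : Fin 3) :
    ∃ (j : chart ⟶ B) (k : Spec (.of (ToricRing {i})) ⟶ B), IsOpenImmersion j ∧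
      j ≫ π = chartToToric i ∧
      k ≫ π = Spec.map (CommRingCat.ofHom (otherHom i)) ≫ rayChart i ∧
      ∀ y, π y ∈ Set.range (rayChart i) → y ∈ Set.range j ∨
        ∃ x : Spec (.of (ToricRing {i})), rayV i ∈ PrimeSpectrum.asIdeal x ∧ k x = y := by
  obtain ⟨B', π', j, k, hg, hB⟩ := exists_rayBlowup i
  exact h.exists_charts (rayChart i) hg hB

/-- The morphism from the glued space to the blowing up. -/
def IsBlowup.gluedLift (h : IsBlowup π centre) : gluedSpace ⟶ B :=
  (h.existsUnique_lift gluedToToric isInvertible_comap_gluedToToric).choose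

lemma IsBlowup.gluedLift_comp (h : IsBlowup π centre) : h.gluedLift ≫ π = gluedToToric :=
  (h.existsUnique_lift gluedToToric isInvertible_comap_gluedToToric).choose_spec.1

lemma IsBlowup.chartι_gluedLift (h : IsBlowup π centre) {i : Fin 3} {j : chart ⟶ B}
    (hj : j ≫ π = chartToToric i) : chartι i ≫ h.gluedLift = j :=
  (h.existsUnique_lift _ (isInvertible_comap_chartToToric i)).unique
    (by rw [Category.assoc, h.gluedLift_comp, chartι_gluedToToric]) hj

lemma IsBlowup.isOpenImmersion_chartι_gluedLift (h : IsBlowup π centre) (i : Fin 3) :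
    IsOpenImmersion (chartι i ≫ h.gluedLift) := by
  obtain ⟨j, k, hj, e, -⟩ := h.exists_rayCharts i
  rw [h.chartι_gluedLift e]
  exact hj

lemma rayV_mem_iff_vv_mem (i : Fin 3) (x : chart) :
    rayChart i (Spec.map (CommRingCat.ofHom (chartHom i)) x) ∈
      Set.range (toricι zeroCone) ↔ vv ∉ PrimeSpectrum.asIdeal x := by
  refine (rayV_notMem_iff (i := i) (Spec.map (CommRingCat.ofHom (chartHom i)) x)).symm.trans ?_
  refine not_congr ?_
  change chartHom i (rayV i) ∈ PrimeSpectrum.asIdeal x ↔ _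
  rw [chartHom, rayLift_rayV]

/-- On one chart the lift is an open immersion. Points of two charts with the same image lie over
two different ray charts, hence over the open orbit; the first then comes from the torus and can be
moved to the second chart. -/
lemma IsBlowup.gluedLift_injective (h : IsBlowup π centre) : Function.Injective h.gluedLift := by
  have hinj : ∀ i, Function.Injective (chartι i ≫ h.gluedLift) := fun i =>
    have := h.isOpenImmersion_chartι_gluedLift i
    (chartι i ≫ h.gluedLift).isOpenEmbedding.injective
  intro x y hxy
  obtain ⟨i, a, rfl⟩ := exists_chartι_eq x
  obtain ⟨k, b, rfl⟩ := exists_chartι_eq y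
  by_cases hik : i = k
  · subst hik
    exact congrArg (chartι i) (hinj i hxy)
  have hq : gluedToToric (chartι i a) = gluedToToric (chartι k b) := by
    rw [← h.gluedLift_comp]
    exact congrArg π hxy
  rw [chartι_gluedToToric_apply, chartι_gluedToToric_apply] at hq
  have ha : a ∈ Set.range (torusToChart i) := by
    rw [mem_range_torusToChart, ← rayV_mem_iff_vv_mem]
    refine mem_range_zeroCone (T := rayCone k)
      (y := Spec.map (CommRingCat.ofHom (chartHom k)) b) hq fun l hl hl' => ?_
    exact hik ((Finset.mem_singleton.mp hl).symm.trans (Finset.mem_singleton.mp hl'))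
  obtain ⟨t, rfl⟩ := ha
  have e : chartι i (torusToChart i t) = chartι k (torusToChart k t) :=
    congrArg (fun f : torus ⟶ gluedSpace => f t)
      ((torusToChart_chartι i).trans (torusToChart_chartι k).symm)
  rw [e] at hxy ⊢
  exact congrArg (chartι k) (hinj k hxy)

lemma IsBlowup.isOpenImmersion_gluedLift (h : IsBlowup π centre) : IsOpenImmersion h.gluedLift :=
  .of_openCover_source _ chartCover h.gluedLift_injective h.isOpenImmersion_chartι_gluedLift

/-- On an axis both `V` and `Z + 1 = V u` vanish, so the image is a point of the centre. The rest of
the glued space maps to the open orbit, which is open and misses the divisors. -/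
lemma mem_support_of_mem_toricDivisor {x : gluedSpace} {i : Fin 3}
    (hx : gluedToToric x ∈ toricDivisor i) : gluedToToric x ∈ centre.support := by
  obtain ⟨k, a, rfl⟩ := exists_chartι_eq x
  rw [chartι_gluedToToric_apply] at hx ⊢
  by_cases ha : vv ∈ PrimeSpectrum.asIdeal a
  · refine (mem_support_iff_toricIdeal_le (S := rayCone k) centre
      (Spec.map (CommRingCat.ofHom (chartHom k)) a)).mpr ?_
    refine (toricIdeal_rayCone_centre k).le.trans (Ideal.span_le.mpr ?_)
    rintro _ (rfl | rfl)
    · change chartHom k (rayV k) ∈ PrimeSpectrum.asIdeal a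
      rwa [chartHom, rayLift_rayV]
    · change chartHom k ((rayZ k : ToricRing {k}) + 1) ∈ PrimeSpectrum.asIdeal a
      rw [(isBlowupChart_chartHom k).map_eq, chartHom, rayLift_rayV]
      exact Ideal.mul_mem_right _ _ ha
  · obtain ⟨z, hz, -, hz'⟩ := mem_closure_iff.mp hx _ (toricι zeroCone).isOpenEmbedding.isOpen_range
      ((rayV_mem_iff_vv_mem k a).mpr ha)
    exact absurd hz hz'

lemma specializes_of_le {R : Type} [CommRing R] {x y : Spec (.of R)}
    (h : PrimeSpectrum.asIdeal x ≤ PrimeSpectrum.asIdeal y) : x ⤳ y :=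
  (PrimeSpectrum.le_iff_specializes x y).mp h

lemma otherHom_rayV_mem_genericPoint (i : Fin 3) :
    otherHom i (rayV i) ∈ (genericPoint i).asIdeal := by
  have e : otherHom i (rayV i) = ((rayZ i : ToricRing {i}) + 1) * rayV i := rayLift_rayV _ _ _ _
  have e' : divisorHom i (rayV i) = 0 := rayLift_rayV _ _ _ _
  change divisorHom i (otherHom i (rayV i)) = 0
  rw [e, map_mul, e', mul_zero]

lemma otherHom_rayZ_add_one_notMem_genericPoint (i : Fin 3) :
    otherHom i ((rayZ i : ToricRing {i}) + 1) ∉ (genericPoint i).asIdeal := by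
  have e : otherHom i (rayZ i) = rayZ i := rayLift_rayZ _ _ _ _
  rw [map_add, map_one, e]
  exact rayZ_add_one_notMem_genericPoint i

lemma mem_asIdeal_specMap {R S : Type} [CommRing R] [CommRing S] (φ : R →+* S) (x : Spec (.of S))
    (r : R) : r ∈ PrimeSpectrum.asIdeal (Spec.map (CommRingCat.ofHom φ) x) ↔
      φ r ∈ PrimeSpectrum.asIdeal x := Iff.rfl

/-- The image of the generic point lies on the toric divisor, outside of the centre. -/
lemma rayChart_genericPoint_mem {i : Fin 3} {z : Spec (.of (ToricRing {i}))}
    (hV : rayV i ∈ PrimeSpectrum.asIdeal z)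
    (hZ : (rayZ i : ToricRing {i}) + 1 ∉ PrimeSpectrum.asIdeal z) :
    rayChart i z ∈ toricDivisor i \ centre.support := by
  refine ⟨subset_closure ⟨⟨z, rfl⟩, fun h => (rayV_notMem_iff z).mpr h hV⟩, fun hs => hZ ?_⟩
  have hs' := (mem_support_iff_toricIdeal_le (S := rayCone i) centre z).mp hs
  exact hs' ((toricIdeal_rayCone_centre i).ge (Ideal.subset_span (by right; rfl)))

/-- The generic point of `V' = 0` maps into the divisor but off the centre, because `Z + 1` does not
vanish there; its specializations lie in the closure. -/
lemma mem_strictTransform {i : Fin 3} {k : Spec (.of (ToricRing {i})) ⟶ B}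
    (hk : k ≫ π = Spec.map (CommRingCat.ofHom (otherHom i)) ≫ rayChart i)
    {x : Spec (.of (ToricRing {i}))} (hx : rayV i ∈ PrimeSpectrum.asIdeal x) :
    k x ∈ strictTransform π centre (toricDivisor i) := by
  let g : Spec (.of (ToricRing {i})) := genericPoint i
  have hsp : k g ⤳ k x := (specializes_of_le (x := g) (genericPoint_le hx)).map k.continuous
  refine hsp.mem_closed isClosed_closure (subset_closure ?_)
  have e : π (k g) = rayChart i (Spec.map (CommRingCat.ofHom (otherHom i)) g) :=
    congrArg (fun f : Spec (.of (ToricRing {i})) ⟶ toricSurface => f g) hk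
  rw [Set.mem_preimage, e]
  exact rayChart_genericPoint_mem
    ((mem_asIdeal_specMap (otherHom i) g _).mpr (otherHom_rayV_mem_genericPoint i))
    fun h => otherHom_rayZ_add_one_notMem_genericPoint i ((mem_asIdeal_specMap (otherHom i) g _).mp h)

/-- The image is open, so meeting a strict transform would mean meeting the divisor off the centre,
which is impossible. Conversely, over a ray chart the points missed lie on `V' = 0`. A point over
none of the ray charts lies over a divisor and off the centre, hence on a strict transform. -/
lemma IsBlowup.range_gluedLift (h : IsBlowup π centre) :
    Set.range h.gluedLift = (strictComplement π : Set B) := by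
  have := h.isOpenImmersion_gluedLift
  apply Set.Subset.antisymm
  · intro y hy hy'
    obtain ⟨i, hi⟩ := Set.mem_iUnion.mp hy'
    obtain ⟨_, ⟨x, rfl⟩, hx, hx'⟩ := mem_closure_iff.mp hi _
      h.gluedLift.isOpenEmbedding.isOpen_range hy
    have e : π (h.gluedLift x) = gluedToToric x :=
      congrArg (fun f : gluedSpace ⟶ toricSurface => f x) h.gluedLift_comp
    rw [e] at hx hx'
    exact hx' (mem_support_of_mem_toricDivisor hx)
  · intro y hy
    have hy' : ∀ i, y ∉ strictTransform π centre (toricDivisor i) := fun i hi =>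
      hy (Set.mem_iUnion.mpr ⟨i, hi⟩)
    by_cases hπ : ∃ i, π y ∈ Set.range (toricι (rayCone i))
    · obtain ⟨i, hi⟩ := hπ
      obtain ⟨j, k, -, hj, hk, hjk⟩ := h.exists_rayCharts i
      rcases hjk y hi with ⟨x, rfl⟩ | ⟨x, hx, rfl⟩
      · refine ⟨chartι i x, ?_⟩
        rw [← h.chartι_gluedLift hj]
        rfl
      · exact absurd (mem_strictTransform hk hx) (hy' i)
    · obtain ⟨i, hi⟩ := exists_mem_toricDivisor (fun i hi => hπ ⟨i, hi⟩)
      exact absurd (subset_closure (show y ∈ π ⁻¹' (toricDivisor i \ centre.support) from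
        ⟨hi, fun hs => hπ (exists_rayCone_of_mem_support hs)⟩)) (hy' i)

/-- The glued space is the complement of the strict transforms of the toric divisors in the blowing
up of the toric surface at the three points. -/
lemma exists_iso_strictComplement : ∃ (B : Scheme.{0}) (π : B ⟶ toricSurface), IsBlowup π centre ∧
    ∃ e : gluedSpace ≅ (strictComplement π).toScheme,
      torusι ≫ e.hom ≫ (strictComplement π).ι ≫ π = toricTorusι := by
  obtain ⟨B, π, h⟩ := hasBlowup_centre
  have := h.isOpenImmersion_gluedLift
  have hr : Set.range h.gluedLift = Set.range (strictComplement π).ι := by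
    rw [h.range_gluedLift, Scheme.Opens.range_ι]
  refine ⟨B, π, h, IsOpenImmersion.isoOfRangeEq h.gluedLift (strictComplement π).ι hr, ?_⟩
  rw [IsOpenImmersion.isoOfRangeEq_hom_fac_assoc, h.gluedLift_comp, torusι_gluedToToric]

end

end CPSMirror

end

open CPSMirror
theorem mainTheorem4 :
    (∃ (B : Scheme.{0}) (π : B ⟶ toricSurface), IsBlowup π centre ∧
      ∃ e : gluedSpace ≅ (strictComplement π).toScheme,
        torusι ≫ e.hom ≫ (strictComplement π).ι ≫ π = toricTorusι) ∧
    ∃ W : gluedSpace ⟶ affineLine, torusι ≫ W = potential ∧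
      IsProperEllipticFibration W ∧
      (∃ S : Finset ℂ, S.card = 3 ∧ (∀ c ∈ S, IsTypeIOne (fibre W c)) ∧
        ∀ c ∉ S, IsEllipticCurve (fibre W c)) ∧
      (∀ i, IsClosedImmersion (axisι ≫ chartι i) ∧ IsIso (axisι ≫ chartι i ≫ W)) ∧
      (∀ i j, i ≠ j → Disjoint (Set.range (axisι ≫ chartι i)) (Set.range (axisι ≫ chartι j))) ∧
      (Set.range torusι)ᶜ = ⋃ i, Set.range (axisι ≫ chartι i) := by
  -- Supplies the separatedness needed for the axes to be closed.
  have := isProper_gluedPotential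
  exact ⟨exists_iso_strictComplement, gluedPotential, torusι_gluedPotential, isProperEllipticFibration_gluedPotential,
    ⟨criticalValues, card_criticalValues, fun _ => isTypeIOne_fibre, fun _ => isEllipticCurve_fibre⟩,
    fun i => ⟨isClosedImmersion_axisι_chartι i, isIso_axisι_chartι i⟩,
    fun _ _ => disjoint_axes, compl_range_torusι⟩
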